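/- **Setting.** Let $x_B=(x_B^0,\mathbf x_B)$ be a fixed reception event, $U\subset\mathbb R^3$ open, containing $\mathbf x_B$ and star-shaped about it, and $\mathcal O\subset\mathbb R^4$ an open region of spacetime containing the Minkowskian null lines from $x_B$ to the positions in $U$. Let $\eta=\mathrm{diag}(1,-1,-1,-1)$ and let $\bar g^{\mu\nu}=\eta^{\mu\nu}+k^{\mu\nu}+\kappa^{\mu\nu}$ be the contravariant optical metric, where the refractive part $\kappa^{\mu\nu}(x,N_0)$ and the gravitational part $k^{\mu\nu}(x,G)$ are symmetric, smooth in $x\in\mathcal O$ and in the parameter near $0$, and vanish for $N_0=0$, respectively $G=0$. Write $\kappa^{\mu\nu}_{(l)}\propto N_0^l$ and $k^{\mu\nu}_{(l)}\propto G^l$ for the terms of their expansions in powers of the parameters. Repeated spatial indices are summed over $1,2,3$. For $\mathbf x\in U\setminus\{\mathbf x_B\}$ let $\mathcal R_r(\mathbf x)$ be the reception range transfer function: $(x_B^0-\mathcal R_r(\mathbf x),\mathbf x)$ is joined to $x_B$ by a null geodesic of $\bar g$ in $\mathcal O$, depending smoothly on $\mathbf x$. Put $\Delta(\mathbf x)=\mathcal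 R_r(\mathbf x)-|\mathbf x_B-\mathbf x|$. For an emission position $\mathbf x_A$ put $R_{AB}=|\mathbf x_B-\mathbf x_A|$, $\mathbf N_{AB}=(\mathbf x_B-\mathbf x_A)/R_{AB}$, $\mathbf z_-(\lambda)=\mathbf x_B-\lambda R_{AB}\mathbf N_{AB}$, $z_-(\lambda)=(x_B^0-\lambda R_{AB},\mathbf z_-(\lambda))$ and $\widetilde z_-(\lambda)=(x_B^0-\lambda R_{AB}-\Delta(\mathbf z_-(\lambda)),\mathbf z_-(\lambda))$. The gravitational delay $\Delta_g$ is the solution $D=\Delta_g$, for $T=k$, of $$D(\mathbf x_A)=\frac{R_{AB}}2\int_0^1\Big\{(T^{00}-2T^{0i}N_{AB}^i+T^{ij}N_{AB}^iN_{AB}^j)+2(T^{0i}-T^{ij}N_{AB}^j)\,\partial_iD+(\eta^{ij}+T^{ij})\,\partial_iD\,\partial_jD\Big\}d\lambda$$ (for all $\mathbf x_A\in U\setminus\{\mathbf x_B\}$; $T$ taken at $\widetilde z_-(\lambda)$, derivatives at $\mathbf z_-(\lambda)$); the refractive delay $\Delta_r$ is the solution for $T=\kappa$; the coupling delay is $\Delta_{gr}=\Delta-\Delta_g-\Delta_r$.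 *Quasi-Minkowskian regime:* $\Delta,\Delta_g,\Delta_r$ vanish for $N_0=G=0$, and, for $(N_0,G)$ in a fixed neighbourhood of $0$, each has the form $r\,F(r,\mathbf u,N_0,G)$ at $\mathbf x=\mathbf x_B-r\mathbf u$ ($r>0$, $\mathbf u\ne0$) with $F$ smooth up to and across $r=0$. **Orders.** Let $s\ge1$ be any integer (in particular, the ratio of the logarithms of $\Delta_g^{(1)}/R_{AB}$ and $\Delta_r^{(1)}/R_{AB}$ rounded to the nearest integer, if it is positive). Count $N_0$ as order $1$ and $G$ as order $s$, so that $N_0^aG^b$ has order $a+sb$. Let $\Delta^{(l)},\Delta_r^{(l)},\Delta_g^{(l)},\Delta_{gr}^{(l)}$ be the parts of order $l$, $l$, $l+s-1$, $l+s$ of $\Delta,\Delta_r,\Delta_g,\Delta_{gr}$, respectively. Put $$\Phi_-^{(l,m)}(\mathbf x)=\frac{(-1)^m}{m!}\sum_{n_1+\dots+n_m=l-m}\ \prod_{d=1}^m\Delta^{(n_d+1)}(\mathbf x),$$ $$\widehat\kappa^{\mu\nu}_{-(l)}=\kappa^{\mu\nu}_{(l)}+\sum_{m=1}^{l-1}\sum_{n=1}^m\Phi_-^{(m,n)}\partial_0^n\kappa^{\mu\nu}_{(l-m)}\quad(l\ge1),$$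 and, for $l=ps+q\geq s$ with $0\le q<s$, $$\widehat k^{\mu\nu}_{-(l)}=A_{p,q}^{\mu\nu}+\sum_{m=1}^{p-1}\sum_{n=1}^{ms+q}\Phi_-^{(ms+q,n)}\partial_0^nk^{\mu\nu}_{(p-m)},\qquad A_{p,0}^{\mu\nu}=k^{\mu\nu}_{(p)},\quad A_{p,q}^{\mu\nu}=\sum_{n=1}^q\Phi_-^{(q,n)}\partial_0^nk^{\mu\nu}_{(p)}\ (q\ge1).$$ **Theorem.** For every $\mathbf x_A\in U\setminus\{\mathbf x_B\}$ one has the expansions $$\Delta=\sum_{l\ge1}\Delta^{(l)},\quad \Delta_r=\sum_{l\ge1}\Delta_r^{(l)},\quad \Delta_g=\sum_{l\ge1}\Delta_g^{(l)},\quad \Delta_{gr}=\sum_{l\ge1}\Delta_{gr}^{(l)}$$ at $\mathbf x_A$: as asymptotic expansions (under $N_0\to tN_0$, $G\to t^sG$, $t\to0$), and, for each of these functions that is analytic in $(N_0,G)$ at $0$, as convergent series for all sufficiently small $(N_0,G)$. Here, for $l\ge1$, $\Delta^{(l)}=\Delta_r^{(l)}+\Theta(l-s)\Delta_g^{(l-s+1)}+\Theta(l-s-1)\Delta_{gr}^{(l-s)}$,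 where $\Theta(i)=1$ for $i\ge0$ and $0$ otherwise, and $\Delta_{gr}^{(l)}(\mathbf x_A)$ is the sum of the following line integrals, each one being present only when $l$ satisfies the stated bound. All $\widehat\kappa_-$, $\widehat k_-$ are taken at $z_-(\lambda)$ and all derivatives $\partial_i=\partial/\partial x^i$ at $\mathbf z_-(\lambda)$; write $\widehat\kappa_{(m)},\widehat k_{(m)}$ for $\widehat\kappa_{-(m)},\widehat k_{-(m)}$ and $\widehat\kappa^i_{(m)}=\widehat\kappa_{(m)}^{0i}-\widehat\kappa_{(m)}^{ij}N_{AB}^j$, $\widehat k^i_{(m)}=\widehat k_{(m)}^{0i}-\widehat k_{(m)}^{ij}N_{AB}^j$. - $l\ge1$: $R_{AB}\int_0^1\big\{\sum_{m=1}^l\eta^{ij}\partial_i\Delta_r^{(m)}\partial_j\Delta_g^{(l-m+1)}+\sum_{m=1}^l\widehat\kappa^i_{(m)}\partial_i\Delta_g^{(l-m+1)}+\sum_{m=s}^{l+s-1}\widehat k^i_{(m)}\partial_i\Delta_r^{(l+s-m)}\big\}d\lambda$ - $l\ge2$: $R_{AB}\int_0^1\big\{\sum_{m=1}^{l-1}\eta^{ij}\partial_i\Delta_r^{(m)}\partial_j\Delta_{gr}^{(l-m)}+\sum_{m=1}^{l-1}\widehat\kappa^i_{(m)}\partial_i\Delta_{gr}^{(l-m)}+\sum_{m=1}^{l-1}\widehat\kappa^{ij}_{(m)}\sum_{n=1}^{l-m}\partial_i\Delta_r^{(n)}\partial_j\Delta_g^{(l-m-n+1)}+\frac12\sum_{m=s}^{l+s-2}\widehat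 k^{ij}_{(m)}\sum_{n=1}^{l+s-m-1}\partial_i\Delta_r^{(n)}\partial_j\Delta_r^{(l+s-m-n)}\big\}d\lambda$ - $l\ge3$: $R_{AB}\int_0^1\sum_{m=1}^{l-2}\widehat\kappa^{ij}_{(m)}\sum_{n=1}^{l-m-1}\partial_i\Delta_r^{(n)}\partial_j\Delta_{gr}^{(l-m-n)}\,d\lambda$ - $l\ge s+1$: $R_{AB}\int_0^1\big\{\sum_{m=1}^{l-s}\eta^{ij}\partial_i\Delta_g^{(m)}\partial_j\Delta_{gr}^{(l-s-m+1)}+\sum_{m=s}^{l-1}\widehat k^i_{(m)}\partial_i\Delta_{gr}^{(l-m)}+\sum_{m=s}^{l-1}\widehat k^{ij}_{(m)}\sum_{n=1}^{l-m}\partial_i\Delta_r^{(n)}\partial_j\Delta_g^{(l-m-n+1)}+\frac12\sum_{m=1}^{l-s}\widehat\kappa^{ij}_{(m)}\sum_{n=1}^{l-s-m+1}\partial_i\Delta_g^{(n)}\partial_j\Delta_g^{(l-s-m-n+2)}\big\}d\lambda$ - $l\ge s+2$: $\frac{R_{AB}}2\int_0^1\big\{\sum_{m=1}^{l-s-1}\eta^{ij}\partial_i\Delta_{gr}^{(m)}\partial_j\Delta_{gr}^{(l-s-m)}+2\sum_{m=s}^{l-2}\widehat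 k^{ij}_{(m)}\sum_{n=1}^{l-m-1}\partial_i\Delta_r^{(n)}\partial_j\Delta_{gr}^{(l-m-n)}+2\sum_{m=1}^{l-s-1}\widehat\kappa^{ij}_{(m)}\sum_{n=1}^{l-s-m}\partial_i\Delta_g^{(n)}\partial_j\Delta_{gr}^{(l-s-m-n+1)}\big\}d\lambda$ - $l\ge s+3$: $\frac{R_{AB}}2\int_0^1\sum_{m=1}^{l-s-2}\widehat\kappa^{ij}_{(m)}\sum_{n=1}^{l-s-m-1}\partial_i\Delta_{gr}^{(n)}\partial_j\Delta_{gr}^{(l-s-m-n)}\,d\lambda$ - $l\ge 2s+1$: $R_{AB}\int_0^1\sum_{m=s}^{l-s-1}\widehat k^{ij}_{(m)}\sum_{n=1}^{l-s-m}\partial_i\Delta_g^{(n)}\partial_j\Delta_{gr}^{(l-s-m-n+1)}\,d\lambda$ - $l\ge 2s+2$: $\frac{R_{AB}}2\int_0^1\sum_{m=s}^{l-s-2}\widehat k^{ij}_{(m)}\sum_{n=1}^{l-s-m-1}\partial_i\Delta_{gr}^{(n)}\partial_j\Delta_{gr}^{(l-s-m-n)}\,d\lambda$ -/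

import Mathlib

open scoped ContDiff Topology

noncomputable section

namespace OpticalDelay

/-- Spatial positions, with the Euclidean norm. -/
abbrev Position := EuclideanSpace ℝ (Fin 3)

/-- Point events of spacetime; index `0` is the time coordinate `x⁰`. -/
abbrev Event := Fin 4 → ℝ

/-- Components `T^{μν}` of a contravariant 2-tensor at a point event. -/
abbrev Tensor := Fin 4 → Fin 4 → ℝ

/-- The point event with components `(t, x)`. -/
def event (t : ℝ) (x : Position) : Event := Matrix.vecCons t (fun i => x i)

/-- The Minkowski metric `diag(1, -1, -1, -1)`. -/
def eta : Tensor := fun μ ν => if μ = ν then (if μ = 0 then 1 else -1) else 0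

/-- The range of each of the two expansion parameters. -/
def params (δ : ℝ) : Set (ℝ × ℝ) := Set.Ioo (-δ) δ ×ˢ Set.Ioo (-δ) δ

/-- A smooth one-parameter family of symmetric contravariant metric perturbations on the region `O`
of spacetime, which vanishes for the parameter value `0`. -/
structure IsPerturbation (δ : ℝ) (O : Set Event) (T : ℝ → Event → Tensor) : Prop where
  smooth : ∀ μ ν, ContDiffOn ℝ ∞ (fun q : ℝ × Event => T q.1 q.2 μ ν) (Set.Ioo (-δ) δ ×ˢ O)
  symm : ∀ a ∈ Set.Ioo (-δ) δ, ∀ z ∈ O, ∀ μ ν, T a z μ ν = T a z ν μ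
  zero : ∀ z ∈ O, T 0 z = 0

/-- The contravariant optical metric `η + k + κ` for the parameters `q = (N₀, G)`. -/
def opticalMetric (κ k : ℝ → Event → Tensor) (q : ℝ × ℝ) : Event → Tensor :=
  fun z μ ν => eta μ ν + k q.2 z μ ν + κ q.1 z μ ν

/-- A light ray of the contravariant metric `g`, on the parameter interval `[0, 1]`: a null geodesic
in its canonical (Hamiltonian) form, with nonzero wave covector `p`. -/
structure IsLightRay (g : Event → Tensor) (X : ℝ → Event) (p : ℝ → Fin 4 → ℝ) : Prop where
  velocity : ∀ σ ∈ Set.Icc (0 : ℝ) 1, ∀ μ,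
    HasDerivWithinAt (fun τ => X τ μ) (∑ ν, g (X σ) μ ν * p σ ν) (Set.Icc 0 1) σ
  covector : ∀ σ ∈ Set.Icc (0 : ℝ) 1, ∀ μ,
    HasDerivWithinAt (fun τ => p τ μ)
      (-(1 / 2) * ∑ α, ∑ β,
        fderiv ℝ (fun z : Event => g z α β) (X σ) (Pi.single μ 1) * p σ α * p σ β)
      (Set.Icc 0 1) σ
  null : ∀ σ ∈ Set.Icc (0 : ℝ) 1, ∑ μ, ∑ ν, g (X σ) μ ν * p σ μ * p σ ν = 0
  nonzero : ∀ σ ∈ Set.Icc (0 : ℝ) 1, p σ ≠ 0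

/-- `R` is a reception range transfer function for the reception event `(tB, xB)`: the event
`(tB - R x, x)` is joined to `(tB, xB)` by a light ray inside the region `O`, and the rays depend
smoothly on the position `x` of emission. -/
def IsReceptionRange (g : Event → Tensor) (O : Set Event) (U : Set Position)
    (tB : ℝ) (xB : Position) (R : Position → ℝ) : Prop :=
  ∃ (J : Set ℝ) (X : ℝ → Position → Event) (p : ℝ → Position → Fin 4 → ℝ),
    IsOpen J ∧ Set.Icc 0 1 ⊆ J ∧
    ContDiffOn ℝ 2 (fun w : ℝ × Position => X w.1 w.2) (J ×ˢ (U \ {xB})) ∧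
    ContDiffOn ℝ 2 (fun w : ℝ × Position => p w.1 w.2) (J ×ˢ (U \ {xB})) ∧
    ∀ x ∈ U \ {xB},
      IsLightRay g (fun σ => X σ x) (fun σ => p σ x) ∧
      (∀ σ ∈ Set.Icc (0 : ℝ) 1, X σ x ∈ O) ∧
      X 0 x = event (tB - R x) x ∧ X 1 x = event tB xB

/-- Regularity of a delay function (of the position `x` and of the parameters `q`): in polar
coordinates `x = xB - r u` about the place of reception it is `r` times a function which is smooth
up to and across `r = 0`. In particular (`r = 1`) it is smooth for `x ≠ xB`, and it tends to `0` at
`xB` with bounded gradient. -/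
def IsRegularDelay (δ : ℝ) (U : Set Position) (xB : Position) (D : Position → ℝ × ℝ → ℝ) : Prop :=
  ∃ F : ℝ × Position × (ℝ × ℝ) → ℝ,
    ContDiffOn ℝ ∞ F {w | w.2.1 ≠ 0 ∧ xB - w.1 • w.2.1 ∈ U ∧ w.2.2 ∈ params δ} ∧
    ∀ (r : ℝ) (u : Position) (q : ℝ × ℝ), 0 < r → u ≠ 0 → xB - r • u ∈ U → q ∈ params δ →
      D (xB - r • u) q = r * F (r, u, q)

/-- The components `∂f/∂xⁱ` at `x`. -/
def grad (f : Position → ℝ) (x : Position) (i : Fin 3) : ℝ :=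
  fderiv ℝ f x (EuclideanSpace.single i 1)

/-- The unit vector `N_AB`. -/
def dir (xA xB : Position) : Position := (‖xB - xA‖)⁻¹ • (xB - xA)

/-- The segment `z₋(l) = x_B - l R_AB N_AB` in space. -/
def segment (xA xB : Position) (l : ℝ) : Position := xB - (l * ‖xB - xA‖) • dir xA xB

/-- The Minkowskian null line `z₋(l) = (x⁰_B - l R_AB, z₋(l))`. -/
def nullLine (tB : ℝ) (xA xB : Position) (l : ℝ) : Event :=
  event (tB - l * ‖xB - xA‖) (segment xA xB l)

/-- The path `z̃₋(l) = (x⁰_B - l R_AB - Δ(z₋(l)), z₋(l))`. -/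
def delayedLine (tB : ℝ) (xA xB : Position) (Δ : Position → ℝ) (l : ℝ) : Event :=
  event (tB - l * ‖xB - xA‖ - Δ (segment xA xB l)) (segment xA xB l)

/-- `T⁰⁰ - 2 T⁰ⁱ Nⁱ + Tⁱʲ Nⁱ Nʲ`. -/
def contr0 (T : Tensor) (N : Position) : ℝ :=
  T 0 0 - 2 * ∑ i : Fin 3, T 0 i.succ * N i
    + ∑ i : Fin 3, ∑ j : Fin 3, T i.succ j.succ * N i * N j

/-- `(T⁰ⁱ - Tⁱʲ Nʲ) aᵢ`. -/
def contr1 (T : Tensor) (N : Position) (a : Fin 3 → ℝ) : ℝ :=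
  ∑ i : Fin 3, (T 0 i.succ - ∑ j : Fin 3, T i.succ j.succ * N j) * a i

/-- `Tⁱʲ aᵢ bⱼ`. -/
def contr2 (T : Tensor) (a b : Fin 3 → ℝ) : ℝ :=
  ∑ i : Fin 3, ∑ j : Fin 3, T i.succ j.succ * a i * b j

/-- The integrodifferential equation that defines the delay function `D` caused by the metric
perturbation `T` alone, along the path of the total delay `Δ`. It is the definition of the
gravitational delay for `T = k` and of the refractive delay for `T = κ`. -/
def SolvesDelayEquation (T : Event → Tensor) (U : Set Position) (tB : ℝ) (xB : Position)
    (Δ D : Position → ℝ) : Prop :=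
  ∀ x ∈ U \ {xB},
    D x = ‖xB - x‖ / 2 * ∫ l in (0 : ℝ)..1,
      (contr0 (T (delayedLine tB x xB Δ l)) (dir x xB)
        + 2 * contr1 (T (delayedLine tB x xB Δ l)) (dir x xB) (grad D (segment x xB l))
        + contr2 (eta + T (delayedLine tB x xB Δ l))
            (grad D (segment x xB l)) (grad D (segment x xB l)))

/-- The part of order `n` of a function `f` of the parameters `q = (N₀, G)` in which `N₀` counts
for order `1` and `G` for order `s`: the sum of all terms of the Taylor series of `f` at `0` that
are proportional to `N₀ᵃ Gᵇ` with `a + s b = n`. -/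
def orderTerm (s n : ℕ) (f : ℝ × ℝ → ℝ) (q : ℝ × ℝ) : ℝ :=
  iteratedDeriv n (fun t : ℝ => f (t * q.1, t ^ s * q.2)) 0 / n.factorial

/-- `f = ∑_{l ≥ 1} f^{(l)}`, where `f^{(l)}` is the part of `f` of order `l + w`: as an asymptotic
expansion, and as a convergent series for small parameters if `f` is analytic in them. -/
def HasExpansion (s w : ℕ) (f : ℝ × ℝ → ℝ) : Prop :=
  (∀ (q : ℝ × ℝ) (L : ℕ),
    (fun t : ℝ => f (t * q.1, t ^ s * q.2)
        - ∑ l ∈ Finset.range L, orderTerm s (l + 1 + w) f q * t ^ (l + 1 + w))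
      =O[𝓝 0] fun t : ℝ => t ^ (L + 1 + w)) ∧
  (AnalyticAt ℝ f 0 →
    ∀ᶠ q in 𝓝 (0 : ℝ × ℝ), HasSum (fun l : ℕ => orderTerm s (l + 1 + w) f q) (f q))

/-- `T_{(l)}`, the term proportional to `aˡ` of the expansion of a perturbation in powers of its
parameter `a`. -/
def powerTerm (T : ℝ → Event → Tensor) (a : ℝ) (l : ℕ) : Event → Tensor :=
  fun z μ ν => a ^ l / l.factorial * iteratedDeriv l (fun b => T b z μ ν) 0

/-- `∂ⁿT/(∂x⁰)ⁿ` at the event `(t, x)`. -/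
def timeDeriv (n : ℕ) (T : Event → Tensor) (t : ℝ) (x : Position) : Tensor :=
  fun μ ν => iteratedDeriv n (fun τ => T (event τ x) μ ν) t

/-- The reception function `Φ₋^{(l,m)}` built from the terms `Δ^{(n)}` of the total delay. -/
def receptionFunction (Δ : ℕ → Position → ℝ) (l m : ℕ) (x : Position) : ℝ :=
  (-1) ^ m / m.factorial *
    ∑ n ∈ Finset.Nat.antidiagonalTuple m (l - m), ∏ d : Fin m, Δ (n d + 1) x

/-- `κ̂₋₍ₗ₎` at the event `(t, x)`, built from the terms `κ₍ₗ₎` and `Δ^{(n)}`. -/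
def kappaHat (κ : ℕ → Event → Tensor) (Δ : ℕ → Position → ℝ) (l : ℕ) (t : ℝ) (x : Position) :
    Tensor :=
  κ l (event t x) + ∑ m ∈ Finset.Icc 1 (l - 1), ∑ n ∈ Finset.Icc 1 m,
    receptionFunction Δ m n x • timeDeriv n (κ (l - m)) t x

/-- `k̂₋₍ₗ₎` for `l = p s + q ≥ s` at the event `(t, x)`, built from the terms `k₍ₗ₎` and
`Δ^{(n)}`. -/
def kHat (s : ℕ) (k : ℕ → Event → Tensor) (Δ : ℕ → Position → ℝ) (l : ℕ) (t : ℝ) (x : Position) :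
    Tensor :=
  let p := l / s
  let q := l % s
  (if q = 0 then k p (event t x)
    else ∑ n ∈ Finset.Icc 1 q, receptionFunction Δ q n x • timeDeriv n (k p) t x)
  + ∑ m ∈ Finset.Icc 1 (p - 1), ∑ n ∈ Finset.Icc 1 (m * s + q),
      receptionFunction Δ (m * s + q) n x • timeDeriv n (k (p - m)) t x

/-- The quantities that enter the line integrals, at one point of the line: the direction `N_AB`,
the tensors `κ̂₋₍ₘ₎` and `k̂₋₍ₘ₎`, and the gradients of `Δ_r^{(n)}`, `Δ_g^{(n)}`, `Δ_gr^{(n)}`. -/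
structure LineData where
  N : Position
  κ : ℕ → Tensor
  k : ℕ → Tensor
  r : ℕ → Fin 3 → ℝ
  g : ℕ → Fin 3 → ℝ
  gr : ℕ → Fin 3 → ℝ

open Finset in
/-- Integrand present for `l ≥ 1`. -/
def LineData.int1 (P : LineData) (s l : ℕ) : ℝ :=
  ∑ m ∈ Icc 1 l, contr2 eta (P.r m) (P.g (l - m + 1))
  + ∑ m ∈ Icc 1 l, contr1 (P.κ m) P.N (P.g (l - m + 1))
  + ∑ m ∈ Icc s (l + s - 1), contr1 (P.k m) P.N (P.r (l + s - m))

open Finset in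
/-- Integrand added for `l ≥ 2`. -/
def LineData.int2 (P : LineData) (s l : ℕ) : ℝ :=
  ∑ m ∈ Icc 1 (l - 1), contr2 eta (P.r m) (P.gr (l - m))
  + ∑ m ∈ Icc 1 (l - 1), contr1 (P.κ m) P.N (P.gr (l - m))
  + ∑ m ∈ Icc 1 (l - 1), ∑ n ∈ Icc 1 (l - m), contr2 (P.κ m) (P.r n) (P.g (l - m - n + 1))
  + 1 / 2 * ∑ m ∈ Icc s (l + s - 2), ∑ n ∈ Icc 1 (l + s - m - 1),
      contr2 (P.k m) (P.r n) (P.r (l + s - m - n))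

open Finset in
/-- Integrand added for `l ≥ 3`. -/
def LineData.int3 (P : LineData) (l : ℕ) : ℝ :=
  ∑ m ∈ Icc 1 (l - 2), ∑ n ∈ Icc 1 (l - m - 1), contr2 (P.κ m) (P.r n) (P.gr (l - m - n))

open Finset in
/-- Integrand added for `l ≥ s + 1`. -/
def LineData.int4 (P : LineData) (s l : ℕ) : ℝ :=
  ∑ m ∈ Icc 1 (l - s), contr2 eta (P.g m) (P.gr (l - s - m + 1))
  + ∑ m ∈ Icc s (l - 1), contr1 (P.k m) P.N (P.gr (l - m))
  + ∑ m ∈ Icc s (l - 1), ∑ n ∈ Icc 1 (l - m), contr2 (P.k m) (P.r n) (P.g (l - m - n + 1))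
  + 1 / 2 * ∑ m ∈ Icc 1 (l - s), ∑ n ∈ Icc 1 (l - s - m + 1),
      contr2 (P.κ m) (P.g n) (P.g (l - s - m + 2 - n))

open Finset in
/-- Integrand added for `l ≥ s + 2`. -/
def LineData.int5 (P : LineData) (s l : ℕ) : ℝ :=
  ∑ m ∈ Icc 1 (l - s - 1), contr2 eta (P.gr m) (P.gr (l - s - m))
  + 2 * ∑ m ∈ Icc s (l - 2), ∑ n ∈ Icc 1 (l - m - 1),
      contr2 (P.k m) (P.r n) (P.gr (l - m - n))
  + 2 * ∑ m ∈ Icc 1 (l - s - 1), ∑ n ∈ Icc 1 (l - s - m),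
      contr2 (P.κ m) (P.g n) (P.gr (l - s - m - n + 1))

open Finset in
/-- Integrand added for `l ≥ s + 3`. -/
def LineData.int6 (P : LineData) (s l : ℕ) : ℝ :=
  ∑ m ∈ Icc 1 (l - s - 2), ∑ n ∈ Icc 1 (l - s - m - 1),
    contr2 (P.κ m) (P.gr n) (P.gr (l - s - m - n))

open Finset in
/-- Integrand added for `l ≥ 2 s + 1`. -/
def LineData.int7 (P : LineData) (s l : ℕ) : ℝ :=
  ∑ m ∈ Icc s (l - s - 1), ∑ n ∈ Icc 1 (l - s - m),
    contr2 (P.k m) (P.g n) (P.gr (l - s - m - n + 1))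

open Finset in
/-- Integrand added for `l ≥ 2 s + 2`. -/
def LineData.int8 (P : LineData) (s l : ℕ) : ℝ :=
  ∑ m ∈ Icc s (l - s - 2), ∑ n ∈ Icc 1 (l - s - m - 1),
    contr2 (P.k m) (P.gr n) (P.gr (l - s - m - n))

/-- The line-integral expression for `Δ_gr^{(l)}`, for a distance `R` and the data `P` along the
Minkowskian null line. -/
def couplingIntegral (R : ℝ) (P : ℝ → LineData) (s l : ℕ) : ℝ :=
  R * (∫ t in (0 : ℝ)..1, (P t).int1 s l)
  + (if 2 ≤ l then R * ∫ t in (0 : ℝ)..1, (P t).int2 s l else 0)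
  + (if 3 ≤ l then R * ∫ t in (0 : ℝ)..1, (P t).int3 l else 0)
  + (if s + 1 ≤ l then R * ∫ t in (0 : ℝ)..1, (P t).int4 s l else 0)
  + (if s + 2 ≤ l then R / 2 * ∫ t in (0 : ℝ)..1, (P t).int5 s l else 0)
  + (if s + 3 ≤ l then R / 2 * ∫ t in (0 : ℝ)..1, (P t).int6 s l else 0)
  + (if 2 * s + 1 ≤ l then R * ∫ t in (0 : ℝ)..1, (P t).int7 s l else 0)
  + (if 2 * s + 2 ≤ l then R / 2 * ∫ t in (0 : ℝ)..1, (P t).int8 s l else 0)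

/-- The data along the Minkowskian null line from `(tB, xB)` towards `xA`, for the parameters
`q = (N₀, G)` and the delay functions `Δ`, `Δr`, `Δg`, `Δgr`. The terms of index `l` of `Δ`, `Δr`,
`Δg`, `Δgr` have order `l`, `l`, `l + s - 1`, `l + s`, respectively. -/
def lineData (s : ℕ) (κ k : ℝ → Event → Tensor) (q : ℝ × ℝ) (tB : ℝ) (xA xB : Position)
    (Δ Δr Δg Δgr : Position → ℝ × ℝ → ℝ) (t : ℝ) : LineData where
  N := dir xA xB
  κ := fun m => kappaHat (powerTerm κ q.1) (fun n x => orderTerm s n (Δ x) q) m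
    (tB - t * ‖xB - xA‖) (segment xA xB t)
  k := fun m => kHat s (powerTerm k q.2) (fun n x => orderTerm s n (Δ x) q) m
    (tB - t * ‖xB - xA‖) (segment xA xB t)
  r := fun n => grad (fun x => orderTerm s n (Δr x) q) (segment xA xB t)
  g := fun n => grad (fun x => orderTerm s (n + s - 1) (Δg x) q) (segment xA xB t)
  gr := fun n => grad (fun x => orderTerm s (n + s) (Δgr x) q) (segment xA xB t)

end OpticalDelay

end

open OpticalDelay

/-! The substitution `(N₀, G) ↦ (t N₀, tˢ G)` turns the part of order `n` of a function of the
parameters into the `n`-th Taylor coefficient at `t = 0` of a function of one variable. The theorem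
thereby becomes a computation with Taylor series in `t` of germs that also depend on a position.

Geometry. Along a smooth family of null geodesics the contraction `p · ∂X` of the wave covector with
the variation is conserved (`hasDerivAt_covector_variation`). All rays end at the same event, so it
vanishes at reception, hence at emission. There `p` is therefore a multiple of `(1, ∂R)`, and this
covector is null (`IsReceptionRange.eikonal`). With `R = |x_B - x| + Δ` and `∂R = -N + ∂Δ`, the null
condition says that `-2 N · ∂Δ` equals the integrand of the delay equation for `T = κ + k`.
Integration along the segment from `x_B`, where `Δ` tends to `0`, shows that `Δ` solves the delay
equation for the sum of the perturbations (`total_delay_equation`).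

Subtraction. The equations of `Δ`, `Δ_g`, `Δ_r` evaluate their tensors on the same path, that of the
total delay. A polynomial identity between the integrands (`delayDensity_sub`) then leaves an
equation for `Δ_gr` whose integrand is a combination of eight parts.

Expansion. Taylor coefficients in `t` commute with spatial derivatives (`fderiv_taylorCoeff`) and
with integration along the segment (`LineSmooth.taylorCoeff_integral`), and they turn products into
Cauchy products. The coefficients of `κ` and `k` on the delayed path, expanded in the delay about
the Minkowskian null line, are `κ̂` and `k̂` (`taylorCoeff_delayed_eq_kHat`). The lowest orders
follow by induction from the equations themselves: if the terms of `Δ_g` of order less than `n < s`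
vanish, the integrand has no term of order `n` either. The same argument works for `Δ_gr` and `n ≤
s`. These bounds fix the ranges of all sums (`taylorCoeff_couplingPart`).

The delicate point is the end `l = 0` of the segment, where gradients of delays may depend on the
direction of approach. Polar coordinates extend them smoothly along each single segment, which is
all that the integrals need.

Convergence. For `f` analytic at `0`, expanding each homogeneous term by multilinearity at `q = (0,
G) + (N₀, 0)` gives an absolutely summable family near `0`. Regrouping it by order and comparing
power series in `t` identifies the groups with the parts of `f`. -/

noncomputable section

namespace OpticalDelay

/-! ### Taylor coefficients and jets of germs at `0` -/

/-- The `n`-th Taylor coefficient of `f` at `0`. -/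
def taylorCoeff (n : ℕ) (f : ℝ → ℝ) : ℝ := iteratedDeriv n f 0 / n.factorial

/-- The Taylor series of `f` at `0`. -/
def jet (f : ℝ → ℝ) : PowerSeries ℝ := PowerSeries.mk fun n => taylorCoeff n f

/-- Germs of smooth functions at `0`. -/
abbrev SmoothGerm (f : ℝ → ℝ) : Prop := ContDiffAt ℝ ∞ f 0

@[simp] lemma coeff_jet (n : ℕ) (f : ℝ → ℝ) : PowerSeries.coeff n (jet f) = taylorCoeff n f := by
  simp [jet]

lemma SmoothGerm.of_le {f : ℝ → ℝ} (hf : SmoothGerm f) (n : ℕ) : ContDiffAt ℝ n f 0 :=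
  ContDiffAt.of_le hf (by exact_mod_cast le_top)

lemma taylorCoeff_congr {f g : ℝ → ℝ} (h : f =ᶠ[𝓝 0] g) (n : ℕ) :
    taylorCoeff n f = taylorCoeff n g := by
  rw [taylorCoeff, taylorCoeff, h.iteratedDeriv_eq n]

lemma jet_congr {f g : ℝ → ℝ} (h : f =ᶠ[𝓝 0] g) : jet f = jet g := by
  ext n; simp [taylorCoeff_congr h]

lemma taylorCoeff_zero (f : ℝ → ℝ) : taylorCoeff 0 f = f 0 := by simp [taylorCoeff]

lemma jet_add {f g : ℝ → ℝ} (hf : SmoothGerm f) (hg : SmoothGerm g) :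
    jet (fun t => f t + g t) = jet f + jet g := by
  ext n
  simp [taylorCoeff, iteratedDeriv_fun_add (hf.of_le n) (hg.of_le n), add_div]

lemma jet_const_mul (c : ℝ) (f : ℝ → ℝ) :
    jet (fun t => c * f t) = PowerSeries.C c * jet f := by
  ext n
  simp [taylorCoeff, iteratedDeriv_const_mul_field, mul_div_assoc]

lemma jet_mul_const (c : ℝ) (f : ℝ → ℝ) :
    jet (fun t => f t * c) = jet f * PowerSeries.C c := by
  simp_rw [mul_comm _ c, jet_const_mul, mul_comm]

lemma jet_const (c : ℝ) : jet (fun _ => c) = PowerSeries.C c := by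
  ext n
  simp only [coeff_jet, taylorCoeff, PowerSeries.coeff_C, iteratedDeriv_const]
  rcases n with _ | n <;> simp

lemma jet_neg (f : ℝ → ℝ) : jet (fun t => -f t) = -jet f := by
  ext n
  simp [taylorCoeff, iteratedDeriv_fun_neg, neg_div]

lemma jet_sub {f g : ℝ → ℝ} (hf : SmoothGerm f) (hg : SmoothGerm g) :
    jet (fun t => f t - g t) = jet f - jet g := by
  simp_rw [sub_eq_add_neg, jet_add hf hg.neg, jet_neg]

lemma jet_mul {f g : ℝ → ℝ} (hf : SmoothGerm f) (hg : SmoothGerm g) :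
    jet (fun t => f t * g t) = jet f * jet g := by
  ext n
  rw [coeff_jet, taylorCoeff, iteratedDeriv_fun_mul (hf.of_le n) (hg.of_le n),
    PowerSeries.coeff_mul, Finset.sum_div,
    Finset.Nat.sum_antidiagonal_eq_sum_range_succ_mk]
  refine Finset.sum_congr rfl fun i hi => ?_
  have hi : i ≤ n := Nat.lt_succ_iff.1 (Finset.mem_range.1 hi)
  simp only [coeff_jet, taylorCoeff]
  rw [Nat.cast_choose ℝ hi]
  have := Nat.factorial_ne_zero n
  field_simp

lemma jet_sum {ι : Type*} (S : Finset ι) {f : ι → ℝ → ℝ} (hf : ∀ i ∈ S, SmoothGerm (f i)) :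
    jet (fun t => ∑ i ∈ S, f i t) = ∑ i ∈ S, jet (f i) := by
  ext n
  simp [taylorCoeff, iteratedDeriv_fun_sum fun i hi => (hf i hi).of_le n, Finset.sum_div]

lemma SmoothGerm.deriv {f : ℝ → ℝ} (hf : SmoothGerm f) : SmoothGerm (deriv f) := by
  have h : ContDiffAt ℝ ∞ (fun t => fderiv ℝ f t 1) 0 :=
    (hf.fderiv_right (m := ∞) (by simp)).clm_apply contDiffAt_const
  simpa using h

lemma taylorCoeff_deriv (f : ℝ → ℝ) (n : ℕ) :
    taylorCoeff n (deriv f) = (n + 1) * taylorCoeff (n + 1) f := by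
  rw [taylorCoeff, taylorCoeff, iteratedDeriv_succ', Nat.factorial_succ]
  push_cast
  have := Nat.factorial_ne_zero n
  field_simp

/-- The Taylor coefficients of the identity to a power. -/
lemma jet_id_pow (m : ℕ) : jet (fun t => t ^ m) = PowerSeries.X ^ m := by
  ext n
  rw [coeff_jet, taylorCoeff, iteratedDeriv_fun_pow_zero, PowerSeries.coeff_X_pow]
  split_ifs with h
  · subst h; exact div_self (by exact_mod_cast Nat.factorial_ne_zero n)
  · simp

/-- **Taylor's theorem** for germs. -/
lemma SmoothGerm.taylor_isBigO {f : ℝ → ℝ} (hf : SmoothGerm f) (M : ℕ) :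
    (fun t => f t - ∑ n ∈ Finset.range M, taylorCoeff n f * t ^ n) =O[𝓝 0] fun t => t ^ M := by
  obtain ⟨u, hu, hfu⟩ := (hf.of_le M).contDiffOn le_rfl (by simp)
  obtain ⟨ε, hε, hball⟩ := Metric.mem_nhds_iff.1 hu
  have h0 : (0 : ℝ) ∈ Metric.ball (0 : ℝ) ε := Metric.mem_ball_self hε
  have hf' : ContDiffOn ℝ M f (Metric.ball 0 ε) := hfu.mono hball
  have h := taylor_isLittleO (convex_ball (0 : ℝ) ε) h0 hf'
  rw [nhdsWithin_eq_nhds.2 (Metric.ball_mem_nhds 0 hε)] at h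
  have key : ∀ n, iteratedDerivWithin n f (Metric.ball 0 ε) 0 = iteratedDeriv n f 0 :=
    fun n => iteratedDerivWithin_of_isOpen Metric.isOpen_ball h0
  -- The Peano remainder belongs to the polynomial of degree `M`; the sum in the statement stops at
  -- degree `M - 1`, so the last term is moved into the error.
  have h2 : (fun t => taylorCoeff M f * t ^ M) =O[𝓝 0] fun t : ℝ => t ^ M :=
    (Asymptotics.isBigO_refl _ _).const_mul_left _
  have h3 := (h.isBigO.congr_right (g₂ := fun t : ℝ => t ^ M) (by simp)).add h2
  refine h3.congr_left fun t => ?_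
  simp only [taylor_within_apply, key, sub_zero, smul_eq_mul, Finset.sum_range_succ, taylorCoeff]
  have : ∀ n, (n.factorial : ℝ)⁻¹ * t ^ n * iteratedDeriv n f 0
      = iteratedDeriv n f 0 / n.factorial * t ^ n := fun n => by ring
  simp only [this]; ring

/-! ### Commuting derivatives in several variables -/

section DirDeriv

variable {W : Type*} [NormedAddCommGroup W] [NormedSpace ℝ W]

/-- The derivative of `Ψ` in the direction `a`. -/
def dirDeriv (a : W) (Ψ : W → ℝ) : W → ℝ := fun w => fderiv ℝ Ψ w a

lemma ContDiffOn.dirDeriv {Ω : Set W} (hΩ : IsOpen Ω) {Ψ : W → ℝ} (hΨ : ContDiffOn ℝ ∞ Ψ Ω)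
    (a : W) : ContDiffOn ℝ ∞ (dirDeriv a Ψ) Ω :=
  (hΨ.fderiv_of_isOpen hΩ (m := ∞) (by simp)).clm_apply contDiffOn_const

lemma ContDiffOn.dirDeriv_iterate {Ω : Set W} (hΩ : IsOpen Ω) {Ψ : W → ℝ}
    (hΨ : ContDiffOn ℝ ∞ Ψ Ω) (a : W) (n : ℕ) :
    ContDiffOn ℝ ∞ ((OpticalDelay.dirDeriv a)^[n] Ψ) Ω := by
  induction n with
  | zero => exact hΨ
  | succ n ih => rw [Function.iterate_succ_apply']; exact ContDiffOn.dirDeriv hΩ ih a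

lemma dirDeriv_congr {Ω : Set W} (hΩ : IsOpen Ω) {Ψ Ψ' : W → ℝ} (h : Set.EqOn Ψ Ψ' Ω) (a : W) :
    Set.EqOn (dirDeriv a Ψ) (dirDeriv a Ψ') Ω := fun w hw => by
  rw [dirDeriv, dirDeriv, (h.eventuallyEq_of_mem (hΩ.mem_nhds hw)).fderiv_eq]

/-- Both sides are values of the second derivative, which is symmetric. This is the source of every
interchange of Taylor coefficients with derivatives below. -/
lemma dirDeriv_comm {Ω : Set W} (hΩ : IsOpen Ω) {Ψ : W → ℝ} (hΨ : ContDiffOn ℝ 2 Ψ Ω)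
    (a b : W) : Set.EqOn (dirDeriv a (dirDeriv b Ψ)) (dirDeriv b (dirDeriv a Ψ)) Ω := by
  intro w hw
  have hc : ContDiffAt ℝ 2 Ψ w := hΨ.contDiffAt (hΩ.mem_nhds hw)
  have hd : DifferentiableAt ℝ (fderiv ℝ Ψ) w :=
    (hc.fderiv_right (m := 1) (by norm_num)).differentiableAt (by simp)
  have key : ∀ c d : W, dirDeriv c (dirDeriv d Ψ) w = fderiv ℝ (fderiv ℝ Ψ) w c d := by
    intro c d
    have := (hd.hasFDerivAt.clm_apply (hasFDerivAt_const d w)).fderiv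
    change fderiv ℝ (fun y => fderiv ℝ Ψ y d) w c = _
    rw [this]
    simp
  rw [key, key]
  exact (hc.isSymmSndFDerivAt (by simp)).eq a b

lemma dirDeriv_iterate_comm {Ω : Set W} (hΩ : IsOpen Ω) {Ψ : W → ℝ} (hΨ : ContDiffOn ℝ ∞ Ψ Ω)
    (a b : W) (n : ℕ) :
    Set.EqOn (dirDeriv a ((dirDeriv b)^[n] Ψ)) ((dirDeriv b)^[n] (dirDeriv a Ψ)) Ω := by
  induction n with
  | zero => exact fun w _ => rfl
  | succ n ih =>
    simp_rw [Function.iterate_succ_apply']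
    have h := dirDeriv_comm hΩ
      ((ContDiffOn.dirDeriv_iterate hΩ hΨ b n).of_le (WithTop.coe_le_coe.2 (le_top : (2 : ℕ∞) ≤ ⊤))) a b
    exact fun w hw => (h hw).trans (dirDeriv_congr hΩ ih b hw)

lemma dirDeriv_iterate_iterate_comm {Ω : Set W} (hΩ : IsOpen Ω) {Ψ : W → ℝ}
    (hΨ : ContDiffOn ℝ ∞ Ψ Ω) (a b : W) (m n : ℕ) :
    Set.EqOn ((dirDeriv a)^[m] ((dirDeriv b)^[n] Ψ)) ((dirDeriv b)^[n] ((dirDeriv a)^[m] Ψ)) Ω := by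
  induction m with
  | zero => exact fun w _ => rfl
  | succ m ih =>
    simp_rw [Function.iterate_succ_apply']
    exact fun w hw => (dirDeriv_congr hΩ ih a hw).trans
      (dirDeriv_iterate_comm hΩ (ContDiffOn.dirDeriv_iterate hΩ hΨ a m) a b n hw)

lemma hasDerivAt_line {Ω : Set W} (hΩ : IsOpen Ω) {Ψ : W → ℝ} (hΨ : ContDiffOn ℝ ∞ Ψ Ω)
    {γ : ℝ → W} {a : W} {t : ℝ} (hγ : HasDerivAt γ a t) (ht : γ t ∈ Ω) :
    HasDerivAt (fun t => Ψ (γ t)) (dirDeriv a Ψ (γ t)) t := by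
  have h := ((hΨ.contDiffAt (hΩ.mem_nhds ht)).differentiableAt (by simp)).hasFDerivAt
  exact h.comp_hasDerivAt t hγ

/-- Iterated derivatives along a straight line are iterated directional derivatives. -/
lemma iteratedDeriv_line {Ω : Set W} (hΩ : IsOpen Ω) {Ψ : W → ℝ} (hΨ : ContDiffOn ℝ ∞ Ψ Ω)
    {γ : ℝ → W} {a : W} (hγ : ∀ t, HasDerivAt γ a t) (n : ℕ) {t : ℝ} (ht : γ t ∈ Ω) :
    iteratedDeriv n (fun t => Ψ (γ t)) t = (dirDeriv a)^[n] Ψ (γ t) := by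
  induction n generalizing t with
  | zero => simp
  | succ n ih =>
    have hc : Continuous γ := continuous_iff_continuousAt.2 fun t => (hγ t).continuousAt
    -- Differentiating once more needs the identity near `t`; this is why the induction hypothesis
    -- is kept for every parameter with image in `Ω`.
    have hev : iteratedDeriv n (fun t => Ψ (γ t)) =ᶠ[𝓝 t] fun t => (dirDeriv a)^[n] Ψ (γ t) := by
      filter_upwards [(hΩ.preimage hc).mem_nhds ht] with t' ht' using ih ht'
    rw [iteratedDeriv_succ, hev.deriv_eq, Function.iterate_succ_apply']
    exact (hasDerivAt_line hΩ (ContDiffOn.dirDeriv_iterate hΩ hΨ a n) (hγ t) ht).deriv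

end DirDeriv

/-! ### Taylor coefficients in one factor of a product -/

section Product

lemma eventually_mem_snd {E : Type*} [TopologicalSpace E] {Ω : Set (E × ℝ)} (hΩ : IsOpen Ω) {x : E} {t : ℝ} (h : (x, t) ∈ Ω) :
    ∀ᶠ t' in 𝓝 t, (x, t') ∈ Ω :=
  (Continuous.prodMk_right x).continuousAt.eventually_mem (hΩ.mem_nhds h)

lemma eventually_mem_fst {E : Type*} [TopologicalSpace E] {Ω : Set (E × ℝ)} (hΩ : IsOpen Ω) {x : E} {t : ℝ} (h : (x, t) ∈ Ω) :
    ∀ᶠ x' in 𝓝 x, (x', t) ∈ Ω :=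
  (Continuous.prodMk_left t).continuousAt.eventually_mem (hΩ.mem_nhds h)

variable {E : Type*} [NormedAddCommGroup E] [NormedSpace ℝ E]

lemma hasDerivAt_prodMk_left (x : E) (t : ℝ) :
    HasDerivAt (fun t : ℝ => (x, t)) ((0, 1) : E × ℝ) t :=
  (hasDerivAt_const t x).prodMk (hasDerivAt_id t)

lemma iteratedDeriv_snd {Ω : Set (E × ℝ)} (hΩ : IsOpen Ω) {Ψ : E × ℝ → ℝ}
    (hΨ : ContDiffOn ℝ ∞ Ψ Ω) (n : ℕ) {x : E} {t : ℝ} (h : (x, t) ∈ Ω) :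
    iteratedDeriv n (fun t => Ψ (x, t)) t = (dirDeriv (0, 1))^[n] Ψ (x, t) :=
  iteratedDeriv_line hΩ hΨ (γ := fun t => (x, t)) (hasDerivAt_prodMk_left x) n h

lemma fderiv_fst {Ω : Set (E × ℝ)} (hΩ : IsOpen Ω) {Ψ : E × ℝ → ℝ}
    (hΨ : ContDiffOn ℝ ∞ Ψ Ω) {x : E} {t : ℝ} (h : (x, t) ∈ Ω) (v : E) :
    fderiv ℝ (fun x => Ψ (x, t)) x v = dirDeriv (v, 0) Ψ (x, t) := by
  have h1 := ((hΨ.contDiffAt (hΩ.mem_nhds h)).differentiableAt (by simp)).hasFDerivAt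
  have h2 : HasFDerivAt (fun x : E => (x, t)) (ContinuousLinearMap.inl ℝ E ℝ) x :=
    hasFDerivAt_prodMk_left x t
  have h3 : HasFDerivAt (fun x => Ψ (x, t)) _ x := h1.comp x h2
  rw [h3.fderiv]
  simp [dirDeriv]

/-- Taylor coefficients in one variable commute with derivatives in the other variables. -/
lemma fderiv_taylorCoeff {Ω : Set (E × ℝ)} (hΩ : IsOpen Ω) {Ψ : E × ℝ → ℝ}
    (hΨ : ContDiffOn ℝ ∞ Ψ Ω) (n : ℕ) {x : E} (h : (x, 0) ∈ Ω) (v : E) :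
    fderiv ℝ (fun x => taylorCoeff n fun t => Ψ (x, t)) x v
      = taylorCoeff n fun t => fderiv ℝ (fun x => Ψ (x, t)) x v := by
  -- Up to the factor `1 / n!`, the coefficient is the `n`-fold derivative in direction `(0, 1)`, so
  -- the claim reduces to commuting with direction `(v, 0)`.
  have h1 : (fun x => taylorCoeff n fun t => Ψ (x, t))
      =ᶠ[𝓝 x] fun x => (n.factorial : ℝ)⁻¹ • (dirDeriv (0, 1))^[n] Ψ (x, 0) := by
    filter_upwards [eventually_mem_fst hΩ h] with x' hx'
    rw [taylorCoeff, iteratedDeriv_snd hΩ hΨ n hx', div_eq_inv_mul, smul_eq_mul]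
  have h2 : (fun t => fderiv ℝ (fun x => Ψ (x, t)) x v)
      =ᶠ[𝓝 0] fun t => dirDeriv (v, 0) Ψ (x, t) := by
    filter_upwards [eventually_mem_snd hΩ h] with t ht using fderiv_fst hΩ hΨ ht v
  have hn := ContDiffOn.dirDeriv_iterate hΩ hΨ (0, 1) n
  have hdiff : DifferentiableAt ℝ (fun x => (dirDeriv (0, 1))^[n] Ψ (x, 0)) x :=
    ((hn.contDiffAt (hΩ.mem_nhds h)).differentiableAt (by simp)).comp x
      (hasFDerivAt_prodMk_left x (0 : ℝ)).differentiableAt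
  rw [h1.fderiv_eq, taylorCoeff_congr h2, taylorCoeff,
    iteratedDeriv_snd hΩ (ContDiffOn.dirDeriv hΩ hΨ _) n h, fderiv_fun_const_smul hdiff,
    smul_apply, fderiv_fst hΩ hn h v, dirDeriv_iterate_comm hΩ hΨ _ _ n h,
    smul_eq_mul, div_eq_inv_mul]

/-- Taylor coefficients in one real variable commute with iterated derivatives in another. -/
lemma iteratedDeriv_taylorCoeff {Ω : Set (ℝ × ℝ)} (hΩ : IsOpen Ω) {Ψ : ℝ × ℝ → ℝ}
    (hΨ : ContDiffOn ℝ ∞ Ψ Ω) (m n : ℕ) {x : ℝ} (h : (x, 0) ∈ Ω) :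
    iteratedDeriv m (fun x => taylorCoeff n fun t => Ψ (x, t)) x
      = taylorCoeff n fun t => iteratedDeriv m (fun x => Ψ (x, t)) x := by
  have hline : ∀ t y : ℝ, HasDerivAt (fun y : ℝ => (y, t)) ((1, 0) : ℝ × ℝ) y := fun t y =>
    (hasDerivAt_id y).prodMk (hasDerivAt_const y t)
  have h1 : (fun x => taylorCoeff n fun t => Ψ (x, t))
      =ᶠ[𝓝 x] fun x => (n.factorial : ℝ)⁻¹ * (dirDeriv (0, 1))^[n] Ψ (x, 0) := by
    filter_upwards [eventually_mem_fst hΩ h] with x' hx'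
    rw [taylorCoeff, iteratedDeriv_snd hΩ hΨ n hx', div_eq_inv_mul]
  have h2 : (fun t => iteratedDeriv m (fun x => Ψ (x, t)) x)
      =ᶠ[𝓝 0] fun t => (dirDeriv (1, 0))^[m] Ψ (x, t) := by
    filter_upwards [eventually_mem_snd hΩ h] with t ht
    exact iteratedDeriv_line hΩ hΨ (γ := fun y => (y, t)) (hline t) m ht
  rw [h1.iteratedDeriv_eq m, taylorCoeff_congr h2, taylorCoeff,
    iteratedDeriv_snd hΩ (ContDiffOn.dirDeriv_iterate hΩ hΨ _ m) n h,
    iteratedDeriv_const_mul_field,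
    iteratedDeriv_line hΩ (ContDiffOn.dirDeriv_iterate hΩ hΨ _ n) (γ := fun y => (y, 0))
      (hline 0) m h, dirDeriv_iterate_iterate_comm hΩ hΨ _ _ m n h, div_eq_inv_mul]

end Product

/-! ### Families of germs along a segment -/

/-- A family `f l` (`0 < l ≤ 1`) of germs at `0` which extends to a function of two variables that
is smooth on a neighbourhood of `[0, 1] × {0}`. -/
def LineSmooth (f : ℝ → ℝ → ℝ) : Prop :=
  ∃ (Φ : ℝ × ℝ → ℝ) (Ω : Set (ℝ × ℝ)), IsOpen Ω ∧ (∀ l ∈ Set.Icc (0 : ℝ) 1, (l, (0 : ℝ)) ∈ Ω) ∧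
    ContDiffOn ℝ ∞ Φ Ω ∧ ∀ l t, (l, t) ∈ Ω → 0 < l → l ≤ 1 → f l t = Φ (l, t)

namespace LineSmooth

lemma const (c : ℝ) : LineSmooth fun _ _ => c :=
  ⟨fun _ => c, Set.univ, isOpen_univ, by simp, contDiffOn_const, by simp⟩

/-- Common bookkeeping for the algebraic operations: the two extensions are combined on the
intersection of their domains. -/
lemma map₂ {f g : ℝ → ℝ → ℝ} (hf : LineSmooth f) (hg : LineSmooth g) {op : ℝ → ℝ → ℝ}
    (hop : ∀ (Ω : Set (ℝ × ℝ)) (Φ Ψ : ℝ × ℝ → ℝ), ContDiffOn ℝ ∞ Φ Ω → ContDiffOn ℝ ∞ Ψ Ω →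
      ContDiffOn ℝ ∞ (fun w => op (Φ w) (Ψ w)) Ω) :
    LineSmooth fun l t => op (f l t) (g l t) := by
  obtain ⟨Φ, Ω, h1, h2, h3, h4⟩ := hf
  obtain ⟨Φ', Ω', h1', h2', h3', h4'⟩ := hg
  refine ⟨fun w => op (Φ w) (Φ' w), Ω ∩ Ω', h1.inter h1', fun l hl => ⟨h2 l hl, h2' l hl⟩,
    hop _ _ _ (h3.mono Set.inter_subset_left) (h3'.mono Set.inter_subset_right),
    fun l t h hl hl' => ?_⟩
  simp only [h4 l t h.1 hl hl', h4' l t h.2 hl hl']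

lemma add {f g : ℝ → ℝ → ℝ} (hf : LineSmooth f) (hg : LineSmooth g) :
    LineSmooth fun l t => f l t + g l t := map₂ hf hg fun _ _ _ h h' => h.add h'

lemma sub {f g : ℝ → ℝ → ℝ} (hf : LineSmooth f) (hg : LineSmooth g) :
    LineSmooth fun l t => f l t - g l t := map₂ hf hg fun _ _ _ h h' => h.sub h'

lemma mul {f g : ℝ → ℝ → ℝ} (hf : LineSmooth f) (hg : LineSmooth g) :
    LineSmooth fun l t => f l t * g l t := map₂ hf hg fun _ _ _ h h' => h.mul h'

lemma sum {ι : Type*} (S : Finset ι) {f : ι → ℝ → ℝ → ℝ} (hf : ∀ i, LineSmooth (f i)) :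
    LineSmooth fun l t => ∑ i ∈ S, f i l t := by
  classical
  induction S using Finset.induction_on with
  | empty => simpa using const 0
  | insert a S ha ih => simpa only [Finset.sum_insert ha] using (hf a).add ih

lemma smoothGerm {f : ℝ → ℝ → ℝ} (hf : LineSmooth f) {l : ℝ} (h0 : 0 < l) (h1 : l ≤ 1) :
    SmoothGerm (f l) := by
  obtain ⟨Φ, Ω, hΩ, hmem, hΦ, heq⟩ := hf
  have hl := hmem l ⟨h0.le, h1⟩
  have : ContDiffAt ℝ ∞ (fun t => Φ (l, t)) 0 :=
    (hΦ.contDiffAt (hΩ.mem_nhds hl)).comp 0 (contDiffAt_const.prodMk contDiffAt_id)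
  refine this.congr_of_eventuallyEq ?_
  filter_upwards [eventually_mem_snd hΩ hl] with t ht using heq l t ht h0 h1

/-- The box `[0,1] × (-ε, ε)` on which a family of germs is smooth. -/
lemma exists_box {Ω : Set (ℝ × ℝ)} (hΩ : IsOpen Ω) (h : ∀ l ∈ Set.Icc (0 : ℝ) 1, (l, (0 : ℝ)) ∈ Ω) :
    ∃ ε > 0, ∀ l ∈ Set.Icc (0 : ℝ) 1, ∀ t ∈ Metric.closedBall (0 : ℝ) ε, (l, t) ∈ Ω := by
  obtain ⟨u, v, hu, hv, hu', hv', huv⟩ := generalized_tube_lemma (s := Set.Icc (0 : ℝ) 1)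
    isCompact_Icc (t := {(0 : ℝ)}) isCompact_singleton hΩ (by
      rintro ⟨l, t⟩ ⟨hl, ht⟩
      obtain rfl : t = 0 := ht
      exact h l hl)
  obtain ⟨ε, hε, hb⟩ := Metric.nhds_basis_closedBall.mem_iff.1 (hv.mem_nhds (hv' rfl))
  exact ⟨ε, hε, fun l hl t ht => huv ⟨hu' hl, hb ht⟩⟩

/-- The family agrees with its extension only for `0 < l`, so the equality is on `(0, 1]`. That
suffices for integrals, and the right-hand side is continuous up to `l = 0`. -/
lemma taylorCoeff_eqOn {f : ℝ → ℝ → ℝ} {Φ : ℝ × ℝ → ℝ} {Ω : Set (ℝ × ℝ)} (hΩ : IsOpen Ω)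
    (hmem : ∀ l ∈ Set.Icc (0 : ℝ) 1, (l, (0 : ℝ)) ∈ Ω) (hΦ : ContDiffOn ℝ ∞ Φ Ω)
    (heq : ∀ l t, (l, t) ∈ Ω → 0 < l → l ≤ 1 → f l t = Φ (l, t)) (n : ℕ) :
    Set.EqOn (fun l => taylorCoeff n (f l))
      (fun l => (dirDeriv (0, 1))^[n] Φ (l, 0) / n.factorial) (Set.uIoc 0 1) := by
  intro l hl
  rw [Set.uIoc_of_le zero_le_one] at hl
  have hl' := hmem l ⟨hl.1.le, hl.2⟩
  have : f l =ᶠ[𝓝 0] fun t => Φ (l, t) := by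
    filter_upwards [eventually_mem_snd hΩ hl'] with t ht using heq l t ht hl.1 hl.2
  change taylorCoeff n (f l) = _
  rw [taylorCoeff_congr this, taylorCoeff, iteratedDeriv_snd hΩ hΦ n hl']

lemma continuousOn_section {Φ : ℝ × ℝ → ℝ} {Ω : Set (ℝ × ℝ)} (hΦ : ContinuousOn Φ Ω) {t : ℝ}
    (h : ∀ l ∈ Set.Icc (0 : ℝ) 1, (l, t) ∈ Ω) :
    IntervalIntegrable (fun l => Φ (l, t)) MeasureTheory.volume 0 1 := by
  apply ContinuousOn.intervalIntegrable
  rw [Set.uIcc_of_le zero_le_one]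
  exact hΦ.comp (by fun_prop) h

lemma intervalIntegrable_taylorCoeff {f : ℝ → ℝ → ℝ} (hf : LineSmooth f) (n : ℕ) :
    IntervalIntegrable (fun l => taylorCoeff n (f l)) MeasureTheory.volume 0 1 := by
  obtain ⟨Φ, Ω, hΩ, hmem, hΦ, heq⟩ := hf
  refine IntervalIntegrable.congr (taylorCoeff_eqOn hΩ hmem hΦ heq n).symm ?_
  exact (continuousOn_section (ContDiffOn.dirDeriv_iterate hΩ hΦ _ n).continuousOn hmem).div_const _

/-- Differentiation under the integral sign, dominated by the maximum of the derivative on the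
compact box `[0, 1] × [-ε, ε]`. -/
lemma hasDerivAt_integral {Φ : ℝ × ℝ → ℝ} {Ω : Set (ℝ × ℝ)} (hΩ : IsOpen Ω)
    (hΦ : ContDiffOn ℝ ∞ Φ Ω) {ε : ℝ}
    (hbox : ∀ l ∈ Set.Icc (0 : ℝ) 1, ∀ t ∈ Metric.closedBall (0 : ℝ) ε, (l, t) ∈ Ω) {t : ℝ}
    (ht : t ∈ Metric.ball (0 : ℝ) ε) :
    HasDerivAt (fun t => ∫ l in (0 : ℝ)..1, Φ (l, t))
      (∫ l in (0 : ℝ)..1, dirDeriv (0, 1) Φ (l, t)) t := by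
  have hd := ContDiffOn.dirDeriv hΩ hΦ (0, 1)
  have hK : IsCompact (Set.Icc (0 : ℝ) 1 ×ˢ Metric.closedBall (0 : ℝ) ε) :=
    isCompact_Icc.prod (isCompact_closedBall _ _)
  obtain ⟨C, hC⟩ := hK.exists_bound_of_continuousOn
    (hd.continuousOn.mono fun w hw => hbox w.1 hw.1 w.2 hw.2)
  have hsub : ∀ l ∈ Set.uIoc (0 : ℝ) 1, l ∈ Set.Icc (0 : ℝ) 1 := fun l hl => by
    rw [Set.uIoc_of_le zero_le_one] at hl; exact ⟨hl.1.le, hl.2⟩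
  refine (intervalIntegral.hasDerivAt_integral_of_dominated_loc_of_deriv_le
    (F := fun t l => Φ (l, t)) (F' := fun t l => dirDeriv (0, 1) Φ (l, t)) (bound := fun _ => C)
    (Metric.isOpen_ball.mem_nhds ht) ?_ ?_ ?_ ?_ ?_ ?_).2
  · filter_upwards [Metric.isOpen_ball.mem_nhds ht] with t' ht'
    have := (continuousOn_section hΦ.continuousOn fun l hl =>
      hbox l hl t' (Metric.ball_subset_closedBall ht')).aestronglyMeasurable
    rwa [Set.uIoc_of_le zero_le_one]
  · exact continuousOn_section hΦ.continuousOn fun l hl =>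
      hbox l hl t (Metric.ball_subset_closedBall ht)
  · have := (continuousOn_section hd.continuousOn fun l hl =>
      hbox l hl t (Metric.ball_subset_closedBall ht)).aestronglyMeasurable
    rwa [Set.uIoc_of_le zero_le_one]
  · exact Filter.Eventually.of_forall fun l hl t' ht' =>
      hC (l, t') ⟨hsub l hl, Metric.ball_subset_closedBall ht'⟩
  · exact intervalIntegrable_const
  · exact Filter.Eventually.of_forall fun l hl t' ht' =>
      hasDerivAt_line hΩ hΦ (hasDerivAt_prodMk_left l t')
        (hbox l (hsub l hl) t' (Metric.ball_subset_closedBall ht'))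

lemma iteratedDeriv_integral {Φ : ℝ × ℝ → ℝ} {Ω : Set (ℝ × ℝ)} (hΩ : IsOpen Ω)
    (hΦ : ContDiffOn ℝ ∞ Φ Ω) {ε : ℝ}
    (hbox : ∀ l ∈ Set.Icc (0 : ℝ) 1, ∀ t ∈ Metric.closedBall (0 : ℝ) ε, (l, t) ∈ Ω) (n : ℕ) {t : ℝ}
    (ht : t ∈ Metric.ball (0 : ℝ) ε) :
    iteratedDeriv n (fun t => ∫ l in (0 : ℝ)..1, Φ (l, t)) t
      = ∫ l in (0 : ℝ)..1, (dirDeriv (0, 1))^[n] Φ (l, t) := by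
  induction n generalizing t with
  | zero => simp
  | succ n ih =>
    have hev : iteratedDeriv n (fun t => ∫ l in (0 : ℝ)..1, Φ (l, t))
        =ᶠ[𝓝 t] fun t => ∫ l in (0 : ℝ)..1, (dirDeriv (0, 1))^[n] Φ (l, t) := by
      filter_upwards [Metric.isOpen_ball.mem_nhds ht] with t' ht' using ih ht'
    rw [iteratedDeriv_succ, hev.deriv_eq]
    simp_rw [Function.iterate_succ_apply']
    exact (hasDerivAt_integral hΩ (ContDiffOn.dirDeriv_iterate hΩ hΦ _ n) hbox ht).deriv

/-- Taylor coefficients commute with integration along the segment. -/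
lemma taylorCoeff_integral {f : ℝ → ℝ → ℝ} (hf : LineSmooth f) (n : ℕ) :
    taylorCoeff n (fun t => ∫ l in (0 : ℝ)..1, f l t)
      = ∫ l in (0 : ℝ)..1, taylorCoeff n (f l) := by
  obtain ⟨Φ, Ω, hΩ, hmem, hΦ, heq⟩ := hf
  obtain ⟨ε, hε, hbox⟩ := exists_box hΩ hmem
  have hev : (fun t => ∫ l in (0 : ℝ)..1, f l t) =ᶠ[𝓝 0] fun t => ∫ l in (0 : ℝ)..1, Φ (l, t) := by
    filter_upwards [Metric.closedBall_mem_nhds (0 : ℝ) hε] with t ht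
    refine intervalIntegral.integral_congr_ae (Filter.Eventually.of_forall fun l hl => ?_)
    rw [Set.uIoc_of_le zero_le_one] at hl
    exact heq l t (hbox l ⟨hl.1.le, hl.2⟩ t ht) hl.1 hl.2
  rw [taylorCoeff_congr hev, taylorCoeff,
    iteratedDeriv_integral hΩ hΦ hbox n (Metric.mem_ball_self hε),
    ← intervalIntegral.integral_div]
  refine (intervalIntegral.integral_congr_ae (Filter.Eventually.of_forall fun l hl => ?_)).symm
  exact taylorCoeff_eqOn hΩ hmem hΦ heq n hl

end LineSmooth

/-! ### Taylor series of a composition -/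

open PowerSeries in
lemma jet_deriv (f : ℝ → ℝ) : jet (deriv f) = d⁄dX ℝ (jet f) := by
  ext n
  rw [coeff_jet, taylorCoeff_deriv, coeff_derivative, coeff_jet, mul_comm]

lemma X_dvd_jet {f : ℝ → ℝ} (h : f 0 = 0) : PowerSeries.X ∣ jet f := by
  rw [PowerSeries.X_dvd_iff, ← PowerSeries.coeff_zero_eq_constantCoeff_apply, coeff_jet,
    taylorCoeff_zero, h]

/-- Partial sums `∑ n < N, a n * θ ^ n / n!` of a Taylor series with power series coefficients. -/
def expSum (θ : PowerSeries ℝ) (a : ℕ → PowerSeries ℝ) (N : ℕ) : PowerSeries ℝ :=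
  ∑ n ∈ Finset.range N, a n * θ ^ n * PowerSeries.C (n.factorial : ℝ)⁻¹

/-- Since `X ∣ θ`, the summand with index `n` is divisible by `X ^ n` and does not reach lower
coefficients. The point of truncation is therefore immaterial. -/
lemma coeff_expSum_succ {θ : PowerSeries ℝ} (hθ : PowerSeries.X ∣ θ) (a : ℕ → PowerSeries ℝ)
    {l N : ℕ} (h : l < N) :
    PowerSeries.coeff l (expSum θ a N) = PowerSeries.coeff l (expSum θ a (l + 1)) := by
  induction N, h using Nat.le_induction with
  | base => rfl
  | succ N hN ih =>
    rw [← ih, expSum, Finset.sum_range_succ, map_add, ← expSum, add_eq_left]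
    have h : PowerSeries.X ^ N ∣ a N * θ ^ N * PowerSeries.C (N.factorial : ℝ)⁻¹ :=
      ((pow_dvd_pow_of_dvd hθ N).mul_left _).mul_right _
    exact PowerSeries.X_pow_dvd_iff.1 h l hN

-- The formal chain rule: either a coefficient `a n` is differentiated, or `θⁿ / n!` becomes `θⁿ⁻¹ /
-- (n-1)! · θ'`, which shifts the index and shortens the sum by one.
open PowerSeries in
lemma derivative_expSum (θ : PowerSeries ℝ) (a : ℕ → PowerSeries ℝ) (N : ℕ) :
    d⁄dX ℝ (expSum θ a (N + 1)) = expSum θ (fun n => d⁄dX ℝ (a n)) (N + 1)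
      + expSum θ (fun n => a (n + 1)) N * d⁄dX ℝ θ := by
  induction N with
  | zero => simp [expSum]
  | succ N ih =>
    have hs : ∀ (b : ℕ → ℝ⟦X⟧) M, expSum θ b (M + 1)
        = expSum θ b M + b M * θ ^ M * C (M.factorial : ℝ)⁻¹ := fun b M =>
      Finset.sum_range_succ _ _
    rw [hs a (N + 1), map_add, ih, hs _ (N + 1), hs (fun n => a (n + 1)) N]
    have h : (C ((N + 1).factorial : ℝ)⁻¹ : ℝ⟦X⟧) * ((N + 1 : ℕ) : ℝ⟦X⟧)
        = C (N.factorial : ℝ)⁻¹ := by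
      rw [← map_natCast (C : ℝ →+* ℝ⟦X⟧), ← map_mul, Nat.factorial_succ]
      congr 1
      have := Nat.factorial_ne_zero N
      push_cast
      field_simp
    simp only [Derivation.leibniz, derivative_C, derivative_pow, smul_eq_mul]
    rw [← h]
    simp only [Nat.add_sub_cancel]
    ring

/-- The Taylor series of `t ↦ K (x₀ + θ t, t)`, by expansion in the first variable. -/
lemma taylorCoeff_comp {Ω : Set (ℝ × ℝ)} (hΩ : IsOpen Ω) {K : ℝ × ℝ → ℝ}
    (hK : ContDiffOn ℝ ∞ K Ω) {x₀ : ℝ} (hx : (x₀, 0) ∈ Ω) {θ : ℝ → ℝ} (hθ : SmoothGerm θ)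
    (hθ0 : θ 0 = 0) (l : ℕ) :
    taylorCoeff l (fun t => K (x₀ + θ t, t)) = PowerSeries.coeff l
      (expSum (jet θ) (fun n => jet fun t => (dirDeriv (1, 0))^[n] K (x₀, t)) (l + 1)) := by
  have hpath : ContDiffAt ℝ ∞ (fun t => (x₀ + θ t, t)) 0 :=
    (contDiffAt_const.add hθ).prodMk contDiffAt_id
  have hmem : ∀ᶠ t in 𝓝 (0 : ℝ), (x₀ + θ t, t) ∈ Ω :=
    hpath.continuousAt.eventually_mem (hΩ.mem_nhds (by simpa [hθ0] using hx))
  have hsm : ∀ {K : ℝ × ℝ → ℝ}, ContDiffOn ℝ ∞ K Ω → SmoothGerm fun t => K (x₀ + θ t, t) :=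
    fun hK => ContDiffAt.comp (g := _) (0 : ℝ)
      (hK.contDiffAt (hΩ.mem_nhds (by simpa [hθ0] using hx))) hpath
  -- Induction on the order for all `K` at once: the derivative of the composition involves the
  -- compositions with `∂ₜK` and `∂ₓK`, whose coefficients of lower order are known. The formal sum
  -- obeys the same recursion by `derivative_expSum`.
  induction l using Nat.strong_induction_on generalizing K with
  | _ l ih =>
  rcases l with _ | l
  · simp [taylorCoeff_zero, hθ0, expSum]
  have hdθ : ∀ᶠ t in 𝓝 (0 : ℝ), HasDerivAt θ (deriv θ t) t := by
    have := (hθ.of_le 1).eventually (by simp)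
    filter_upwards [this] with t ht using (ht.differentiableAt (by simp)).hasDerivAt
  have hd : deriv (fun t => K (x₀ + θ t, t)) =ᶠ[𝓝 0]
      fun t => dirDeriv (0, 1) K (x₀ + θ t, t) + dirDeriv (1, 0) K (x₀ + θ t, t) * deriv θ t := by
    filter_upwards [hmem, hdθ] with t ht hdt
    have := hasDerivAt_line hΩ hK (γ := fun t => (x₀ + θ t, t)) (a := (deriv θ t, 1))
      ((hdt.const_add x₀).prodMk (hasDerivAt_id t)) ht
    rw [this.deriv]
    have e : ((deriv θ t, 1) : ℝ × ℝ) = (0, 1) + deriv θ t • (1, 0) := by simp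
    rw [dirDeriv, e, map_add, map_smul, smul_eq_mul, mul_comm]
    rfl
  have hKt := ContDiffOn.dirDeriv hΩ hK (0, 1)
  have hKx := ContDiffOn.dirDeriv hΩ hK (1, 0)
  have hX := X_dvd_jet hθ0
  have key : PowerSeries.coeff l (jet (deriv fun t => K (x₀ + θ t, t)))
      = PowerSeries.coeff l (PowerSeries.derivative ℝ
        (expSum (jet θ) (fun n => jet fun t => (dirDeriv (1, 0))^[n] K (x₀, t)) (l + 2))) := by
    rw [jet_congr hd, jet_add (hsm hKt) ((hsm hKx).mul hθ.deriv), jet_mul (hsm hKx) hθ.deriv,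
      derivative_expSum, map_add, map_add, PowerSeries.coeff_mul, PowerSeries.coeff_mul]
    congr 1
    · rw [coeff_jet, ih l (by simp) hKt, coeff_expSum_succ hX _ (by simp : l < l + 1 + 1)]
      congr 2
      funext n
      rw [← jet_deriv]
      refine jet_congr ?_
      filter_upwards [eventually_mem_snd hΩ hx] with t ht
      have := hasDerivAt_line hΩ (ContDiffOn.dirDeriv_iterate hΩ hK (1, 0) n)
        (hasDerivAt_prodMk_left x₀ t) ht
      rw [this.deriv, dirDeriv_iterate_comm hΩ hK _ _ n ht]
    · refine Finset.sum_congr rfl fun ij hij => ?_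
      have hi : ij.1 ≤ l := by have := Finset.HasAntidiagonal.mem_antidiagonal.1 hij; omega
      rw [coeff_jet, ih ij.1 (by omega) hKx, jet_deriv,
        coeff_expSum_succ hX _ (by omega : ij.1 < l + 1)]
      simp only [Function.iterate_succ_apply]
  -- Both sides of `key` carry the factor `l + 1` from differentiation; cancelling it gives the
  -- coefficient of order `l + 1`.
  rw [coeff_jet, taylorCoeff_deriv, PowerSeries.coeff_derivative, mul_comm] at key
  exact mul_right_cancel₀ (by positivity) key

/-- The Taylor coefficients of `t ↦ K (x₀ + θ t, t)` in terms of derivatives of the Taylor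
coefficients of `K` in the second variable. -/
lemma taylorCoeff_comp_eq_sum {Ω : Set (ℝ × ℝ)} (hΩ : IsOpen Ω) {K : ℝ × ℝ → ℝ}
    (hK : ContDiffOn ℝ ∞ K Ω) {x₀ : ℝ} (hx : (x₀, 0) ∈ Ω) {θ : ℝ → ℝ} (hθ : SmoothGerm θ)
    (hθ0 : θ 0 = 0) (l : ℕ) :
    taylorCoeff l (fun t => K (x₀ + θ t, t)) =
      ∑ n ∈ Finset.range (l + 1), ∑ ij ∈ Finset.HasAntidiagonal.antidiagonal l,
        iteratedDeriv n (fun x => taylorCoeff ij.1 fun t => K (x, t)) x₀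
          * (PowerSeries.coeff ij.2 (jet θ ^ n) / n.factorial) := by
  rw [taylorCoeff_comp hΩ hK hx hθ hθ0, expSum, map_sum]
  refine Finset.sum_congr rfl fun n _ => ?_
  rw [PowerSeries.coeff_mul_C, PowerSeries.coeff_mul, Finset.sum_mul]
  refine Finset.sum_congr rfl fun ij _ => ?_
  rw [iteratedDeriv_taylorCoeff hΩ hK n ij.1 hx, coeff_jet, div_eq_mul_inv, mul_assoc]
  congr 1
  refine taylorCoeff_congr ?_ _
  filter_upwards [eventually_mem_snd hΩ hx] with t ht
  refine (iteratedDeriv_line hΩ hK (γ := fun y => (y, t)) (fun y => ?_) n ht).symm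
  exact (hasDerivAt_id y).prodMk (hasDerivAt_const y t)

/-- The Taylor coefficients of `t ↦ h (a t ^ w)`. -/
lemma taylorCoeff_comp_monomial {h : ℝ → ℝ} {u : Set ℝ} (hu : IsOpen u) (hh : ContDiffOn ℝ ∞ h u)
    (h0 : (0 : ℝ) ∈ u) (a : ℝ) {w : ℕ} (hw : 1 ≤ w) (l : ℕ) :
    taylorCoeff l (fun t => h (a * t ^ w))
      = if w ∣ l then a ^ (l / w) * taylorCoeff (l / w) h else 0 := by
  have hθ : SmoothGerm fun t : ℝ => a * t ^ w := by unfold SmoothGerm; fun_prop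
  have hΩ : IsOpen (u ×ˢ (Set.univ : Set ℝ)) := hu.prod isOpen_univ
  have hK : ContDiffOn ℝ ∞ (fun w : ℝ × ℝ => h w.1) (u ×ˢ (Set.univ : Set ℝ)) :=
    hh.comp contDiffOn_fst fun w hw => hw.1
  -- The general formula for a function independent of the second variable, based at `0`, with `θ t
  -- = a t ^ w`. Only pairs `(0, w n)` contribute.
  have key := taylorCoeff_comp_eq_sum hΩ hK (x₀ := 0) ⟨h0, trivial⟩ hθ
    (by simp [Nat.one_le_iff_ne_zero.1 hw]) l
  simp only [zero_add] at key
  rw [key]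
  have hc : ∀ (i n : ℕ), iteratedDeriv n (fun x => taylorCoeff i fun _ => h x) 0
      = if i = 0 then iteratedDeriv n h 0 else 0 := by
    intro i n
    have : ∀ x, taylorCoeff i (fun _ => h x) = if i = 0 then h x else 0 := fun x => by
      rw [← coeff_jet, jet_const, PowerSeries.coeff_C]
    simp_rw [this]
    split_ifs <;> simp
  have hp : ∀ n m, PowerSeries.coeff m (jet (fun t : ℝ => a * t ^ w) ^ n)
      = if m = w * n then a ^ n else 0 := by
    intro n m
    rw [jet_const_mul, jet_id_pow, mul_pow, ← map_pow, PowerSeries.coeff_C_mul, ← pow_mul,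
      PowerSeries.coeff_X_pow]
    simp
  simp only [hc, hp]
  have : ∀ n, ∑ ij ∈ Finset.HasAntidiagonal.antidiagonal l, (if ij.1 = 0 then iteratedDeriv n h 0 else 0)
      * ((if ij.2 = w * n then a ^ n else 0) / n.factorial)
      = if l = w * n then a ^ n * taylorCoeff n h else 0 := by
    intro n
    rw [Finset.sum_eq_single_of_mem (0, l) (by simp)]
    · simp only [if_true, taylorCoeff]
      split_ifs <;> ring
    · rintro ⟨i, j⟩ hij hne
      have : i ≠ 0 := by
        rintro rfl
        simp at hij hne
        exact hne hij
      simp [this]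
  simp only [this]
  split_ifs with hd
  · obtain ⟨b, rfl⟩ := hd
    rw [Nat.mul_div_cancel_left b hw, Finset.sum_eq_single_of_mem b]
    · simp
    · rw [Finset.mem_range]; nlinarith
    · intro n _ hn
      rw [if_neg]
      intro h'
      exact hn (Nat.eq_of_mul_eq_mul_left hw h').symm
  · exact Finset.sum_eq_zero fun n _ => if_neg fun h' => hd ⟨n, h'⟩

/-! ### The tensors `κ̂` and `k̂` -/

/-- The index tuples are the ones in `receptionFunction`. -/
lemma coeff_pow_antidiagonalTuple (Y : PowerSeries ℝ) (n m : ℕ) :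
    PowerSeries.coeff m (Y ^ n)
      = ∑ e ∈ Finset.Nat.antidiagonalTuple n m, ∏ d : Fin n, PowerSeries.coeff (e d) Y := by
  have h : Y ^ n = ∏ _d : Fin n, Y := by simp
  rw [h, PowerSeries.coeff_prod]
  refine Finset.sum_nbij' (fun e => ⇑e) (fun e => Finsupp.equivFunOnFinite.symm e) ?_ ?_ ?_ ?_ ?_
  · intro e he
    simpa [Finset.Nat.mem_antidiagonalTuple] using he
  · intro e he
    simpa [Finset.Nat.mem_antidiagonalTuple] using he
  · intro e _
    ext; simp
  · intro e _
    ext; simp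
  · intro e _
    rfl

/-- The reception functions are the Taylor coefficients of the powers of `-Δ`. -/
lemma coeff_jet_neg_pow {d : ℝ → ℝ} (hd : d 0 = 0) (m n : ℕ) (x : Position)
    {D : ℕ → Position → ℝ} (hD : ∀ j, D j x = taylorCoeff j d) :
    PowerSeries.coeff m (jet (fun t => -d t) ^ n) / n.factorial
      = if n ≤ m then receptionFunction D m n x else 0 := by
  -- As `d` vanishes at `0`, a factor `X` splits off its series. This produces the shifts `n_d + 1`
  -- and `l - m` in the reception function; for `n > m` the coefficient is zero, whereas the
  -- truncated `m - n` in `receptionFunction` would be meaningless.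
  have hX : jet d = PowerSeries.X * PowerSeries.mk fun j => taylorCoeff (j + 1) d := by
    ext j
    rcases j with _ | j
    · simp [taylorCoeff_zero, hd]
    · rw [PowerSeries.coeff_succ_X_mul]; simp
  have hneg : jet (fun t => -d t) ^ n = PowerSeries.C ((-1) ^ n) * (PowerSeries.X ^ n *
      (PowerSeries.mk fun j => taylorCoeff (j + 1) d) ^ n) := by
    rw [jet_neg, hX, neg_pow, mul_pow, map_pow, map_neg, map_one]
  rw [hneg, PowerSeries.coeff_C_mul, PowerSeries.coeff_X_pow_mul']
  split_ifs with h
  · simp [receptionFunction, hD, coeff_pow_antidiagonalTuple]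
    ring
  · simp

lemma powerTerm_eq (T : ℝ → Event → Tensor) (a : ℝ) (l : ℕ) (z : Event) (μ ν : Fin 4) :
    powerTerm T a l z μ ν = a ^ l * taylorCoeff l fun b => T b z μ ν := by
  rw [powerTerm, taylorCoeff]; ring

lemma continuous_event : Continuous fun w : ℝ × Position => event w.1 w.2 := by
  refine continuous_pi fun i => ?_
  refine Fin.cases ?_ (fun i => ?_) i
  · simpa [event] using continuous_fst
  · simp only [event, Matrix.cons_val_succ]; fun_prop

lemma contDiff_event : ContDiff ℝ ∞ fun w : ℝ × Position => event w.1 w.2 := by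
  refine contDiff_pi.2 fun i => ?_
  refine Fin.cases ?_ (fun i => ?_) i
  · simpa [event] using contDiff_fst
  · simp only [event, Matrix.cons_val_succ]; fun_prop

section Hat

variable {δ : ℝ} {O : Set Event} {T : ℝ → Event → Tensor}

lemma IsPerturbation.section_smooth (hT : IsPerturbation δ O T) (z : Event) (hz : z ∈ O)
    (μ ν : Fin 4) : ContDiffOn ℝ ∞ (fun b => T b z μ ν) (Set.Ioo (-δ) δ) :=
  (hT.smooth μ ν).comp (f := fun b : ℝ => (b, z)) (by fun_prop) fun _ hb => ⟨hb, hz⟩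

lemma IsPerturbation.powerTerm_zero (hT : IsPerturbation δ O T) (a : ℝ) {z : Event} (hz : z ∈ O)
    (μ ν : Fin 4) : powerTerm T a 0 z μ ν = 0 := by
  simp [powerTerm, hT.zero z hz]

lemma eventually_event_mem (hO : IsOpen O) {τ : ℝ} {x : Position} (h : event τ x ∈ O) :
    ∀ᶠ τ' in 𝓝 τ, event τ' x ∈ O :=
  (continuous_event.comp (Continuous.prodMk_left x)).continuousAt.eventually_mem (hO.mem_nhds h)

lemma IsPerturbation.timeDeriv_powerTerm_zero (hO : IsOpen O) (hT : IsPerturbation δ O T) (a : ℝ)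
    (n : ℕ) {τ : ℝ} {x : Position} (h : event τ x ∈ O) (μ ν : Fin 4) :
    timeDeriv n (powerTerm T a 0) τ x μ ν = 0 := by
  have : (fun τ' => powerTerm T a 0 (event τ' x) μ ν) =ᶠ[𝓝 τ] fun _ => 0 := by
    filter_upwards [eventually_event_mem hO h] with τ' hτ' using hT.powerTerm_zero a hτ' μ ν
  rw [timeDeriv, this.iteratedDeriv_eq]
  simp

/-- The Taylor coefficients of a perturbation along a path with a varying delay `d`. -/
lemma taylorCoeff_delayed (hδ : 0 < δ) (hO : IsOpen O) (hT : IsPerturbation δ O T) (a : ℝ) {w : ℕ}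
    (hw : 1 ≤ w) {τ : ℝ} {x : Position} (h : event τ x ∈ O) {d : ℝ → ℝ} (hd : SmoothGerm d)
    (hd0 : d 0 = 0) {D : ℕ → Position → ℝ} (hD : ∀ j, D j x = taylorCoeff j d) (μ ν : Fin 4)
    (l : ℕ) :
    taylorCoeff l (fun t => T (a * t ^ w) (event (τ - d t) x) μ ν)
      = ∑ n ∈ Finset.range (l + 1), ∑ ij ∈ Finset.HasAntidiagonal.antidiagonal l,
          (if w ∣ ij.1 then timeDeriv n (powerTerm T a (ij.1 / w)) τ x μ ν else 0)
            * if n ≤ ij.2 then receptionFunction D ij.2 n x else 0 := by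
  -- The composition formula is applied to `K (τ', t) = T (a t ^ w) (event τ' x)`, based at `τ` with
  -- displacement `-d`: only the time of the event is shifted by the delay.
  set γ : ℝ × ℝ → ℝ × Event := fun y => (a * y.2 ^ w, event y.1 x) with hγ
  have hγc : ContDiff ℝ ∞ γ := by
    refine ContDiff.prodMk (by fun_prop) ?_
    exact contDiff_event.comp (contDiff_fst.prodMk contDiff_const)
  set Ω : Set (ℝ × ℝ) := γ ⁻¹' (Set.Ioo (-δ) δ ×ˢ O) with hΩdef
  have hΩ : IsOpen Ω := (isOpen_Ioo.prod hO).preimage hγc.continuous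
  have hK : ContDiffOn ℝ ∞ (fun y => T (γ y).1 (γ y).2 μ ν) Ω :=
    (hT.smooth μ ν).comp hγc.contDiffOn fun y hy => hy
  have h0 : (0 : ℝ) ∈ Set.Ioo (-δ) δ := ⟨by linarith, hδ⟩
  have hx : (τ, 0) ∈ Ω := by
    refine ⟨?_, h⟩
    simpa [hγ, Nat.one_le_iff_ne_zero.1 hw] using hδ
  have key := taylorCoeff_comp_eq_sum hΩ hK hx hd.neg (by simp [hd0]) l
  simp only [hγ, ← sub_eq_add_neg] at key
  rw [key]
  refine Finset.sum_congr rfl fun n _ => Finset.sum_congr rfl fun ij _ => ?_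
  rw [coeff_jet_neg_pow hd0 _ _ x hD]
  congr 1
  have hev : (fun τ' => taylorCoeff ij.1 fun t => T (a * t ^ w) (event τ' x) μ ν)
      =ᶠ[𝓝 τ] fun τ' => if w ∣ ij.1 then powerTerm T a (ij.1 / w) (event τ' x) μ ν else 0 := by
    filter_upwards [eventually_event_mem hO h] with τ' hτ'
    rw [taylorCoeff_comp_monomial (h := fun b => T b (event τ' x) μ ν) isOpen_Ioo
      (hT.section_smooth _ hτ' μ ν) h0 a hw, powerTerm_eq]
  rw [hev.iteratedDeriv_eq]
  split_ifs
  · rfl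
  · simp

lemma receptionFunction_zero_zero (D : ℕ → Position → ℝ) (x : Position) :
    receptionFunction D 0 0 x = 1 := by
  simp [receptionFunction]

/-- No tuple of length `0` has a positive sum. Hence the sums over `n` in `κ̂` and `k̂` may start at
`n = 1`. -/
lemma receptionFunction_zero_right (D : ℕ → Position → ℝ) {m : ℕ} (hm : 1 ≤ m) (x : Position) :
    receptionFunction D m 0 x = 0 := by
  obtain ⟨m, rfl⟩ := Nat.exists_eq_add_of_le' hm
  simp [receptionFunction]

lemma timeDeriv_zero (T : Event → Tensor) (τ : ℝ) (x : Position) :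
    timeDeriv 0 T τ x = T (event τ x) := by
  funext μ ν; simp [timeDeriv]

lemma sum_receptionFunction (D : ℕ → Position → ℝ) (S : ℕ → ℝ) {m : ℕ} (hm : 1 ≤ m)
    (x : Position) :
    ∑ n ∈ Finset.range (m + 1), S n * receptionFunction D m n x
      = ∑ n ∈ Finset.Icc 1 m, receptionFunction D m n x * S n := by
  rw [Finset.sum_range_succ', receptionFunction_zero_right D hm, mul_zero, add_zero,
    Finset.range_eq_Ico, Finset.sum_Ico_add' (fun n => S n * receptionFunction D m n x) 0 m 1]
  exact Finset.sum_congr (by ext; simp; try omega) fun n _ => mul_comm _ _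

/-- The parameter contributes only orders `w b` with `1 ≤ b ≤ l / w`. With `b = l / w - m` the delay
must supply the remaining order `m w + l % w`; this is the indexing of `k̂`. -/
lemma taylorCoeff_delayed_eq_sum (hδ : 0 < δ) (hO : IsOpen O) (hT : IsPerturbation δ O T) (a : ℝ)
    {w : ℕ} (hw : 1 ≤ w) {τ : ℝ} {x : Position} (h : event τ x ∈ O) {d : ℝ → ℝ}
    (hd : SmoothGerm d) (hd0 : d 0 = 0) {D : ℕ → Position → ℝ}
    (hD : ∀ j, D j x = taylorCoeff j d) (μ ν : Fin 4) (l : ℕ) :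
    taylorCoeff l (fun t => T (a * t ^ w) (event (τ - d t) x) μ ν)
      = ∑ m ∈ Finset.range (l / w), ∑ n ∈ Finset.range (m * w + l % w + 1),
          timeDeriv n (powerTerm T a (l / w - m)) τ x μ ν
            * receptionFunction D (m * w + l % w) n x := by
  rw [taylorCoeff_delayed hδ hO hT a hw h hd hd0 hD, Finset.sum_comm]
  have hdiv : w * (l / w) + l % w = l := Nat.div_add_mod l w
  symm
  refine Finset.sum_of_injOn (fun m => (w * (l / w - m), m * w + l % w)) ?_ ?_ ?_ ?_
  · intro m hm m' hm' heq
    simp only [Prod.mk.injEq] at heq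
    exact Nat.eq_of_mul_eq_mul_right hw (by omega)
  · intro m hm
    have hm : m < l / w := by simpa using hm
    simp only [Finset.mem_coe, Finset.HasAntidiagonal.mem_antidiagonal]
    obtain ⟨c, hc⟩ := Nat.exists_eq_add_of_lt hm
    rw [show l / w - m = c + 1 by omega]
    rw [hc] at hdiv
    nlinarith
  · rintro ⟨i, j⟩ hij hni
    refine Finset.sum_eq_zero fun n _ => ?_
    have hij : i + j = l := Finset.HasAntidiagonal.mem_antidiagonal.1 hij
    by_cases hi : w ∣ i
    · obtain ⟨b, rfl⟩ := hi
      rw [if_pos (Dvd.intro b rfl), Nat.mul_div_cancel_left b hw]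
      rcases Nat.eq_zero_or_pos b with rfl | hb
      -- The term `b = 0` drops out because the perturbation vanishes for parameter zero.
      · rw [hT.timeDeriv_powerTerm_zero hO a n h, zero_mul]
      · exfalso
        apply hni
        have hbl : b ≤ l / w := (Nat.le_div_iff_mul_le hw).2 (by rw [mul_comm]; exact hij ▸ Nat.le_add_right _ _)
        refine ⟨l / w - b, ?_, ?_⟩
        · exact Finset.mem_coe.2 (Finset.mem_range.2 (by omega))
        · obtain ⟨c, hc⟩ := Nat.exists_eq_add_of_le hbl
          rw [hc] at hdiv
          simp only [Prod.mk.injEq]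
          rw [hc]
          constructor
          · congr 1; omega
          · rw [show b + c - b = c by omega]
            nlinarith
    · rw [if_neg hi, zero_mul]
  · intro m hm
    have hm : m < l / w := by simpa using hm
    simp only [if_pos (Dvd.intro (l / w - m) rfl), Nat.mul_div_cancel_left _ hw]
    have hle : m * w + l % w ≤ l := by
      have := Nat.mul_le_mul_left w hm.le
      rw [mul_comm]; omega
    refine Finset.sum_subset_zero_on_sdiff (Finset.range_mono (by omega)) ?_ ?_
    · intro n hn
      simp only [Finset.mem_sdiff, Finset.mem_range] at hn
      rw [if_neg (by omega), mul_zero]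
    · intro n hn
      rw [if_pos (Nat.lt_succ_iff.1 (Finset.mem_range.1 hn))]

lemma taylorCoeff_delayed_of_lt (hδ : 0 < δ) (hO : IsOpen O) (hT : IsPerturbation δ O T) (a : ℝ)
    {w : ℕ} (hw : 1 ≤ w) {τ : ℝ} {x : Position} (h : event τ x ∈ O) {d : ℝ → ℝ}
    (hd : SmoothGerm d) (hd0 : d 0 = 0) (μ ν : Fin 4) {l : ℕ} (hl : l < w) :
    taylorCoeff l (fun t => T (a * t ^ w) (event (τ - d t) x) μ ν) = 0 := by
  rw [taylorCoeff_delayed_eq_sum hδ hO hT a hw h hd hd0 (D := fun j _ => taylorCoeff j d)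
    (fun _ => rfl), Nat.div_eq_of_lt hl]
  simp

/-- `k̂₋₍ₗ₎` is the Taylor coefficient of the perturbation along the delayed path. -/
lemma taylorCoeff_delayed_eq_kHat (hδ : 0 < δ) (hO : IsOpen O) (hT : IsPerturbation δ O T) (a : ℝ)
    {w : ℕ} (hw : 1 ≤ w) {τ : ℝ} {x : Position} (h : event τ x ∈ O) {d : ℝ → ℝ}
    (hd : SmoothGerm d) (hd0 : d 0 = 0) {D : ℕ → Position → ℝ}
    (hD : ∀ j, D j x = taylorCoeff j d) (μ ν : Fin 4) {l : ℕ} (hl : w ≤ l) :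
    taylorCoeff l (fun t => T (a * t ^ w) (event (τ - d t) x) μ ν)
      = kHat w (powerTerm T a) D l τ x μ ν := by
  rw [taylorCoeff_delayed_eq_sum hδ hO hT a hw h hd hd0 hD]
  have hp : 1 ≤ l / w := (Nat.le_div_iff_mul_le hw).2 (by omega)
  obtain ⟨p, hp⟩ := Nat.exists_eq_add_of_le' hp
  simp only [kHat, hp]
  -- The summand `m = 0` is `A_{p,q}`: for `q = 0` it is the undelayed term, for `q ≥ 1` its `n = 0`
  -- part is zero. For `m ≥ 1` the order `m w + q` is positive, so `n = 0` drops out again.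
  rw [Finset.sum_range_succ', add_comm]
  simp only [zero_mul, zero_add, Nat.sub_zero, Pi.add_apply, Nat.add_sub_cancel, Finset.sum_apply,
    Pi.smul_apply, smul_eq_mul]
  congr 1
  · rcases Nat.eq_zero_or_pos (l % w) with hq | hq
    · simp [hq, receptionFunction_zero_zero, timeDeriv_zero]
    · rw [if_neg hq.ne', sum_receptionFunction D _ hq]
      simp [Finset.sum_apply]
  · rw [Finset.range_eq_Ico, Finset.sum_Ico_add' (fun m => ∑ n ∈ Finset.range (m * w + l % w + 1),
      timeDeriv n (powerTerm T a (p + 1 - m)) τ x μ ν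
        * receptionFunction D (m * w + l % w) n x) 0 p 1]
    refine Finset.sum_congr (by ext; simp; try omega) fun m hm => ?_
    have hm : 1 ≤ m := (Finset.mem_Icc.1 hm).1
    have hmw : 1 * 1 ≤ m * w := Nat.mul_le_mul hm hw
    rw [sum_receptionFunction D _ (by omega)]

/-- For `s = 1` every remainder is `0`. Thus `κ̂` is the case of weight one of `k̂`, and one
computation serves both tensors. -/
lemma kHat_one (k : ℕ → Event → Tensor) (D : ℕ → Position → ℝ) (l : ℕ) (τ : ℝ) (x : Position) :
    kHat 1 k D l τ x = kappaHat k D l τ x := by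
  simp [kHat, kappaHat, Nat.mod_one]

end Hat

/-! ### Light rays and the eikonal equation -/

lemma clm_apply_eq_sum {ι : Type*} [Fintype ι] [DecidableEq ι] (L : (ι → ℝ) →L[ℝ] ℝ) (x : ι → ℝ) :
    L x = ∑ i, x i * L (Pi.single i 1) := by
  have h := L.toLinearMap.pi_apply_eq_sum_univ x
  simp only [ContinuousLinearMap.coe_coe, smul_eq_mul] at h
  rw [h]
  refine Finset.sum_congr rfl fun i _ => ?_
  congr 2
  funext j
  simp [Pi.single_apply, eq_comm]

lemma hasDerivAt_comp_line {W : Type*} [NormedAddCommGroup W] [NormedSpace ℝ W] {Ψ : W → ℝ}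
    {γ : ℝ → W} {a : W} {t : ℝ} (hΨ : DifferentiableAt ℝ Ψ (γ t)) (hγ : HasDerivAt γ a t) :
    HasDerivAt (fun t => Ψ (γ t)) (dirDeriv a Ψ (γ t)) t :=
  hΨ.hasFDerivAt.comp_hasDerivAt t hγ

/-- The algebraic identity behind the conservation of `p · ∂X` along a family of light rays. -/
lemma hamiltonian_variation {ι : Type*} [Fintype ι] (G G' : ι → ι → ℝ) (hG : ∀ α β, G α β = G β α)
    (dG : ι → ι → ι → ℝ) (p π ξ V dV A : ι → ℝ) (hV : ∀ μ, V μ = ∑ ν, G μ ν * p ν)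
    (hA : ∀ μ, A μ = -(1 / 2) * ∑ α, ∑ β, dG μ α β * p α * p β)
    (hG' : ∀ α β, G' α β = ∑ μ, ξ μ * dG μ α β)
    (h1 : ∑ μ, (π μ * V μ + p μ * dV μ) = 0)
    (h2 : ∑ α, ∑ β, ((G' α β * p α + G α β * π α) * p β + G α β * p α * π β) = 0) :
    ∑ μ, (A μ * ξ μ + p μ * dV μ) = 0 := by
  have e1 : ∑ μ, A μ * ξ μ = -(1 / 2) * ∑ α, ∑ β, G' α β * p α * p β := by
    simp only [hA, hG', Finset.sum_mul, Finset.mul_sum]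
    rw [Finset.sum_comm]
    refine Finset.sum_congr rfl fun α _ => ?_
    rw [Finset.sum_comm]
    refine Finset.sum_congr rfl fun β _ => Finset.sum_congr rfl fun μ _ => ?_
    ring
  have e2 : ∑ μ, π μ * V μ = ∑ α, ∑ β, G α β * π α * p β := by
    simp only [hV, Finset.mul_sum]
    exact Finset.sum_congr rfl fun α _ => Finset.sum_congr rfl fun β _ => by ring
  have e3 : ∑ α, ∑ β, G α β * p α * π β = ∑ α, ∑ β, G α β * π α * p β := by
    rw [Finset.sum_comm]
    refine Finset.sum_congr rfl fun α _ => Finset.sum_congr rfl fun β _ => ?_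
    rw [hG β α]; ring
  -- With `Q = G'(p, p)`: `h2` gives `π · V = -Q/2`, then `h1` gives `p · dV = Q/2`, while `A · ξ =
  -- -Q/2`.
  simp only [Finset.sum_add_distrib, add_mul] at h1 h2 ⊢
  rw [e2] at h1
  rw [e3] at h2
  rw [e1]
  linarith

section Ray

variable {g : Event → Tensor} {O : Set Event}

/-- The ray equations are one-sided at the ends of `[0, 1]`; uniqueness of derivatives within the
interval identifies them with the two-sided derivatives of the family, which exist on the larger
open set of ray parameters. -/
lemma IsLightRay.velocity_eq {X : ℝ → Event} {p : ℝ → Fin 4 → ℝ} (h : IsLightRay g X p) {σ : ℝ}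
    (hσ : σ ∈ Set.Icc (0 : ℝ) 1) (μ : Fin 4) {v : ℝ} (hv : HasDerivAt (fun τ => X τ μ) v σ) :
    v = ∑ ν, g (X σ) μ ν * p σ ν :=
  (uniqueDiffOn_Icc zero_lt_one σ hσ).eq_deriv _ hv.hasDerivWithinAt (h.velocity σ hσ μ)

lemma IsLightRay.covector_eq {X : ℝ → Event} {p : ℝ → Fin 4 → ℝ} (h : IsLightRay g X p) {σ : ℝ}
    (hσ : σ ∈ Set.Icc (0 : ℝ) 1) (μ : Fin 4) {v : ℝ} (hv : HasDerivAt (fun τ => p τ μ) v σ) :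
    v = -(1 / 2) * ∑ α, ∑ β,
        fderiv ℝ (fun z : Event => g z α β) (X σ) (Pi.single μ 1) * p σ α * p σ β :=
  (uniqueDiffOn_Icc zero_lt_one σ hσ).eq_deriv _ hv.hasDerivWithinAt (h.covector σ hσ μ)

/-- For a smooth family of light rays with parameters `y`, the contraction `p · ∂X/∂y` is constant
along each ray. -/
lemma hasDerivAt_covector_variation (hO : IsOpen O)
    (hg : ∀ μ ν, DifferentiableOn ℝ (fun z => g z μ ν) O) (hgs : ∀ z ∈ O, ∀ μ ν, g z μ ν = g z ν μ)
    {V : Set Position} (hV : IsOpen V) {J : Set ℝ} (hJ : IsOpen J) (hIJ : Set.Icc 0 1 ⊆ J)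
    {X : ℝ → Position → Event} {p : ℝ → Position → Fin 4 → ℝ}
    (hX : ContDiffOn ℝ 2 (fun w : ℝ × Position => X w.1 w.2) (J ×ˢ V))
    (hp : ContDiffOn ℝ 2 (fun w : ℝ × Position => p w.1 w.2) (J ×ˢ V))
    (hray : ∀ x ∈ V, IsLightRay g (fun σ => X σ x) (fun σ => p σ x) ∧
      ∀ σ ∈ Set.Icc (0 : ℝ) 1, X σ x ∈ O)
    {x : Position} (hx : x ∈ V) (v : Position) {σ : ℝ} (hσ : σ ∈ Set.Icc (0 : ℝ) 1) :
    HasDerivAt (fun σ => ∑ μ, p σ x μ *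
      dirDeriv ((0, v) : ℝ × Position) (fun w => X w.1 w.2 μ) (σ, x)) 0 σ := by
  have hΩ : IsOpen (J ×ˢ V) := hJ.prod hV
  have hw : (σ, x) ∈ J ×ˢ V := ⟨hIJ hσ, hx⟩
  have hXc : ∀ μ, ContDiffOn ℝ 2 (fun w : ℝ × Position => X w.1 w.2 μ) (J ×ˢ V) :=
    fun μ => contDiffOn_pi.1 hX μ
  have hpc : ∀ μ, ContDiffOn ℝ 2 (fun w : ℝ × Position => p w.1 w.2 μ) (J ×ˢ V) :=
    fun μ => contDiffOn_pi.1 hp μ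
  have hXd : ∀ (a : ℝ × Position) μ,
      ContDiffOn ℝ 1 (dirDeriv a (fun w : ℝ × Position => X w.1 w.2 μ)) (J ×ˢ V) := fun a μ =>
    ((hXc μ).fderiv_of_isOpen hΩ (m := 1) (by norm_num)).clm_apply contDiffOn_const
  have hdiff : ∀ {Ψ : ℝ × Position → ℝ} {n : ℕ∞ω}, n ≠ 0 → ContDiffOn ℝ n Ψ (J ×ˢ V) →
      ∀ w ∈ J ×ˢ V, DifferentiableAt ℝ Ψ w := fun hn hΨ w hw =>
    (hΨ.contDiffAt (hΩ.mem_nhds hw)).differentiableAt hn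
  -- the line in the direction of the ray parameter
  have hγσ : ∀ (τ : ℝ) (y : Position),
      HasDerivAt (fun τ : ℝ => (τ, y)) ((1, 0) : ℝ × Position) τ := fun τ y =>
    (hasDerivAt_id τ).prodMk (hasDerivAt_const τ y)
  -- the line in the direction of the variation
  set γ : ℝ → ℝ × Position := fun ε => (σ, x + ε • v) with hγ
  have hγ0 : γ 0 = (σ, x) := by simp [hγ]
  have hγd : HasDerivAt γ ((0, v) : ℝ × Position) 0 := by
    refine (hasDerivAt_const (0 : ℝ) σ).prodMk ?_
    simpa using ((hasDerivAt_id (0 : ℝ)).smul_const v).const_add x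
  have hγmem : ∀ᶠ ε in 𝓝 (0 : ℝ), x + ε • v ∈ V := by
    have : ContinuousAt (fun ε : ℝ => x + ε • v) 0 := by fun_prop
    exact this.eventually_mem (hV.mem_nhds (by simpa using hx))
  have hvel : ∀ y ∈ V, ∀ μ, dirDeriv (1, 0) (fun w : ℝ × Position => X w.1 w.2 μ) (σ, y)
      = ∑ ν, g (X σ y) μ ν * p σ y ν := fun y hy μ =>
    (hray y hy).1.velocity_eq hσ μ
      (hasDerivAt_comp_line (hdiff (by simp) (hXc μ) (σ, y) ⟨hIJ hσ, hy⟩) (hγσ σ y))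
  have hdline : ∀ {Ψ : ℝ × Position → ℝ} {n : ℕ∞ω}, n ≠ 0 → ContDiffOn ℝ n Ψ (J ×ˢ V) →
      HasDerivAt (fun ε => Ψ (γ ε)) (dirDeriv (0, v) Ψ (σ, x)) 0 := by
    intro Ψ n hn hΨ
    have := hasDerivAt_comp_line (Ψ := Ψ) (by rw [hγ0]; exact hdiff hn hΨ _ hw) hγd
    rwa [hγ0] at this
  set ξ : Fin 4 → ℝ := fun μ => dirDeriv (0, v) (fun w : ℝ × Position => X w.1 w.2 μ) (σ, x)
    with hξ
  have hXO : X σ x ∈ O := (hray x hx).2 σ hσ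
  have hgl : ∀ α β, HasDerivAt (fun ε : ℝ => g (X σ (x + ε • v)) α β)
      (fderiv ℝ (fun z => g z α β) (X σ x) ξ) 0 := by
    intro α β
    have h1 : HasDerivAt (fun ε : ℝ => X σ (x + ε • v)) ξ 0 :=
      hasDerivAt_pi.2 fun μ => hdline (by simp) (hXc μ)
    have h2 : HasFDerivAt (fun z => g z α β) (fderiv ℝ (fun z => g z α β) (X σ x))
        (X σ (x + (0 : ℝ) • v)) := by
      simpa using ((hg α β).differentiableAt (hO.mem_nhds hXO)).hasFDerivAt
    exact h2.comp_hasDerivAt (0 : ℝ) h1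
  -- differentiate the two forms of the null condition in the direction of the variation
  set P : Fin 4 → ℝ := p σ x with hP
  set π : Fin 4 → ℝ := fun μ => dirDeriv (0, v) (fun w : ℝ × Position => p w.1 w.2 μ) (σ, x)
    with hπ
  set S : Fin 4 → ℝ := fun μ => dirDeriv (1, 0) (fun w : ℝ × Position => X w.1 w.2 μ) (σ, x)
    with hS
  set S' : Fin 4 → ℝ := fun μ =>
    dirDeriv (0, v) (dirDeriv (1, 0) (fun w : ℝ × Position => X w.1 w.2 μ)) (σ, x) with hS'
  set A : Fin 4 → ℝ := fun μ => dirDeriv (1, 0) (fun w : ℝ × Position => p w.1 w.2 μ) (σ, x)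
    with hA
  have hpl : ∀ μ, HasDerivAt (fun ε : ℝ => p σ (x + ε • v) μ) (π μ) 0 := fun μ =>
    hdline (by simp) (hpc μ)
  have hSl : ∀ μ, HasDerivAt (fun ε : ℝ => dirDeriv (1, 0)
      (fun w : ℝ × Position => X w.1 w.2 μ) (σ, x + ε • v)) (S' μ) 0 := fun μ =>
    hdline (by simp) (hXd (1, 0) μ)
  have e1 : ∑ μ, (π μ * S μ + P μ * S' μ) = 0 := by
    have h : HasDerivAt (fun ε : ℝ => ∑ μ, p σ (x + ε • v) μ *
        dirDeriv (1, 0) (fun w : ℝ × Position => X w.1 w.2 μ) (σ, x + ε • v))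
        (∑ μ, (π μ * S μ + P μ * S' μ)) 0 := by
      refine HasDerivAt.fun_sum fun μ _ => ?_
      have := (hpl μ).fun_mul (hSl μ)
      simp only [zero_smul, add_zero] at this
      exact this
    -- By the velocity equation `p · Ẋ = g(p, p)`, which is zero on every neighbouring ray.
    have h' : (fun ε : ℝ => ∑ μ, p σ (x + ε • v) μ *
        dirDeriv (1, 0) (fun w : ℝ × Position => X w.1 w.2 μ) (σ, x + ε • v))
        =ᶠ[𝓝 0] fun _ => 0 := by
      filter_upwards [hγmem] with ε hε
      rw [← (hray _ hε).1.null σ hσ]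
      refine Finset.sum_congr rfl fun μ _ => ?_
      rw [hvel _ hε, Finset.mul_sum]
      exact Finset.sum_congr rfl fun ν _ => by ring
    exact (h.congr_of_eventuallyEq h'.symm).unique (hasDerivAt_const (0 : ℝ) (0 : ℝ))
  set G' : Fin 4 → Fin 4 → ℝ := fun α β => fderiv ℝ (fun z => g z α β) (X σ x) ξ with hG'
  have e2 : ∑ α, ∑ β, ((G' α β * P α + g (X σ x) α β * π α) * P β
      + g (X σ x) α β * P α * π β) = 0 := by
    have h : HasDerivAt (fun ε : ℝ => ∑ α, ∑ β, g (X σ (x + ε • v)) α β * p σ (x + ε • v) α *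
        p σ (x + ε • v) β) (∑ α, ∑ β, ((G' α β * P α + g (X σ x) α β * π α) * P β
      + g (X σ x) α β * P α * π β)) 0 := by
      refine HasDerivAt.fun_sum fun α _ => HasDerivAt.fun_sum fun β _ => ?_
      have := ((hgl α β).fun_mul (hpl α)).fun_mul (hpl β)
      simp only [zero_smul, add_zero] at this
      exact this
    have h' : (fun ε : ℝ => ∑ α, ∑ β, g (X σ (x + ε • v)) α β * p σ (x + ε • v) α *
        p σ (x + ε • v) β) =ᶠ[𝓝 0] fun _ => 0 := by
      filter_upwards [hγmem] with ε hε using (hray _ hε).1.null σ hσ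
    exact (h.congr_of_eventuallyEq h'.symm).unique (hasDerivAt_const (0 : ℝ) (0 : ℝ))
  have hAl : ∀ μ, HasDerivAt (fun τ : ℝ => p τ x μ) (A μ) σ := fun μ =>
    hasDerivAt_comp_line (hdiff (by simp) (hpc μ) (σ, x) hw) (hγσ σ x)
  have e3 : ∑ μ, (A μ * ξ μ + P μ * S' μ) = 0 :=
    hamiltonian_variation (fun α β => g (X σ x) α β) G' (hgs _ hXO)
      (fun μ α β => fderiv ℝ (fun z => g z α β) (X σ x) (Pi.single μ 1)) P π ξ S S' A
      (hvel x hx) (fun μ => (hray x hx).1.covector_eq hσ μ (hAl μ))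
      (fun α β => clm_apply_eq_sum _ _) e1 e2
  refine (HasDerivAt.fun_sum fun μ _ => ?_).congr_deriv e3
  have h := (hAl μ).fun_mul
    (hasDerivAt_comp_line (hdiff (by simp) (hXd (0, v) μ) (σ, x) hw) (hγσ σ x))
  -- The variation of the velocity is the velocity of the variation: here the `C²` dependence of the
  -- family of rays enters.
  rw [dirDeriv_comm hΩ (hXc μ) (1, 0) (0, v) hw] at h
  exact h

/-- The **eikonal equation**: the covector `(1, ∂R)` is null at the event of emission. -/
lemma IsReceptionRange.eikonal (hO : IsOpen O)
    (hg : ∀ μ ν, DifferentiableOn ℝ (fun z => g z μ ν) O) (hgs : ∀ z ∈ O, ∀ μ ν, g z μ ν = g z ν μ)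
    {U : Set Position} (hU : IsOpen U) {tB : ℝ} {xB : Position} {R : Position → ℝ}
    (h : IsReceptionRange g O U tB xB R) {x : Position} (hx : x ∈ U \ {xB}) :
    event (tB - R x) x ∈ O ∧ DifferentiableAt ℝ R x ∧
      ∑ μ, ∑ ν, g (event (tB - R x) x) μ ν * (Matrix.vecCons 1 (grad R x) : Fin 4 → ℝ) μ
        * (Matrix.vecCons 1 (grad R x) : Fin 4 → ℝ) ν = 0 := by
  obtain ⟨J, X, p, hJ, hIJ, hX, hp, hray⟩ := h
  have hV : IsOpen (U \ {xB}) := hU.sdiff isClosed_singleton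
  have h0 : (0 : ℝ) ∈ Set.Icc (0 : ℝ) 1 := by simp
  have h1 : (1 : ℝ) ∈ Set.Icc (0 : ℝ) 1 := by simp
  have hΩ : IsOpen (J ×ˢ (U \ {xB})) := hJ.prod hV
  have hdX : ∀ σ ∈ Set.Icc (0 : ℝ) 1, ∀ μ,
      DifferentiableAt ℝ (fun w : ℝ × Position => X w.1 w.2 μ) (σ, x) := fun σ hσ μ =>
    (((contDiffOn_pi.1 hX μ).contDiffAt (hΩ.mem_nhds ⟨hIJ hσ, hx⟩))).differentiableAt (by simp)
  -- derivatives of `X` in the direction `v`, as derivatives at fixed ray parameter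
  have hdir : ∀ σ ∈ Set.Icc (0 : ℝ) 1, ∀ (v : Position) μ,
      dirDeriv ((0, v) : ℝ × Position) (fun w => X w.1 w.2 μ) (σ, x)
        = fderiv ℝ (fun y => X σ y μ) x v := by
    intro σ hσ v μ
    have h2 : HasFDerivAt (fun y : Position => X σ y μ) _ x :=
      (hdX σ hσ μ).hasFDerivAt.comp x (hasFDerivAt_prodMk_right σ x)
    rw [h2.fderiv]
    simp [dirDeriv]
  have hX0 : ∀ᶠ y in 𝓝 x, X 0 y = event (tB - R y) y := by
    filter_upwards [hV.mem_nhds hx] with y hy using (hray y hy).2.2.1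
  have hX1 : ∀ᶠ y in 𝓝 x, X 1 y = event tB xB := by
    filter_upwards [hV.mem_nhds hx] with y hy using (hray y hy).2.2.2
  have hX00 : DifferentiableAt ℝ (fun y => X 0 y 0) x :=
    ((hdX 0 h0 0).hasFDerivAt.comp x (hasFDerivAt_prodMk_right (0 : ℝ) x)).differentiableAt
  have hReq : R =ᶠ[𝓝 x] fun y => tB - X 0 y 0 := by
    filter_upwards [hX0] with y hy
    simp [hy, event]
  have hRd : DifferentiableAt ℝ R x :=
    (hX00.const_sub tB).congr_of_eventuallyEq hReq
  -- The conserved quantity vanishes at ray parameter `1`, where all rays pass through the fixed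
  -- reception event.
  have hconst : ∀ v : Position, ∑ μ, p 0 x μ * fderiv ℝ (fun y => X 0 y μ) x v = 0 := by
    intro v
    have hder := fun σ (hσ : σ ∈ Set.Icc (0 : ℝ) 1) =>
      hasDerivAt_covector_variation hO hg hgs hV hJ hIJ hX hp
        (fun y hy => ⟨(hray y hy).1, (hray y hy).2.1⟩) hx v hσ
    have hc := constant_of_has_deriv_right_zero (a := (0 : ℝ)) (b := 1)
      (fun σ hσ => (hder σ hσ).continuousAt.continuousWithinAt)
      (fun σ hσ => (hder σ ⟨hσ.1, hσ.2.le⟩).hasDerivWithinAt) 1 h1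
    simp only [hdir 0 h0, hdir 1 h1] at hc
    rw [← hc]
    refine Finset.sum_eq_zero fun μ _ => ?_
    have : (fun y => X 1 y μ) =ᶠ[𝓝 x] fun _ => event tB xB μ := by
      filter_upwards [hX1] with y hy using by rw [hy]
    rw [this.fderiv_eq]
    simp
  -- At emission `X = (tB - R y, y)`, so the variation in direction `i` is `(-∂ᵢR, eᵢ)`. Its
  -- contraction with `p` vanishes, that is `pᵢ = p₀ ∂ᵢR`.
  have hp_eq : p 0 x = p 0 x 0 • (Matrix.vecCons 1 (grad R x) : Fin 4 → ℝ) := by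
    funext μ
    refine Fin.cases (by simp) (fun i => ?_) μ
    have hv := hconst (EuclideanSpace.single i 1)
    rw [Fin.sum_univ_succ] at hv
    have e0 : fderiv ℝ (fun y => X 0 y 0) x (EuclideanSpace.single i 1) = -grad R x i := by
      have : (fun y => X 0 y 0) =ᶠ[𝓝 x] fun y => tB - R y := by
        filter_upwards [hX0] with y hy using by simp [hy, event]
      rw [this.fderiv_eq, fderiv_const_sub]
      rfl
    have ej : ∀ j : Fin 3, fderiv ℝ (fun y => X 0 y j.succ) x (EuclideanSpace.single i 1)
        = if j = i then 1 else 0 := by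
      intro j
      have : (fun y => X 0 y j.succ) =ᶠ[𝓝 x] fun y => EuclideanSpace.proj (𝕜 := ℝ) j y := by
        filter_upwards [hX0] with y hy using by simp [hy, event]
      rw [this.fderiv_eq, ContinuousLinearMap.fderiv]
      simp
    rw [e0] at hv
    simp only [ej] at hv
    simp at hv
    simp
    linarith
  have hp0 : p 0 x 0 ≠ 0 := by
    intro h
    apply (hray x hx).1.nonzero 0 h0
    rw [hp_eq, h, zero_smul]
  have hX0x := (hray x hx).2.2.1
  have hnull := (hray x hx).1.null 0 h0
  refine ⟨hX0x ▸ (hray x hx).2.1 0 h0, hRd, ?_⟩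
  simp only [hX0x] at hnull
  rw [hp_eq] at hnull
  have : (p 0 x 0) ^ 2 * ∑ μ, ∑ ν, g (event (tB - R x) x) μ ν *
      (Matrix.vecCons 1 (grad R x) : Fin 4 → ℝ) μ
        * (Matrix.vecCons 1 (grad R x) : Fin 4 → ℝ) ν = 0 := by
    refine Eq.trans ?_ hnull
    rw [Finset.mul_sum]
    refine Finset.sum_congr rfl fun μ _ => ?_
    rw [Finset.mul_sum]
    refine Finset.sum_congr rfl fun ν _ => ?_
    simp only [Pi.smul_apply, smul_eq_mul]
    ring
  exact (mul_eq_zero.1 this).resolve_left (pow_ne_zero 2 hp0)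

end Ray

/-! ### Regular delays -/

lemma segment_eq {xA xB : Position} (h : xA ≠ xB) (l : ℝ) :
    segment xA xB l = xB - l • (xB - xA) := by
  have : ‖xB - xA‖ ≠ 0 := norm_ne_zero_iff.2 (sub_ne_zero.2 h.symm)
  rw [segment, dir, smul_smul, mul_assoc, mul_inv_cancel₀ this, mul_one]

lemma segment_mem {U : Set Position} {xA xB : Position} (hstar : StarConvex ℝ xB U) (hxA : xA ∈ U)
    {l : ℝ} (h0 : 0 ≤ l) (h1 : l ≤ 1) : xB - l • (xB - xA) ∈ U := by
  have := hstar hxA (sub_nonneg.2 h1) h0 (by ring)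
  convert this using 1
  module

lemma segment_ne {xA xB : Position} (h : xA ≠ xB) {l : ℝ} (hl : l ≠ 0) :
    xB - l • (xB - xA) ≠ xB := by
  intro h'
  rw [sub_eq_self, smul_eq_zero] at h'
  exact h'.elim hl (sub_ne_zero.2 h.symm)

lemma norm_sub_segment (xA xB : Position) {l : ℝ} (hl : 0 ≤ l) :
    ‖xB - (xB - l • (xB - xA))‖ = l * ‖xB - xA‖ := by
  rw [sub_sub_cancel, norm_smul, Real.norm_of_nonneg hl]

lemma dir_segment (xA xB : Position) {l : ℝ} (hl : 0 < l) :
    dir (xB - l • (xB - xA)) xB = dir xA xB := by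
  rw [dir, norm_sub_segment _ _ hl.le, sub_sub_cancel, dir, smul_smul, mul_inv, mul_assoc,
    mul_comm _ l, ← mul_assoc, inv_mul_cancel₀ hl.ne', one_mul]

lemma isOpen_params (δ : ℝ) : IsOpen (params δ) := isOpen_Ioo.prod isOpen_Ioo

/-- The domain of the function that represents a regular delay in polar coordinates. -/
def polarDomain (δ : ℝ) (U : Set Position) (xB : Position) : Set (ℝ × Position × (ℝ × ℝ)) :=
  {w | w.2.1 ≠ 0 ∧ xB - w.1 • w.2.1 ∈ U ∧ w.2.2 ∈ params δ}

lemma isOpen_polarDomain {δ : ℝ} {U : Set Position} (hU : IsOpen U) (xB : Position) :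
    IsOpen (polarDomain δ U xB) := by
  have h1 : IsOpen {w : ℝ × Position × (ℝ × ℝ) | w.2.1 ≠ 0} :=
    isOpen_ne_fun (by fun_prop) continuous_const
  have h2 : IsOpen {w : ℝ × Position × (ℝ × ℝ) | xB - w.1 • w.2.1 ∈ U} :=
    hU.preimage (by fun_prop)
  have h3 : IsOpen {w : ℝ × Position × (ℝ × ℝ) | w.2.2 ∈ params δ} :=
    (isOpen_params δ).preimage (by fun_prop)
  exact h1.inter (h2.inter h3)

section Regular

variable {δ : ℝ} {U : Set Position} {xB : Position} {D : Position → ℝ × ℝ → ℝ}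

lemma IsRegularDelay.contDiffOn (hD : IsRegularDelay δ U xB D) :
    ContDiffOn ℝ ∞ (fun w : Position × (ℝ × ℝ) => D w.1 w.2) ((U \ {xB}) ×ˢ params δ) := by
  obtain ⟨F, hF, hDF⟩ := hD
  have hmap : ∀ w ∈ (U \ {xB}) ×ˢ params δ,
      ((1 : ℝ), xB - w.1, w.2) ∈ polarDomain δ U xB := fun w hw => by
    refine ⟨sub_ne_zero.2 fun h => hw.1.2 h.symm, ?_, hw.2⟩
    simpa using hw.1.1
  have h : ContDiffOn ℝ ∞ (fun w : Position × (ℝ × ℝ) => F (1, xB - w.1, w.2))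
      ((U \ {xB}) ×ˢ params δ) :=
    hF.comp (f := fun w : Position × (ℝ × ℝ) => ((1 : ℝ), xB - w.1, w.2)) (by fun_prop) hmap
  refine h.congr fun w hw => ?_
  have := hDF 1 (xB - w.1) w.2 one_pos (hmap w hw).1 (hmap w hw).2.1 hw.2
  simpa using this

/-- The gradient of a regular delay in polar coordinates. -/
lemma grad_polar (hU : IsOpen U) {F : ℝ × Position × (ℝ × ℝ) → ℝ}
    (hF : ContDiffOn ℝ ∞ F (polarDomain δ U xB))
    (hDF : ∀ (r : ℝ) (u : Position) (q : ℝ × ℝ), 0 < r → u ≠ 0 → xB - r • u ∈ U → q ∈ params δ →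
      D (xB - r • u) q = r * F (r, u, q)) (hDs : IsRegularDelay δ U xB D) {r : ℝ} {u : Position}
    {q : ℝ × ℝ} (hr : 0 < r) (hw : (r, u, q) ∈ polarDomain δ U xB) (i : Fin 3) :
    grad (fun x => D x q) (xB - r • u) i
      = -dirDeriv (0, EuclideanSpace.single i 1, 0) F (r, u, q) := by
  set e : Position := EuclideanSpace.single i 1 with he
  have hγ : HasDerivAt (fun ε : ℝ => (r, u + ε • e, q)) ((0, e, 0) : ℝ × Position × (ℝ × ℝ)) 0 := by
    refine (hasDerivAt_const (0 : ℝ) r).prodMk (HasDerivAt.prodMk ?_ (hasDerivAt_const (0 : ℝ) q))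
    simpa using ((hasDerivAt_id (0 : ℝ)).smul_const e).const_add u
  have hΩ := isOpen_polarDomain (δ := δ) hU xB
  have h1 : HasDerivAt (fun ε : ℝ => F (r, u + ε • e, q)) (dirDeriv (0, e, 0) F (r, u, q)) 0 := by
    have := hasDerivAt_line hΩ hF hγ (by simpa using hw)
    simpa using this
  have hV : IsOpen ((U \ {xB}) ×ˢ params δ) :=
    (hU.sdiff isClosed_singleton).prod (isOpen_params δ)
  have hmem : (xB - r • u, q) ∈ (U \ {xB}) ×ˢ params δ := by
    refine ⟨⟨hw.2.1, ?_⟩, hw.2.2⟩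
    simp only [Set.mem_singleton_iff, sub_eq_self, smul_eq_zero, not_or]
    exact ⟨hr.ne', hw.1⟩
  have hDd : DifferentiableAt ℝ (fun x => D x q) (xB - r • u) :=
    ((hDs.contDiffOn.contDiffAt (hV.mem_nhds hmem)).differentiableAt (by simp)).comp
      (xB - r • u) (f := fun x => (x, q)) (hasFDerivAt_prodMk_left _ _).differentiableAt
  have h2 : HasDerivAt (fun ε : ℝ => D (xB - r • (u + ε • e)) q)
      (fderiv ℝ (fun x => D x q) (xB - r • u) (-(r • e))) 0 := by
    have hl : HasDerivAt (fun ε : ℝ => xB - r • (u + ε • e)) (-(r • e)) 0 := by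
      have := ((((hasDerivAt_id (0 : ℝ)).smul_const e).const_add u).const_smul r).const_sub xB
      simpa using this
    have hd' : HasFDerivAt (fun x => D x q) (fderiv ℝ (fun x => D x q) (xB - r • u))
        (xB - r • (u + (0 : ℝ) • e)) := by simpa using hDd.hasFDerivAt
    exact hd'.comp_hasDerivAt (0 : ℝ) hl
  have hev : (fun ε : ℝ => D (xB - r • (u + ε • e)) q) =ᶠ[𝓝 0]
      fun ε => r * F (r, u + ε • e, q) := by
    have : ∀ᶠ ε in 𝓝 (0 : ℝ), (r, u + ε • e, q) ∈ polarDomain δ U xB :=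
      hγ.continuousAt.eventually_mem (hΩ.mem_nhds (by simpa using hw))
    filter_upwards [this] with ε hε using hDF r _ q hr hε.1 hε.2.1 hε.2.2
  -- The factor `r` of the chain rule cancels the factor `r` in front of `F`; hence the gradient, in
  -- polar coordinates, has a smooth extension to `r = 0`.
  have h3 := (h2.congr_of_eventuallyEq hev.symm).unique (h1.const_mul r)
  rw [map_neg, map_smul, smul_eq_mul, ← mul_neg, mul_eq_mul_left_iff] at h3
  have := h3.resolve_right hr.ne'
  rw [grad, ← this, neg_neg]

/-- A regular delay along the segment to `x` is the integral of its derivative. -/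
lemma IsRegularDelay.eq_integral (hU : IsOpen U) (hstar : StarConvex ℝ xB U)
    (hD : IsRegularDelay δ U xB D) {q : ℝ × ℝ} (hq : q ∈ params δ) {x : Position}
    (hx : x ∈ U \ {xB}) {f : ℝ → ℝ}
    (hf : ∀ l, 0 < l → l ≤ 1 →
      f l = -fderiv ℝ (fun y => D y q) (xB - l • (xB - x)) (xB - x)) :
    D x q = ∫ l in (0 : ℝ)..1, f l := by
  have hDs := hD
  obtain ⟨F, hF, hDF⟩ := hD
  have hxB : x ≠ xB := hx.2
  have hu : xB - x ≠ 0 := sub_ne_zero.2 hxB.symm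
  have hΩ := isOpen_polarDomain (δ := δ) hU xB
  have hmem : ∀ l ∈ Set.Icc (0 : ℝ) 1, (l, xB - x, q) ∈ polarDomain δ U xB := fun l hl =>
    ⟨hu, segment_mem hstar hx.1 hl.1 hl.2, hq⟩
  have hγ : ∀ l : ℝ, HasDerivAt (fun l : ℝ => (l, xB - x, q))
      ((1, 0, 0) : ℝ × Position × (ℝ × ℝ)) l := fun l =>
    (hasDerivAt_id l).prodMk (hasDerivAt_const l (xB - x, q))
  -- The function `l F(l, u, q)` extends the delay along the segment to `l = 0` with value `0`, so
  -- the fundamental theorem of calculus leaves no boundary term there.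
  have hder : ∀ l ∈ Set.Icc (0 : ℝ) 1, HasDerivAt (fun l => l * F (l, xB - x, q))
      (F (l, xB - x, q) + l * dirDeriv (1, 0, 0) F (l, xB - x, q)) l := fun l hl => by
    have := (hasDerivAt_id l).fun_mul (hasDerivAt_line hΩ hF (hγ l) (hmem l hl))
    simpa using this
  have hcont : ContinuousOn (fun l => F (l, xB - x, q)
      + l * dirDeriv (1, 0, 0) F (l, xB - x, q)) (Set.uIcc 0 1) := by
    rw [Set.uIcc_of_le zero_le_one]
    have hl : ContinuousOn (fun l : ℝ => (l, xB - x, q)) (Set.Icc 0 1) := by fun_prop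
    exact (hF.continuousOn.comp hl hmem).add (continuousOn_id.mul
      ((ContDiffOn.dirDeriv hΩ hF _).continuousOn.comp hl hmem))
  have hint := intervalIntegral.integral_eq_sub_of_hasDerivAt (a := 0) (b := 1)
    (fun l hl => hder l (by rwa [Set.uIcc_of_le zero_le_one] at hl)) hcont.intervalIntegrable
  have h1 := hDF 1 (xB - x) q one_pos hu (by simpa using hx.1) hq
  simp only [one_smul, sub_sub_cancel, one_mul] at h1
  rw [h1]
  simp only [one_mul, zero_mul, sub_zero] at hint
  rw [← hint]
  refine intervalIntegral.integral_congr_ae (Filter.Eventually.of_forall fun l hl => ?_)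
  rw [Set.uIoc_of_le zero_le_one] at hl
  have hl' : l ∈ Set.Icc (0 : ℝ) 1 := ⟨hl.1.le, hl.2⟩
  rw [hf l hl.1 hl.2]
  have hV : IsOpen ((U \ {xB}) ×ˢ params δ) :=
    (hU.sdiff isClosed_singleton).prod (isOpen_params δ)
  have hm : (xB - l • (xB - x), q) ∈ (U \ {xB}) ×ˢ params δ :=
    ⟨⟨(hmem l hl').2.1, segment_ne hxB hl.1.ne'⟩, hq⟩
  have hDd : DifferentiableAt ℝ (fun x => D x q) (xB - l • (xB - x)) :=
    ((hDs.contDiffOn.contDiffAt (hV.mem_nhds hm)).differentiableAt (by simp)).comp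
      (xB - l • (xB - x)) (f := fun x => (x, q)) (hasFDerivAt_prodMk_left _ _).differentiableAt
  have h2 : HasDerivAt (fun l : ℝ => D (xB - l • (xB - x)) q)
      (fderiv ℝ (fun x => D x q) (xB - l • (xB - x)) (-(xB - x))) l := by
    have hl : HasDerivAt (fun l : ℝ => xB - l • (xB - x)) (-(xB - x)) l := by
      simpa using ((hasDerivAt_id l).smul_const (xB - x)).const_sub xB
    exact hDd.hasFDerivAt.comp_hasDerivAt l hl
  have hev : (fun l : ℝ => D (xB - l • (xB - x)) q) =ᶠ[𝓝 l] fun l => l * F (l, xB - x, q) := by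
    have h3 : ∀ᶠ l' in 𝓝 l, (l', xB - x, q) ∈ polarDomain δ U xB :=
      (hγ l).continuousAt.eventually_mem (hΩ.mem_nhds (hmem l hl'))
    filter_upwards [h3, lt_mem_nhds hl.1] with l' h h' using hDF l' _ q h' h.1 h.2.1 h.2.2
  have := (h2.congr_of_eventuallyEq hev.symm).unique (hder l hl')
  rw [← this, map_neg]

end Regular

/-! ### The integrodifferential equation of the total delay -/

lemma grad_norm_sub {x xB : Position} (h : x ≠ xB) (i : Fin 3) :
    grad (fun y => ‖xB - y‖) x i = -dir x xB i := by
  have hne : xB - x ≠ 0 := sub_ne_zero.2 h.symm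
  have hd : DifferentiableAt ℝ (fun y : Position => ‖xB - y‖) x :=
    ((differentiableAt_const xB).sub differentiableAt_id).norm ℝ hne
  -- The gradient of the norm is read off from two expressions for the derivative of its square.
  have h1 : HasFDerivAt (fun y : Position => ‖xB - y‖ ^ 2) _ x :=
    ((hasFDerivAt_id x).const_sub xB).norm_sq
  have h2 : HasFDerivAt (fun y : Position => ‖xB - y‖ ^ 2) _ x := hd.hasFDerivAt.pow 2
  have := congrArg (fun L => L (EuclideanSpace.single i 1)) (h1.unique h2)
  simp [EuclideanSpace.inner_single_right] at this
  have hn : ‖xB - x‖ ≠ 0 := norm_ne_zero_iff.2 hne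
  simp only [grad, dir, PiLp.smul_apply, PiLp.sub_apply, smul_eq_mul]
  field_simp
  linarith

lemma norm_dir {x xB : Position} (h : x ≠ xB) : ∑ i, dir x xB i ^ 2 = 1 := by
  have hn : ‖xB - x‖ ≠ 0 := norm_ne_zero_iff.2 (sub_ne_zero.2 h.symm)
  have h1 : ‖dir x xB‖ = 1 := by
    rw [dir, norm_smul, norm_inv, norm_norm, inv_mul_cancel₀ hn]
  rw [← EuclideanSpace.real_norm_sq_eq, h1, one_pow]

/-- Contraction of a perturbed Minkowski metric with the covector `(1, a - N)`. -/
lemma null_contraction (H : Tensor) (hH : ∀ μ ν, H μ ν = H ν μ) (N : Position)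
    (hN : ∑ i, N i ^ 2 = 1) (a : Fin 3 → ℝ) :
    ∑ μ, ∑ ν, (eta + H) μ ν * (Matrix.vecCons 1 (fun i => -N i + a i) : Fin 4 → ℝ) μ
        * (Matrix.vecCons 1 (fun i => -N i + a i) : Fin 4 → ℝ) ν
      = contr0 H N + 2 * contr1 H N a + contr2 (eta + H) a a + 2 * ∑ i, N i * a i := by
  have s01 := hH 0 1; have s02 := hH 0 2; have s03 := hH 0 3
  have s12 := hH 1 2; have s13 := hH 1 3; have s23 := hH 2 3
  simp only [Fin.sum_univ_three] at hN
  simp [contr0, contr1, contr2, eta, Fin.sum_univ_succ, Fin.succ_ne_zero]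
  rw [← s01, ← s02, ← s03, ← s12, ← s13, ← s23]
  -- The Minkowskian part `1 - |N|²` of lowest order cancels.
  linear_combination (-1 : ℝ) * hN

lemma opticalMetric_eq (κ k : ℝ → Event → Tensor) (q : ℝ × ℝ) (z : Event) :
    opticalMetric κ k q z = eta + (κ q.1 z + k q.2 z) := by
  funext μ ν
  simp only [opticalMetric, Pi.add_apply]
  ring

lemma position_eq_sum (v : Position) : v = ∑ i, v i • EuclideanSpace.single i (1 : ℝ) := by
  ext j
  simp [Pi.single_apply]

/-- The total delay satisfies the delay equation for the sum of the two perturbations. -/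
lemma total_delay_equation {tB : ℝ} {xB : Position} {U : Set Position} {O : Set Event} {δ : ℝ}
    (hO : IsOpen O) (hU : IsOpen U) (hstar : StarConvex ℝ xB U) {κ k : ℝ → Event → Tensor}
    (hκ : IsPerturbation δ O κ) (hk : IsPerturbation δ O k) {Δ : Position → ℝ × ℝ → ℝ}
    (hregΔ : IsRegularDelay δ U xB Δ) {q : ℝ × ℝ} (hq : q ∈ params δ)
    (hrange : IsReceptionRange (opticalMetric κ k q) O U tB xB (fun x => ‖xB - x‖ + Δ x q)) :
    SolvesDelayEquation (fun z => κ q.1 z + k q.2 z) U tB xB (fun x => Δ x q)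
      (fun x => Δ x q) := by
  intro x hx
  have hxB : x ≠ xB := hx.2
  have hR : ‖xB - x‖ ≠ 0 := norm_ne_zero_iff.2 (sub_ne_zero.2 hxB.symm)
  have hdiff : ∀ (T : ℝ → Event → Tensor) a, a ∈ Set.Ioo (-δ) δ → IsPerturbation δ O T →
      ∀ μ ν, DifferentiableOn ℝ (fun z => T a z μ ν) O := fun T a ha hT μ ν =>
    ((hT.smooth μ ν).comp (f := fun z : Event => (a, z)) (by fun_prop)
      fun z hz => ⟨ha, hz⟩).differentiableOn (by simp)
  have hg : ∀ μ ν, DifferentiableOn ℝ (fun z => opticalMetric κ k q z μ ν) O := fun μ ν =>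
    ((hdiff k q.2 hq.2 hk μ ν).const_add (eta μ ν)).add (hdiff κ q.1 hq.1 hκ μ ν)
  have hgs : ∀ z ∈ O, ∀ μ ν, opticalMetric κ k q z μ ν = opticalMetric κ k q z ν μ := by
    intro z hz μ ν
    rw [opticalMetric, opticalMetric, hk.symm _ hq.2 z hz μ ν, hκ.symm _ hq.1 z hz μ ν]
    congr 2
    simp only [eta]
    by_cases h : μ = ν
    · simp [h]
    · simp [h, Ne.symm h]
  rw [← intervalIntegral.integral_const_mul]
  -- It now suffices to prove a pointwise identity along the segment: the null condition for the ray
  -- emitted at each of its points.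
  refine hregΔ.eq_integral hU hstar hq hx fun l hl hl1 => ?_
  set y := xB - l • (xB - x) with hy
  have hyU : y ∈ U \ {xB} := ⟨segment_mem hstar hx.1 hl.le hl1, segment_ne hxB hl.ne'⟩
  obtain ⟨hmem, hd, hnull⟩ := hrange.eikonal hO hg hgs hU hyU
  have hnorm : ‖xB - y‖ = l * ‖xB - x‖ := norm_sub_segment x xB hl.le
  have hdir : dir y xB = dir x xB := dir_segment x xB hl
  -- Because `|x_B - y| = l R_AB`, the emission event of the ray from `y` is exactly the point of
  -- the delayed path at `l`.
  have hline : delayedLine tB x xB (fun x => Δ x q) l = event (tB - (‖xB - y‖ + Δ y q)) y := by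
    rw [delayedLine, segment_eq hxB, ← hy, hnorm, sub_sub]
  set a := grad (fun x => Δ x q) y with ha
  have hnd : DifferentiableAt ℝ (fun x => ‖xB - x‖) y :=
    ((differentiableAt_const xB).sub differentiableAt_id).norm ℝ
      (sub_ne_zero.2 (Ne.symm hyU.2))
  have hΔd : DifferentiableAt ℝ (fun x => Δ x q) y := by
    have := hd.sub hnd
    refine this.congr_of_eventuallyEq (Filter.Eventually.of_forall fun z => ?_)
    simp
  have hgrad : grad (fun x => ‖xB - x‖ + Δ x q) y = fun i => -dir x xB i + a i := by
    funext i
    rw [← hdir, ← grad_norm_sub hyU.2, ha, grad, grad, grad, fderiv_fun_add hnd hΔd]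
    rfl
  rw [hgrad, opticalMetric_eq] at hnull
  rw [segment_eq hxB, ← hy, hline]
  rw [null_contraction _ (fun μ ν => by
    simp only [Pi.add_apply]
    rw [hk.symm _ hq.2 _ hmem μ ν, hκ.symm _ hq.1 _ hmem μ ν]) _ (norm_dir hxB)] at hnull
  have hf : fderiv ℝ (fun x => Δ x q) y (xB - x) = ‖xB - x‖ * ∑ i, dir x xB i * a i := by
    conv_lhs => rw [position_eq_sum (xB - x)]
    rw [map_sum, Finset.mul_sum]
    refine Finset.sum_congr rfl fun i _ => ?_
    rw [map_smul, smul_eq_mul, ha, grad, dir, PiLp.smul_apply, smul_eq_mul]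
    field_simp
  rw [hf]
  linear_combination ‖xB - x‖ / 2 * hnull

/-! ### Convolutions of sequences with vanishing initial terms -/

/-- Reindexing by `m = i - a` cuts off the vanishing initial terms of both sequences. The bound `1 ≤
α` makes the interval empty when the truncated difference `n - a - β` is zero. -/
lemma sum_antidiagonal_shift (A B : ℕ → ℝ) {α a β : ℕ} (hα : 1 ≤ α) (hA : ∀ i < α + a, A i = 0)
    (hB : ∀ j < β, B j = 0) (n : ℕ) :
    ∑ ij ∈ Finset.HasAntidiagonal.antidiagonal n, A ij.1 * B ij.2
      = ∑ m ∈ Finset.Icc α (n - a - β), A (m + a) * B (n - (m + a)) := by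
  symm
  refine Finset.sum_of_injOn (fun m => (m + a, n - (m + a))) ?_ ?_ ?_ ?_
  · intro m _ m' _ h
    simp only [Prod.mk.injEq] at h
    omega
  · intro m hm
    have := Finset.mem_Icc.1 (Finset.mem_coe.1 hm)
    exact Finset.mem_coe.2 (Finset.HasAntidiagonal.mem_antidiagonal.2 (by dsimp only; omega))
  · rintro ⟨i, j⟩ hij hni
    have hij : i + j = n := Finset.HasAntidiagonal.mem_antidiagonal.1 hij
    by_cases hi : i < α + a
    · rw [hA i hi, zero_mul]
    by_cases hj : j < β
    · rw [hB j hj, mul_zero]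
    exfalso
    refine hni ⟨i - a, Finset.mem_coe.2 (Finset.mem_Icc.2 ⟨by omega, by omega⟩), ?_⟩
    simp only [Prod.mk.injEq]
    omega
  · intro m _
    rfl

/-- Two applications of `sum_antidiagonal_shift`; the inner convolution starts at index `b + c + 2`.
-/
lemma sum_antidiagonal_shift₃ (A B C : ℕ → ℝ) {α b c : ℕ} (hα : 1 ≤ α) (hA : ∀ i < α, A i = 0)
    (hB : ∀ j ≤ b, B j = 0) (hC : ∀ j ≤ c, C j = 0) (n : ℕ) :
    ∑ ij ∈ Finset.HasAntidiagonal.antidiagonal n,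
        A ij.1 * ∑ pq ∈ Finset.HasAntidiagonal.antidiagonal ij.2, B pq.1 * C pq.2
      = ∑ m ∈ Finset.Icc α (n - b - c - 2), ∑ p ∈ Finset.Icc 1 (n - b - c - m - 1),
          A m * (B (p + b) * C (n - b - c - m - p + c)) := by
  have hBC : ∀ j, ∑ pq ∈ Finset.HasAntidiagonal.antidiagonal j, B pq.1 * C pq.2
      = ∑ p ∈ Finset.Icc 1 (j - b - (c + 1)), B (p + b) * C (j - (p + b)) := fun j =>
    sum_antidiagonal_shift B C le_rfl (fun i hi => hB i (by omega)) (fun i hi => hC i (by omega)) j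
  have h0 : ∀ j < b + c + 2,
      ∑ pq ∈ Finset.HasAntidiagonal.antidiagonal j, B pq.1 * C pq.2 = 0 := by
    intro j hj
    rw [hBC, Finset.Icc_eq_empty (by omega), Finset.sum_empty]
  rw [sum_antidiagonal_shift A (fun j => ∑ pq ∈ Finset.HasAntidiagonal.antidiagonal j,
    B pq.1 * C pq.2) (a := 0) hα hA h0]
  refine Finset.sum_congr (by congr 1; omega) fun m hm => ?_
  have hm := Finset.mem_Icc.1 hm
  rw [hBC, Finset.mul_sum]
  refine Finset.sum_congr (by congr 1; omega) fun p hp => ?_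
  have hp := Finset.mem_Icc.1 hp
  rw [show n - (m + 0) - (p + b) = n - b - c - m - p + c by omega, add_zero]

/-! ### Contractions of germs -/

lemma SmoothGerm.contr1 {K : ℝ → Tensor} (hK : ∀ μ ν, SmoothGerm fun t => K t μ ν) (N : Position)
    {a : ℝ → Fin 3 → ℝ} (ha : ∀ i, SmoothGerm fun t => a t i) :
    SmoothGerm fun t => OpticalDelay.contr1 (K t) N (a t) :=
  ContDiffAt.sum fun i _ => ContDiffAt.mul ((hK _ _).sub
    (ContDiffAt.sum fun _ _ => (hK _ _).mul contDiffAt_const)) (ha i)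

lemma SmoothGerm.contr2 {K : ℝ → Tensor} (hK : ∀ μ ν, SmoothGerm fun t => K t μ ν)
    {a b : ℝ → Fin 3 → ℝ} (ha : ∀ i, SmoothGerm fun t => a t i)
    (hb : ∀ i, SmoothGerm fun t => b t i) :
    SmoothGerm fun t => OpticalDelay.contr2 (K t) (a t) (b t) :=
  ContDiffAt.sum fun i _ => ContDiffAt.sum fun j _ => ((hK _ _).mul (ha i)).mul (hb j)

lemma jet_contr2 {K : ℝ → Tensor} (hK : ∀ μ ν, SmoothGerm fun t => K t μ ν)
    {a b : ℝ → Fin 3 → ℝ} (ha : ∀ i, SmoothGerm fun t => a t i)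
    (hb : ∀ i, SmoothGerm fun t => b t i) :
    jet (fun t => contr2 (K t) (a t) (b t)) = ∑ i : Fin 3, ∑ j : Fin 3,
      jet (fun t => K t i.succ j.succ) * (jet (fun t => a t i) * jet (fun t => b t j)) := by
  unfold contr2
  rw [jet_sum _ fun i _ => ContDiffAt.sum fun j _ => ((hK _ _).mul (ha i)).mul (hb j)]
  refine Finset.sum_congr rfl fun i _ => ?_
  rw [jet_sum _ fun j _ => ((hK _ _).mul (ha i)).mul (hb j)]
  refine Finset.sum_congr rfl fun j _ => ?_
  rw [jet_mul ((hK _ _).mul (ha i)) (hb j), jet_mul (hK _ _) (ha i), mul_assoc]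

/-- The germ `f` is smooth and its Taylor coefficients of index less than `k` vanish. -/
structure VanishesTo (k : ℕ) (f : ℝ → ℝ) : Prop where
  smooth : SmoothGerm f
  dvd : PowerSeries.X ^ k ∣ jet f

namespace VanishesTo

lemma coeff_eq_zero {k : ℕ} {f : ℝ → ℝ} (h : VanishesTo k f) {n : ℕ} (hn : n < k) :
    taylorCoeff n f = 0 := by
  rw [← coeff_jet]; exact PowerSeries.X_pow_dvd_iff.1 h.dvd n hn

lemma of_coeff {k : ℕ} {f : ℝ → ℝ} (hf : SmoothGerm f) (h : ∀ n < k, taylorCoeff n f = 0) :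
    VanishesTo k f :=
  ⟨hf, PowerSeries.X_pow_dvd_iff.2 fun n hn => by rw [coeff_jet, h n hn]⟩

lemma mono {k k' : ℕ} {f : ℝ → ℝ} (h : VanishesTo k f) (hk : k' ≤ k) : VanishesTo k' f :=
  ⟨h.smooth, (pow_dvd_pow _ hk).trans h.dvd⟩

lemma zero {f : ℝ → ℝ} (h : SmoothGerm f) : VanishesTo 0 f := ⟨h, by simp⟩

lemma mul {k k' : ℕ} {f g : ℝ → ℝ} (hf : VanishesTo k f) (hg : VanishesTo k' g) :
    VanishesTo (k + k') fun t => f t * g t :=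
  ⟨ContDiffAt.mul hf.smooth hg.smooth, by
    rw [jet_mul hf.smooth hg.smooth, pow_add]; exact mul_dvd_mul hf.dvd hg.dvd⟩

lemma add {k : ℕ} {f g : ℝ → ℝ} (hf : VanishesTo k f) (hg : VanishesTo k g) :
    VanishesTo k fun t => f t + g t :=
  ⟨ContDiffAt.add hf.smooth hg.smooth, by
    rw [jet_add hf.smooth hg.smooth]; exact dvd_add hf.dvd hg.dvd⟩

lemma const_mul {k : ℕ} {f : ℝ → ℝ} (c : ℝ) (hf : VanishesTo k f) :
    VanishesTo k fun t => c * f t := by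
  simpa using (zero (contDiffAt_const (c := c))).mul hf

lemma mul_const {k : ℕ} {f : ℝ → ℝ} (hf : VanishesTo k f) (c : ℝ) :
    VanishesTo k fun t => f t * c := hf.mul (zero contDiffAt_const)

lemma sub {k : ℕ} {f g : ℝ → ℝ} (hf : VanishesTo k f) (hg : VanishesTo k g) :
    VanishesTo k fun t => f t - g t := by
  simpa [sub_eq_add_neg] using hf.add (hg.const_mul (-1))

lemma sum {ι : Type*} (S : Finset ι) {k : ℕ} {f : ι → ℝ → ℝ} (hf : ∀ i, VanishesTo k (f i)) :
    VanishesTo k fun t => ∑ i ∈ S, f i t :=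
  ⟨ContDiffAt.sum fun i _ => (hf i).smooth, by
    rw [jet_sum S fun i _ => (hf i).smooth]; exact Finset.dvd_sum fun i _ => (hf i).dvd⟩

lemma contr0 {k : ℕ} {K : ℝ → Tensor} (hK : ∀ μ ν, VanishesTo k fun t => K t μ ν) (N : Position) :
    VanishesTo k fun t => OpticalDelay.contr0 (K t) N :=
  ((hK 0 0).sub ((sum _ fun i => (hK _ _).mul_const (N i)).const_mul 2)).add
    (sum _ fun i => sum _ fun j => ((hK _ _).mul_const (N i)).mul_const (N j))

lemma contr1 {k k' : ℕ} {K : ℝ → Tensor} (hK : ∀ μ ν, VanishesTo k fun t => K t μ ν)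
    (N : Position) {a : ℝ → Fin 3 → ℝ} (ha : ∀ i, VanishesTo k' fun t => a t i) :
    VanishesTo (k + k') fun t => OpticalDelay.contr1 (K t) N (a t) :=
  sum _ fun i => ((hK _ _).sub (sum _ fun j => (hK _ _).mul_const (N j))).mul (ha i)

lemma contr2 {k k' k'' : ℕ} {K : ℝ → Tensor} (hK : ∀ μ ν, VanishesTo k fun t => K t μ ν)
    {a b : ℝ → Fin 3 → ℝ} (ha : ∀ i, VanishesTo k' fun t => a t i)
    (hb : ∀ i, VanishesTo k'' fun t => b t i) :
    VanishesTo (k + k' + k'') fun t => OpticalDelay.contr2 (K t) (a t) (b t) :=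
  sum _ fun i => sum _ fun j => ((hK _ _).mul (ha i)).mul (hb j)

end VanishesTo

/-- The germ `K` of a tensor has the terms `c m` (`m ≥ α`), of order `m`, and no others. -/
structure TensorExpansion (K : ℝ → Tensor) (α : ℕ) (c : ℕ → Tensor) : Prop where
  vanishes : ∀ μ ν, VanishesTo α fun t => K t μ ν
  coeff : ∀ m, α ≤ m → ∀ μ ν, taylorCoeff m (fun t => K t μ ν) = c m μ ν

/-- The germ `a` of a covector has the terms `c p` (`p ≥ 1`), of order `p + b`, and no others. -/
structure CovectorExpansion (a : ℝ → Fin 3 → ℝ) (b : ℕ) (c : ℕ → Fin 3 → ℝ) : Prop where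
  vanishes : ∀ i, VanishesTo (b + 1) fun t => a t i
  coeff : ∀ p, 1 ≤ p → ∀ i, taylorCoeff (p + b) (fun t => a t i) = c p i

section Expansions

variable {K : ℝ → Tensor} {α : ℕ} {Kc : ℕ → Tensor} {a b : ℝ → Fin 3 → ℝ} {v w : ℕ}
  {ac bc : ℕ → Fin 3 → ℝ}

/-- A threefold Cauchy product in each component. The offsets `v`, `w` let both covector indices
count from `1`, as in the line integrals. -/
lemma taylorCoeff_contr2 (hα : 1 ≤ α) (hK : TensorExpansion K α Kc)
    (ha : CovectorExpansion a v ac) (hb : CovectorExpansion b w bc) (n : ℕ) :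
    taylorCoeff n (fun t => contr2 (K t) (a t) (b t))
      = ∑ m ∈ Finset.Icc α (n - v - w - 2), ∑ p ∈ Finset.Icc 1 (n - v - w - m - 1),
          contr2 (Kc m) (ac p) (bc (n - v - w - m - p)) := by
  rw [← coeff_jet, jet_contr2 (fun μ ν => (hK.vanishes μ ν).smooth)
    (fun i => (ha.vanishes i).smooth) (fun i => (hb.vanishes i).smooth), map_sum]
  have key : ∀ i j : Fin 3, PowerSeries.coeff n (jet (fun t => K t i.succ j.succ)
      * (jet (fun t => a t i) * jet (fun t => b t j)))
      = ∑ m ∈ Finset.Icc α (n - v - w - 2), ∑ p ∈ Finset.Icc 1 (n - v - w - m - 1),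
          Kc m i.succ j.succ * ac p i * bc (n - v - w - m - p) j := by
    intro i j
    simp only [PowerSeries.coeff_mul, coeff_jet]
    rw [sum_antidiagonal_shift₃ (fun m => taylorCoeff m fun t => K t i.succ j.succ)
      (fun m => taylorCoeff m fun t => a t i) (fun m => taylorCoeff m fun t => b t j) hα
      (fun m hm => (hK.vanishes _ _).coeff_eq_zero hm)
      (fun m hm => (ha.vanishes i).coeff_eq_zero (Nat.lt_succ_of_le hm))
      (fun m hm => (hb.vanishes j).coeff_eq_zero (Nat.lt_succ_of_le hm))]
    refine Finset.sum_congr rfl fun m hm => Finset.sum_congr rfl fun p hp => ?_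
    have hm := Finset.mem_Icc.1 hm
    have hp := Finset.mem_Icc.1 hp
    rw [hK.coeff m hm.1, ha.coeff p hp.1, hb.coeff _ (by omega), mul_assoc]
  simp only [map_sum, key, contr2]
  rw [Finset.sum_congr rfl fun i _ => Finset.sum_comm, Finset.sum_comm]
  refine Finset.sum_congr rfl fun m _ => ?_
  rw [Finset.sum_congr rfl fun i _ => Finset.sum_comm, Finset.sum_comm]

/-- Needed separately for `eta`, which has order zero and is not covered by a tensor expansion
starting at `α ≥ 1`. -/
lemma taylorCoeff_contr2_const (T : Tensor)
    (ha : CovectorExpansion a v ac) (hb : CovectorExpansion b w bc) (n : ℕ) :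
    taylorCoeff n (fun t => contr2 T (a t) (b t))
      = ∑ m ∈ Finset.Icc 1 (n - v - w - 1), contr2 T (ac m) (bc (n - v - w - m)) := by
  rw [← coeff_jet, jet_contr2 (K := fun _ => T) (fun μ ν => contDiffAt_const)
    (fun i => (ha.vanishes i).smooth) (fun i => (hb.vanishes i).smooth), map_sum]
  have key : ∀ i j : Fin 3, PowerSeries.coeff n (jet (fun _ => T i.succ j.succ)
      * (jet (fun t => a t i) * jet (fun t => b t j)))
      = ∑ m ∈ Finset.Icc 1 (n - v - w - 1),
          T i.succ j.succ * ac m i * bc (n - v - w - m) j := by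
    intro i j
    rw [jet_const, PowerSeries.coeff_C_mul, PowerSeries.coeff_mul]
    simp only [coeff_jet]
    rw [sum_antidiagonal_shift
      (fun m => taylorCoeff m fun t => a t i) (fun m => taylorCoeff m fun t => b t j)
      (α := 1) (a := v) (β := w + 1) le_rfl
      (fun m hm => (ha.vanishes i).coeff_eq_zero (by omega))
      (fun m hm => (hb.vanishes j).coeff_eq_zero hm), Finset.mul_sum]
    refine Finset.sum_congr (by congr 1) fun m hm => ?_
    have hm := Finset.mem_Icc.1 hm
    rw [ha.coeff m hm.1, show n - (m + v) = n - v - w - m + w by omega,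
      hb.coeff _ (by omega), mul_assoc]
  simp only [map_sum, key, contr2]
  rw [Finset.sum_congr rfl fun i _ => Finset.sum_comm, Finset.sum_comm]

lemma taylorCoeff_contr1 (hα : 1 ≤ α) (hK : TensorExpansion K α Kc) (N : Position)
    (ha : CovectorExpansion a v ac) (n : ℕ) :
    taylorCoeff n (fun t => contr1 (K t) N (a t))
      = ∑ m ∈ Finset.Icc α (n - v - 1), contr1 (Kc m) N (ac (n - v - m)) := by
  have hv := hK.vanishes
  have h1 : ∀ i : Fin 3, VanishesTo α fun t => K t 0 i.succ - ∑ j : Fin 3, K t i.succ j.succ * N j :=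
    fun i => (hv _ _).sub (VanishesTo.sum _ fun j => (hv _ _).mul_const (N j))
  have hc : ∀ (i : Fin 3) m, α ≤ m →
      taylorCoeff m (fun t => K t 0 i.succ - ∑ j : Fin 3, K t i.succ j.succ * N j)
        = Kc m 0 i.succ - ∑ j : Fin 3, Kc m i.succ j.succ * N j := by
    intro i m hm
    rw [← coeff_jet, jet_sub (hv _ _).smooth
      (VanishesTo.sum _ fun j => (hv _ _).mul_const (N j)).smooth,
      jet_sum _ fun j _ => ((hv _ _).mul_const (N j)).smooth]
    simp only [jet_mul_const, map_sub, map_sum, coeff_jet, PowerSeries.coeff_mul_C,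
      hK.coeff m hm]
  unfold contr1
  rw [← coeff_jet, jet_sum _ fun i _ => ((h1 i).mul (ha.vanishes i)).smooth, map_sum,
    Finset.sum_comm]
  refine Finset.sum_congr rfl fun i _ => ?_
  rw [jet_mul (h1 i).smooth (ha.vanishes i).smooth, PowerSeries.coeff_mul]
  simp only [coeff_jet]
  rw [sum_antidiagonal_shift
    (fun m => taylorCoeff m fun t => K t 0 i.succ - ∑ j : Fin 3, K t i.succ j.succ * N j)
    (fun m => taylorCoeff m fun t => a t i) (a := 0) (β := v + 1) hα
    (fun m hm => (h1 i).coeff_eq_zero hm) (fun m hm => (ha.vanishes i).coeff_eq_zero hm)]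
  refine Finset.sum_congr (by congr 1) fun m hm => ?_
  have hm := Finset.mem_Icc.1 hm
  rw [show n - (m + 0) = n - v - m + v by omega, ha.coeff _ (by omega), add_zero, hc i m hm.1]

end Expansions

/-! ### The integrand of the coupling delay -/

/-- The integrand of the delay equation. -/
def delayDensity (N : Position) (T : Tensor) (a : Fin 3 → ℝ) : ℝ :=
  contr0 T N + 2 * contr1 T N a + contr2 (eta + T) a a

/-- The terms of the coupling integrand that correspond to `LineData.int1`, …, `LineData.int8`. -/
def couplingPart (N : Position) (K k : Tensor) (r g c : Fin 3 → ℝ) : Fin 8 → ℝ :=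
  ![contr2 eta r g + contr1 K N g + contr1 k N r,
    contr2 eta r c + contr1 K N c + contr2 K r g + 1 / 2 * contr2 k r r,
    contr2 K r c,
    contr2 eta g c + contr1 k N c + contr2 k r g + 1 / 2 * contr2 K g g,
    contr2 eta c c + 2 * contr2 k r c + 2 * contr2 K g c,
    contr2 K c c,
    contr2 k g c,
    contr2 k c c]

/-- The factors of the parts in the coupling integrand. -/
def couplingWeight : Fin 8 → ℝ := ![1, 1, 1, 1, 1 / 2, 1 / 2, 1, 1 / 2]

lemma contr0_add (S T : Tensor) (N : Position) :
    contr0 (S + T) N = contr0 S N + contr0 T N := by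
  simp only [contr0, Pi.add_apply, add_mul, Finset.sum_add_distrib]; ring

lemma contr1_add_left (S T : Tensor) (N : Position) (a : Fin 3 → ℝ) :
    contr1 (S + T) N a = contr1 S N a + contr1 T N a := by
  simp only [contr1, Pi.add_apply, add_mul, ← Finset.sum_add_distrib]
  refine Finset.sum_congr rfl fun i _ => ?_
  rw [Finset.sum_add_distrib]; ring

lemma contr1_add_right (T : Tensor) (N : Position) (a b : Fin 3 → ℝ) :
    contr1 T N (a + b) = contr1 T N a + contr1 T N b := by
  simp only [contr1, Pi.add_apply, mul_add, Finset.sum_add_distrib]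

lemma contr2_add_left (S T : Tensor) (a b : Fin 3 → ℝ) :
    contr2 (S + T) a b = contr2 S a b + contr2 T a b := by
  simp only [contr2, Pi.add_apply, add_mul, Finset.sum_add_distrib]

lemma contr2_add_mid (T : Tensor) (a a' b : Fin 3 → ℝ) :
    contr2 T (a + a') b = contr2 T a b + contr2 T a' b := by
  simp only [contr2, Pi.add_apply, mul_add, add_mul, Finset.sum_add_distrib]

lemma contr2_add_right (T : Tensor) (a b b' : Fin 3 → ℝ) :
    contr2 T a (b + b') = contr2 T a b + contr2 T a b' := by
  simp only [contr2, Pi.add_apply, mul_add, Finset.sum_add_distrib]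

lemma contr2_comm {T : Tensor} (hT : ∀ μ ν, T μ ν = T ν μ) (a b : Fin 3 → ℝ) :
    contr2 T a b = contr2 T b a := by
  unfold contr2
  rw [Finset.sum_comm]
  refine Finset.sum_congr rfl fun i _ => Finset.sum_congr rfl fun j _ => ?_
  rw [hT]; ring

lemma eta_symm (μ ν : Fin 4) : eta μ ν = eta ν μ := by
  simp only [eta]
  by_cases h : μ = ν
  · simp [h]
  · simp [h, Ne.symm h]

/-- Subtracting the equations of the refractive and of the gravitational delay from that of the
total delay leaves the coupling integrand. -/
lemma delayDensity_sub (N : Position) {K k : Tensor} (hK : ∀ μ ν, K μ ν = K ν μ)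
    (hk : ∀ μ ν, k μ ν = k ν μ) (r g c : Fin 3 → ℝ) :
    delayDensity N (K + k) (r + g + c) - delayDensity N k g - delayDensity N K r
      = 2 * ∑ i, couplingWeight i * couplingPart N K k r g c i := by
  simp only [delayDensity, couplingPart, couplingWeight, Fin.sum_univ_succ, contr0_add,
    contr1_add_left, contr1_add_right, contr2_add_left, contr2_add_mid, contr2_add_right]
  -- The quadratic terms contain each mixed product in both orders; symmetry merges them, so that a
  -- common factor `2` can be extracted.
  rw [contr2_comm hK g r, contr2_comm hK c r, contr2_comm hK c g, contr2_comm hk g r,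
    contr2_comm hk c r, contr2_comm hk c g, contr2_comm eta_symm g r, contr2_comm eta_symm c r,
    contr2_comm eta_symm c g]
  simp
  ring

/-! ### Orders of the coupling integrand -/

section Orders

variable {K k : ℝ → Tensor} {r g c : ℝ → Fin 3 → ℝ}

/-- The three terms have orders at least `s`, `s + n` and `2 n`, each at least `n + 1`. The density
thus gains an order over the gradient, which drives the induction for `Δ_g`. -/
lemma VanishesTo.delayDensity {s n : ℕ} (hn : 1 ≤ n) (hns : n < s) (N : Position)
    (hk : ∀ μ ν, VanishesTo s fun t => k t μ ν) (hg : ∀ i, VanishesTo n fun t => g t i) :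
    VanishesTo (n + 1) fun t => delayDensity N (k t) (g t) := by
  have h1 : ∀ μ ν, VanishesTo 0 fun t => (eta + k t) μ ν := fun μ ν =>
    (VanishesTo.zero contDiffAt_const).add ((hk μ ν).mono (Nat.zero_le _))
  exact ((((VanishesTo.contr0 hk N).mono (by omega)).add
    (((VanishesTo.contr1 hk N hg).mono (by omega)).const_mul 2))).add
    ((VanishesTo.contr2 h1 hg hg).mono (by omega))

/-- Each product either contains `c` with a further factor of positive order, or has order at least
`s + 1 ≥ n + 1` without it. This drives the induction for `Δ_gr`. -/
lemma VanishesTo.couplingPart {s n : ℕ} (hs : 1 ≤ s) (hn : 1 ≤ n) (hns : n ≤ s) (N : Position)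
    (hK : ∀ μ ν, VanishesTo 1 fun t => K t μ ν) (hk : ∀ μ ν, VanishesTo s fun t => k t μ ν)
    (hr : ∀ i, VanishesTo 1 fun t => r t i) (hg : ∀ i, VanishesTo s fun t => g t i)
    (hc : ∀ i, VanishesTo n fun t => c t i) (i : Fin 8) :
    VanishesTo (n + 1) fun t => couplingPart N (K t) (k t) (r t) (g t) (c t) i := by
  have he : ∀ μ ν, VanishesTo 0 fun _ => eta μ ν := fun μ ν => VanishesTo.zero contDiffAt_const
  fin_cases i
  · exact (((VanishesTo.contr2 he hr hg).mono (by omega)).add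
      ((VanishesTo.contr1 hK N hg).mono (by omega))).add
      ((VanishesTo.contr1 hk N hr).mono (by omega))
  · exact ((((VanishesTo.contr2 he hr hc).mono (by omega)).add
      ((VanishesTo.contr1 hK N hc).mono (by omega))).add
      ((VanishesTo.contr2 hK hr hg).mono (by omega))).add
      (((VanishesTo.contr2 hk hr hr).mono (by omega)).const_mul _)
  · exact (VanishesTo.contr2 hK hr hc).mono (by omega)
  · exact ((((VanishesTo.contr2 he hg hc).mono (by omega)).add
      ((VanishesTo.contr1 hk N hc).mono (by omega))).add
      ((VanishesTo.contr2 hk hr hg).mono (by omega))).add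
      (((VanishesTo.contr2 hK hg hg).mono (by omega)).const_mul _)
  · exact (((VanishesTo.contr2 he hc hc).mono (by omega)).add
      (((VanishesTo.contr2 hk hr hc).mono (by omega)).const_mul _)).add
      (((VanishesTo.contr2 hK hg hc).mono (by omega)).const_mul _)
  · exact (VanishesTo.contr2 hK hc hc).mono (by omega)
  · exact (VanishesTo.contr2 hk hg hc).mono (by omega)
  · exact (VanishesTo.contr2 hk hc hc).mono (by omega)

/-- The integrands of the line integrals. -/
def LineData.int (P : LineData) (s l : ℕ) : Fin 8 → ℝ :=
  ![P.int1 s l, P.int2 s l, P.int3 l, P.int4 s l, P.int5 s l, P.int6 s l, P.int7 s l, P.int8 s l]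

lemma taylorCoeff_add {f h : ℝ → ℝ} (hf : SmoothGerm f) (hh : SmoothGerm h) (n : ℕ) :
    taylorCoeff n (fun t => f t + h t) = taylorCoeff n f + taylorCoeff n h := by
  rw [← coeff_jet, jet_add hf hh, map_add, coeff_jet, coeff_jet]

lemma taylorCoeff_const_mul (a : ℝ) (f : ℝ → ℝ) (n : ℕ) :
    taylorCoeff n (fun t => a * f t) = a * taylorCoeff n f := by
  rw [← coeff_jet, jet_const_mul, PowerSeries.coeff_C_mul, coeff_jet]

/-- The terms of the expansion of the coupling integrand. -/
lemma taylorCoeff_couplingPart {s : ℕ} (hs : 1 ≤ s) (P : LineData) (hK : TensorExpansion K 1 P.κ)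
    (hk : TensorExpansion k s P.k) (hr : CovectorExpansion r 0 P.r)
    (hg : CovectorExpansion g (s - 1) P.g) (hc : CovectorExpansion c s P.gr) (l : ℕ) (i : Fin 8) :
    taylorCoeff (l + s) (fun t => couplingPart P.N (K t) (k t) (r t) (g t) (c t) i)
      = P.int s l i := by
  have sK := fun μ ν => (hK.vanishes μ ν).smooth
  have sk := fun μ ν => (hk.vanishes μ ν).smooth
  have sr := fun i => (hr.vanishes i).smooth
  have sg := fun i => (hg.vanishes i).smooth
  have sc := fun i => (hc.vanishes i).smooth
  have se : ∀ μ ν, SmoothGerm fun _ => eta μ ν := fun μ ν => contDiffAt_const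
  -- The offsets of `r`, `g`, `c` are `0`, `s - 1`, `s`. Inserting them at order `l + s` gives the
  -- limits and indices of the line integrals; the memberships `hm`, `hp` are used where truncated
  -- subtraction would otherwise intervene.
  fin_cases i
  · change taylorCoeff (l + s) (fun t => contr2 eta (r t) (g t) + contr1 (K t) P.N (g t)
      + contr1 (k t) P.N (r t)) = P.int1 s l
    rw [taylorCoeff_add ((SmoothGerm.contr2 se sr sg).add (SmoothGerm.contr1 sK _ sg))
      (SmoothGerm.contr1 sk _ sr),
      taylorCoeff_add (SmoothGerm.contr2 se sr sg) (SmoothGerm.contr1 sK _ sg),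
      taylorCoeff_contr2_const eta hr hg, taylorCoeff_contr1 le_rfl hK _ hg,
      taylorCoeff_contr1 hs hk _ hr, LineData.int1]
    congr 1
    · congr 1
      · refine Finset.sum_congr (by congr 1; omega) fun m hm => ?_
        have := Finset.mem_Icc.1 hm
        congr 2; omega
      · refine Finset.sum_congr (by congr 1; omega) fun m hm => ?_
        have := Finset.mem_Icc.1 hm
        congr 2; omega
  · change taylorCoeff (l + s) (fun t => contr2 eta (r t) (c t) + contr1 (K t) P.N (c t)
      + contr2 (K t) (r t) (g t) + 1 / 2 * contr2 (k t) (r t) (r t)) = P.int2 s l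
    have s1 := SmoothGerm.contr2 se sr sc
    have s2 := SmoothGerm.contr1 sK P.N sc
    have s3 := SmoothGerm.contr2 sK sr sg
    rw [taylorCoeff_add ((s1.add s2).add s3) (contDiffAt_const.mul (SmoothGerm.contr2 sk sr sr)),
      taylorCoeff_add (s1.add s2) s3, taylorCoeff_add s1 s2, taylorCoeff_const_mul,
      taylorCoeff_contr2_const eta hr hc, taylorCoeff_contr1 le_rfl hK _ hc,
      taylorCoeff_contr2 le_rfl hK hr hg, taylorCoeff_contr2 hs hk hr hr, LineData.int2]
    congr 1
    · congr 1
      · congr 1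
        · refine Finset.sum_congr (by congr 1; omega) fun m hm => ?_
          congr 2; omega
        · refine Finset.sum_congr (by congr 1; omega) fun m hm => ?_
          congr 2; omega
      · refine Finset.sum_congr (by congr 1; omega) fun m hm => ?_
        have := Finset.mem_Icc.1 hm
        refine Finset.sum_congr (by congr 1; omega) fun p hp => ?_
        have := Finset.mem_Icc.1 hp
        congr 2; omega
  · change taylorCoeff (l + s) (fun t => contr2 (K t) (r t) (c t)) = P.int3 l
    rw [taylorCoeff_contr2 le_rfl hK hr hc, LineData.int3]
    refine Finset.sum_congr (by congr 1; omega) fun m hm => ?_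
    refine Finset.sum_congr (by congr 1; omega) fun p hp => ?_
    congr 2; omega
  · change taylorCoeff (l + s) (fun t => contr2 eta (g t) (c t) + contr1 (k t) P.N (c t)
      + contr2 (k t) (r t) (g t) + 1 / 2 * contr2 (K t) (g t) (g t)) = P.int4 s l
    have s1 := SmoothGerm.contr2 se sg sc
    have s2 := SmoothGerm.contr1 sk P.N sc
    have s3 := SmoothGerm.contr2 sk sr sg
    rw [taylorCoeff_add ((s1.add s2).add s3) (contDiffAt_const.mul (SmoothGerm.contr2 sK sg sg)),
      taylorCoeff_add (s1.add s2) s3, taylorCoeff_add s1 s2, taylorCoeff_const_mul,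
      taylorCoeff_contr2_const eta hg hc, taylorCoeff_contr1 hs hk _ hc,
      taylorCoeff_contr2 hs hk hr hg, taylorCoeff_contr2 le_rfl hK hg hg, LineData.int4]
    congr 1
    · congr 1
      · congr 1
        · refine Finset.sum_congr (by congr 1; omega) fun m hm => ?_
          have := Finset.mem_Icc.1 hm
          congr 2; omega
        · refine Finset.sum_congr (by congr 1; omega) fun m hm => ?_
          congr 2; omega
      · refine Finset.sum_congr (by congr 1; omega) fun m hm => ?_
        have := Finset.mem_Icc.1 hm
        refine Finset.sum_congr (by congr 1; omega) fun p hp => ?_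
        have := Finset.mem_Icc.1 hp
        congr 2; omega
    · congr 1
      refine Finset.sum_congr (by congr 1; omega) fun m hm => ?_
      have := Finset.mem_Icc.1 hm
      refine Finset.sum_congr (by congr 1; omega) fun p hp => ?_
      have := Finset.mem_Icc.1 hp
      congr 2; omega
  · change taylorCoeff (l + s) (fun t => contr2 eta (c t) (c t) + 2 * contr2 (k t) (r t) (c t)
      + 2 * contr2 (K t) (g t) (c t)) = P.int5 s l
    have s1 := SmoothGerm.contr2 se sc sc
    have s2 : SmoothGerm fun t => 2 * contr2 (k t) (r t) (c t) :=
      contDiffAt_const.mul (SmoothGerm.contr2 sk sr sc)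
    have s3 : SmoothGerm fun t => 2 * contr2 (K t) (g t) (c t) :=
      contDiffAt_const.mul (SmoothGerm.contr2 sK sg sc)
    rw [taylorCoeff_add (s1.add s2) s3, taylorCoeff_add s1 s2, taylorCoeff_const_mul,
      taylorCoeff_const_mul, taylorCoeff_contr2_const eta hc hc, taylorCoeff_contr2 hs hk hr hc,
      taylorCoeff_contr2 le_rfl hK hg hc, LineData.int5]
    congr 1
    · congr 1
      · refine Finset.sum_congr (by congr 1; omega) fun m hm => ?_
        congr 2; omega
      · congr 1
        refine Finset.sum_congr (by congr 1; omega) fun m hm => ?_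
        refine Finset.sum_congr (by congr 1; omega) fun p hp => ?_
        congr 2; omega
    · congr 1
      refine Finset.sum_congr (by congr 1; omega) fun m hm => ?_
      have := Finset.mem_Icc.1 hm
      refine Finset.sum_congr (by congr 1; omega) fun p hp => ?_
      have := Finset.mem_Icc.1 hp
      congr 2; omega
  · change taylorCoeff (l + s) (fun t => contr2 (K t) (c t) (c t)) = P.int6 s l
    rw [taylorCoeff_contr2 le_rfl hK hc hc, LineData.int6]
    refine Finset.sum_congr (by congr 1; omega) fun m hm => ?_
    refine Finset.sum_congr (by congr 1; omega) fun p hp => ?_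
    congr 2; omega
  · change taylorCoeff (l + s) (fun t => contr2 (k t) (g t) (c t)) = P.int7 s l
    rw [taylorCoeff_contr2 hs hk hg hc, LineData.int7]
    refine Finset.sum_congr (by congr 1; omega) fun m hm => ?_
    have := Finset.mem_Icc.1 hm
    refine Finset.sum_congr (by congr 1; omega) fun p hp => ?_
    have := Finset.mem_Icc.1 hp
    congr 2; omega
  · change taylorCoeff (l + s) (fun t => contr2 (k t) (c t) (c t)) = P.int8 s l
    rw [taylorCoeff_contr2 hs hk hc hc, LineData.int8]
    refine Finset.sum_congr (by congr 1; omega) fun m hm => ?_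
    refine Finset.sum_congr (by congr 1; omega) fun p hp => ?_
    congr 2; omega

end Orders

/-- The bounds on `l` in the coupling integral are redundant. -/
lemma couplingIntegral_eq (R : ℝ) (P : ℝ → LineData) {s : ℕ} (hs : 1 ≤ s) (l : ℕ) :
    couplingIntegral R P s l
      = R * ∑ i, couplingWeight i * ∫ t in (0 : ℝ)..1, (P t).int s l i := by
  -- Below each bound all the sums in the integrand run over empty intervals.
  have h2 : ¬ 2 ≤ l → ∀ t, (P t).int2 s l = 0 := fun h t => by
    simp [LineData.int2, Finset.Icc_eq_empty (show ¬ 1 ≤ l - 1 by omega),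
      Finset.Icc_eq_empty (show ¬ s ≤ l + s - 2 by omega)]
  have h3 : ¬ 3 ≤ l → ∀ t, (P t).int3 l = 0 := fun h t => by
    simp [LineData.int3, Finset.Icc_eq_empty (show ¬ 1 ≤ l - 2 by omega)]
  have h4 : ¬ s + 1 ≤ l → ∀ t, (P t).int4 s l = 0 := fun h t => by
    simp [LineData.int4, Finset.Icc_eq_empty (show ¬ 1 ≤ l - s by omega),
      Finset.Icc_eq_empty (show ¬ s ≤ l - 1 by omega)]
  have h5 : ¬ s + 2 ≤ l → ∀ t, (P t).int5 s l = 0 := fun h t => by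
    simp [LineData.int5, Finset.Icc_eq_empty (show ¬ 1 ≤ l - s - 1 by omega),
      Finset.Icc_eq_empty (show ¬ s ≤ l - 2 by omega)]
  have h6 : ¬ s + 3 ≤ l → ∀ t, (P t).int6 s l = 0 := fun h t => by
    simp [LineData.int6, Finset.Icc_eq_empty (show ¬ 1 ≤ l - s - 2 by omega)]
  have h7 : ¬ 2 * s + 1 ≤ l → ∀ t, (P t).int7 s l = 0 := fun h t => by
    simp [LineData.int7, Finset.Icc_eq_empty (show ¬ s ≤ l - s - 1 by omega)]
  have h8 : ¬ 2 * s + 2 ≤ l → ∀ t, (P t).int8 s l = 0 := fun h t => by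
    simp [LineData.int8, Finset.Icc_eq_empty (show ¬ s ≤ l - s - 2 by omega)]
  have key : ∀ (c : Prop) [Decidable c] (A : ℝ) (f : ℝ → ℝ), (¬ c → ∀ t, f t = 0) →
      (if c then A * ∫ t in (0 : ℝ)..1, f t else 0) = A * ∫ t in (0 : ℝ)..1, f t := by
    intro c _ A f h
    split_ifs with hc
    · rfl
    · simp [h hc]
  rw [couplingIntegral, key _ _ _ h2, key _ _ _ h3, key _ _ _ h4, key _ _ _ h5, key _ _ _ h6,
    key _ _ _ h7, key _ _ _ h8]
  simp only [Fin.sum_univ_succ, couplingWeight, LineData.int]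
  simp
  ring

/-! ### Germs along the segment between emission and reception -/

/-- The scaling `(N₀, G) ↦ (t N₀, tˢ G)` of the parameters. -/
def scaledParams (s : ℕ) (q : ℝ × ℝ) (t : ℝ) : ℝ × ℝ := (t * q.1, t ^ s * q.2)

lemma contDiff_scaledParams (s : ℕ) (q : ℝ × ℝ) {n : ℕ∞ω} : ContDiff ℝ n (scaledParams s q) := by
  unfold scaledParams; fun_prop

lemma scaledParams_zero {s : ℕ} (hs : 1 ≤ s) (q : ℝ × ℝ) : scaledParams s q 0 = 0 := by
  simp [scaledParams, Nat.one_le_iff_ne_zero.1 hs]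

/-- The bridge from orders in two parameters to Taylor coefficients in the scaling variable. -/
lemma orderTerm_eq (s n : ℕ) (f : ℝ × ℝ → ℝ) (q : ℝ × ℝ) :
    orderTerm s n f q = taylorCoeff n fun t => f (scaledParams s q t) := rfl

lemma zero_mem_params {δ : ℝ} (hδ : 0 < δ) : (0 : ℝ × ℝ) ∈ params δ := by
  refine ⟨⟨?_, ?_⟩, ⟨?_, ?_⟩⟩ <;> simp [hδ]

lemma eventually_scaledParams_mem {δ : ℝ} (hδ : 0 < δ) {s : ℕ} (hs : 1 ≤ s) (q : ℝ × ℝ) :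
    ∀ᶠ t in 𝓝 (0 : ℝ), scaledParams s q t ∈ params δ :=
  (contDiff_scaledParams s q (n := 0)).continuous.continuousAt.eventually_mem
    ((isOpen_params δ).mem_nhds (by rw [scaledParams_zero hs]; exact zero_mem_params hδ))

section Delay

variable {δ : ℝ} {U : Set Position} {xA xB x : Position} {D : Position → ℝ × ℝ → ℝ} {s : ℕ}

lemma IsRegularDelay.contDiffOn_scaled (hD : IsRegularDelay δ U xB D) (s : ℕ) (q : ℝ × ℝ) :
    ContDiffOn ℝ ∞ (fun w : Position × ℝ => D w.1 (scaledParams s q w.2))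
      {w | w.1 ∈ U \ {xB} ∧ scaledParams s q w.2 ∈ params δ} :=
  hD.contDiffOn.comp (f := fun w : Position × ℝ => (w.1, scaledParams s q w.2))
    (contDiff_fst.prodMk ((contDiff_scaledParams s q).comp contDiff_snd)).contDiffOn
    fun _ hw => ⟨hw.1, hw.2⟩

lemma isOpen_scaled (hU : IsOpen U) (s : ℕ) (q : ℝ × ℝ) :
    IsOpen {w : Position × ℝ | w.1 ∈ U \ {xB} ∧ scaledParams s q w.2 ∈ params δ} :=
  ((hU.sdiff isClosed_singleton).preimage continuous_fst).inter ((isOpen_params δ).preimage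
    ((contDiff_scaledParams s q (n := 0)).continuous.comp continuous_snd))

lemma mem_scaled (hδ : 0 < δ) (hs : 1 ≤ s) (q : ℝ × ℝ) (hx : x ∈ U \ {xB}) :
    (x, (0 : ℝ)) ∈ {w : Position × ℝ | w.1 ∈ U \ {xB} ∧ scaledParams s q w.2 ∈ params δ} :=
  ⟨hx, by simp only [scaledParams_zero hs]; exact zero_mem_params hδ⟩

lemma IsRegularDelay.smoothGerm (hδ : 0 < δ) (hU : IsOpen U) (hD : IsRegularDelay δ U xB D)
    (hs : 1 ≤ s) (q : ℝ × ℝ) (hx : x ∈ U \ {xB}) :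
    SmoothGerm fun t => D x (scaledParams s q t) :=
  ((hD.contDiffOn_scaled s q).contDiffAt
    ((isOpen_scaled hU s q).mem_nhds (mem_scaled hδ hs q hx))).comp (0 : ℝ)
    (contDiffAt_const.prodMk contDiffAt_id)

lemma IsRegularDelay.differentiableAt (hU : IsOpen U) (hD : IsRegularDelay δ U xB D) {q : ℝ × ℝ}
    (hq : q ∈ params δ) (hx : x ∈ U \ {xB}) : DifferentiableAt ℝ (fun y => D y q) x :=
  ((hD.contDiffOn.contDiffAt (((hU.sdiff isClosed_singleton).prod (isOpen_params δ)).mem_nhds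
    ⟨hx, hq⟩)).differentiableAt (by simp)).comp x (f := fun y => (y, q))
    (hasFDerivAt_prodMk_left _ _).differentiableAt

/-- The expansion of a gradient consists of the gradients of the terms. -/
lemma IsRegularDelay.taylorCoeff_grad (hδ : 0 < δ) (hU : IsOpen U) (hD : IsRegularDelay δ U xB D)
    (hs : 1 ≤ s) (q : ℝ × ℝ) (hx : x ∈ U \ {xB}) (n : ℕ) (i : Fin 3) :
    taylorCoeff n (fun t => grad (fun y => D y (scaledParams s q t)) x i)
      = grad (fun y => orderTerm s n (D y) q) x i :=
  (fderiv_taylorCoeff (isOpen_scaled hU s q) (hD.contDiffOn_scaled s q) n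
    (mem_scaled hδ hs q hx) _).symm

lemma grad_orderTerm_eq_zero (hU : IsOpen U) {q : ℝ × ℝ} {n : ℕ}
    (h : ∀ x ∈ U \ {xB}, orderTerm s n (D x) q = 0) (hx : x ∈ U \ {xB}) (i : Fin 3) :
    grad (fun y => orderTerm s n (D y) q) x i = 0 := by
  have : (fun y => orderTerm s n (D y) q) =ᶠ[𝓝 x] fun _ => 0 := by
    filter_upwards [(hU.sdiff isClosed_singleton).mem_nhds hx] with y hy using h y hy
  rw [grad, this.fderiv_eq]
  simp

lemma segment_mem_punctured (hstar : StarConvex ℝ xB U) (hxA : xA ∈ U \ {xB}) {l : ℝ}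
    (h0 : 0 < l) (h1 : l ≤ 1) : segment xA xB l ∈ U \ {xB} := by
  rw [segment_eq hxA.2]
  exact ⟨segment_mem hstar hxA.1 h0.le h1, segment_ne hxA.2 h0.ne'⟩

lemma polar_mem (hδ : 0 < δ) (hstar : StarConvex ℝ xB U) (hxA : xA ∈ U \ {xB}) (hs : 1 ≤ s)
    (q : ℝ × ℝ) {l : ℝ} (hl : l ∈ Set.Icc (0 : ℝ) 1) :
    (l, xB - xA, scaledParams s q 0) ∈ polarDomain δ U xB :=
  ⟨sub_ne_zero.2 (Ne.symm hxA.2), segment_mem hstar hxA.1 hl.1 hl.2, by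
    rw [scaledParams_zero hs]; exact zero_mem_params hδ⟩

lemma contDiff_polar (u : Position) (s : ℕ) (q : ℝ × ℝ) :
    ContDiff ℝ ∞ fun y : ℝ × ℝ => (y.1, u, scaledParams s q y.2) :=
  contDiff_fst.prodMk (contDiff_const.prodMk ((contDiff_scaledParams s q).comp contDiff_snd))

/-- The extension to `l = 0` is the one of `grad_polar`, with `r = l` and the fixed vector `u = x_B
- x_A`. -/
lemma IsRegularDelay.lineSmooth_grad (hδ : 0 < δ) (hU : IsOpen U) (hstar : StarConvex ℝ xB U)
    (hD : IsRegularDelay δ U xB D) (hs : 1 ≤ s) (q : ℝ × ℝ) (hxA : xA ∈ U \ {xB}) (i : Fin 3) :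
    LineSmooth fun l t => grad (fun y => D y (scaledParams s q t)) (segment xA xB l) i := by
  have hDs := hD
  obtain ⟨F, hF, hDF⟩ := hD
  have hpol := contDiff_polar (xB - xA) s q
  have hΩ := isOpen_polarDomain (δ := δ) hU xB
  refine ⟨fun y => -dirDeriv (0, EuclideanSpace.single i 1, 0) F
      (y.1, xB - xA, scaledParams s q y.2),
    (fun y : ℝ × ℝ => (y.1, xB - xA, scaledParams s q y.2)) ⁻¹' polarDomain δ U xB,
    hΩ.preimage hpol.continuous, fun l hl => polar_mem hδ hstar hxA hs q hl,
    ((ContDiffOn.dirDeriv hΩ hF _).comp hpol.contDiffOn fun y hy => hy).neg, ?_⟩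
  intro l t hlt hl _
  beta_reduce
  rw [segment_eq hxA.2]
  exact grad_polar hU hF hDF hDs hl hlt i

/-- On the segment the delay is `l F`, which is smooth up to `l = 0`. For `t = 0` it vanishes, so
the path is the Minkowskian null line in `O`, and openness of `O` gives a neighbourhood. -/
lemma lineSmooth_perturbation {O : Set Event} {T : ℝ → Event → Tensor} {tB : ℝ} (hδ : 0 < δ)
    (hO : IsOpen O) (hU : IsOpen U) (hstar : StarConvex ℝ xB U)
    (hline : ∀ x ∈ U, event (tB - ‖xB - x‖) x ∈ O) (hT : IsPerturbation δ O T)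
    (hD : IsRegularDelay δ U xB D) (hD0 : ∀ x ∈ U \ {xB}, D x 0 = 0) (hs : 1 ≤ s) (q : ℝ × ℝ)
    (hxA : xA ∈ U \ {xB}) (a : ℝ) {w : ℕ} (hw : 1 ≤ w) (μ ν : Fin 4) :
    LineSmooth fun l t => T (a * t ^ w)
      (delayedLine tB xA xB (fun y => D y (scaledParams s q t)) l) μ ν := by
  obtain ⟨F, hF, hDF⟩ := hD
  have hpol := contDiff_polar (xB - xA) s q
  have hΩ := isOpen_polarDomain (δ := δ) hU xB
  set Ω : Set (ℝ × ℝ) :=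
    (fun y : ℝ × ℝ => (y.1, xB - xA, scaledParams s q y.2)) ⁻¹' polarDomain δ U xB with hΩdef
  have hΩo : IsOpen Ω := hΩ.preimage hpol.continuous
  set Γ : ℝ × ℝ → ℝ × Event := fun y => (a * y.2 ^ w, event
    (tB - y.1 * ‖xB - xA‖ - y.1 * F (y.1, xB - xA, scaledParams s q y.2))
    (xB - y.1 • (xB - xA))) with hΓ
  have hFc : ContDiffOn ℝ ∞ (fun y : ℝ × ℝ => F (y.1, xB - xA, scaledParams s q y.2)) Ω :=
    hF.comp hpol.contDiffOn fun y hy => hy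
  have hΓc : ContDiffOn ℝ ∞ Γ Ω := by
    refine ContDiffOn.prodMk (by fun_prop) (contDiff_event.comp_contDiffOn
      (f := fun y : ℝ × ℝ => (tB - y.1 * ‖xB - xA‖ - y.1 * F (y.1, xB - xA, scaledParams s q y.2),
        xB - y.1 • (xB - xA))) (ContDiffOn.prodMk ?_ (by fun_prop)))
    exact (ContDiffOn.sub (by fun_prop) (contDiffOn_fst.mul hFc))
  refine ⟨fun y => T (Γ y).1 (Γ y).2 μ ν, Ω ∩ Γ ⁻¹' (Set.Ioo (-δ) δ ×ˢ O),
    hΓc.continuousOn.isOpen_inter_preimage hΩo (isOpen_Ioo.prod hO), ?_,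
    (hT.smooth μ ν).comp (hΓc.mono Set.inter_subset_left) fun y hy => hy.2, ?_⟩
  · intro l hl
    have hm := polar_mem hδ hstar hxA hs q hl
    refine ⟨hm, ?_, ?_⟩
    · simpa [hΓ, Nat.one_le_iff_ne_zero.1 hw] using hδ
    -- At `l = 0` the prefactor vanishes; for `l > 0` the product is the delay in the Minkowskian
    -- limit.
    · have h0 : l * F (l, xB - xA, scaledParams s q 0) = 0 := by
        rcases hl.1.eq_or_lt with rfl | hl0
        · simp
        · rw [← hDF l _ _ hl0 hm.1 hm.2.1 hm.2.2, scaledParams_zero hs]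
          exact hD0 _ ⟨hm.2.1, segment_ne hxA.2 hl0.ne'⟩
      simp only [hΓ, h0, sub_zero]
      rw [← norm_sub_segment xA xB hl.1]
      exact hline _ hm.2.1
  · intro l t hlt hl _
    have hm : (l, xB - xA, scaledParams s q t) ∈ polarDomain δ U xB := hlt.1
    have hd : delayedLine tB xA xB (fun y => D y (scaledParams s q t)) l = (Γ (l, t)).2 := by
      rw [delayedLine, segment_eq hxA.2, hDF l _ _ hl hm.1 hm.2.1 hm.2.2]
    beta_reduce
    rw [hd]

end Delay

/-! ### Smoothness of the integrands along the segment -/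

namespace LineSmooth

lemma contr0 {T : ℝ → ℝ → Tensor} (hT : ∀ μ ν, LineSmooth fun l t => T l t μ ν) (N : Position) :
    LineSmooth fun l t => OpticalDelay.contr0 (T l t) N :=
  ((hT 0 0).sub ((const 2).mul (sum Finset.univ fun i : Fin 3 =>
    (hT 0 i.succ).mul (const (N i))))).add (sum Finset.univ fun i : Fin 3 =>
      sum Finset.univ fun j : Fin 3 =>
        ((hT i.succ j.succ).mul (const (N i))).mul (const (N j)))

lemma contr1 {T : ℝ → ℝ → Tensor} (hT : ∀ μ ν, LineSmooth fun l t => T l t μ ν) (N : Position)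
    {a : ℝ → ℝ → Fin 3 → ℝ} (ha : ∀ i, LineSmooth fun l t => a l t i) :
    LineSmooth fun l t => OpticalDelay.contr1 (T l t) N (a l t) :=
  sum _ fun i => ((hT 0 i.succ).sub
    (sum _ fun j => (hT i.succ j.succ).mul (const (N j)))).mul (ha i)

lemma contr2 {T : ℝ → ℝ → Tensor} (hT : ∀ μ ν, LineSmooth fun l t => T l t μ ν)
    {a b : ℝ → ℝ → Fin 3 → ℝ} (ha : ∀ i, LineSmooth fun l t => a l t i)
    (hb : ∀ i, LineSmooth fun l t => b l t i) :
    LineSmooth fun l t => OpticalDelay.contr2 (T l t) (a l t) (b l t) :=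
  sum _ fun i => sum _ fun j => ((hT i.succ j.succ).mul (ha i)).mul (hb j)

lemma delayDensity {T : ℝ → ℝ → Tensor} (hT : ∀ μ ν, LineSmooth fun l t => T l t μ ν)
    (N : Position) {a : ℝ → ℝ → Fin 3 → ℝ} (ha : ∀ i, LineSmooth fun l t => a l t i) :
    LineSmooth fun l t => OpticalDelay.delayDensity N (T l t) (a l t) :=
  ((contr0 hT N).add ((const 2).mul (contr1 hT N ha))).add
    (contr2 (T := fun l t => eta + T l t) (fun μ ν => (const (eta μ ν)).add (hT μ ν)) ha ha)

lemma couplingPart {K k : ℝ → ℝ → Tensor} (hK : ∀ μ ν, LineSmooth fun l t => K l t μ ν)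
    (hk : ∀ μ ν, LineSmooth fun l t => k l t μ ν) (N : Position) {r g c : ℝ → ℝ → Fin 3 → ℝ}
    (hr : ∀ i, LineSmooth fun l t => r l t i) (hg : ∀ i, LineSmooth fun l t => g l t i)
    (hc : ∀ i, LineSmooth fun l t => c l t i) (i : Fin 8) :
    LineSmooth fun l t =>
      OpticalDelay.couplingPart N (K l t) (k l t) (r l t) (g l t) (c l t) i := by
  have he : ∀ μ ν, LineSmooth fun _ _ => eta μ ν := fun μ ν => const _
  fin_cases i
  · exact ((contr2 he hr hg).add (contr1 hK N hg)).add (contr1 hk N hr)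
  · exact (((contr2 he hr hc).add (contr1 hK N hc)).add (contr2 hK hr hg)).add
      ((const _).mul (contr2 hk hr hr))
  · exact contr2 hK hr hc
  · exact (((contr2 he hg hc).add (contr1 hk N hc)).add (contr2 hk hr hg)).add
      ((const _).mul (contr2 hK hg hg))
  · exact ((contr2 he hc hc).add ((const _).mul (contr2 hk hr hc))).add
      ((const _).mul (contr2 hK hg hc))
  · exact contr2 hK hc hc
  · exact contr2 hk hg hc
  · exact contr2 hk hc hc

end LineSmooth

/-- The terms of a delay in terms of those of the integrand of its delay equation. -/
lemma orderTerm_eq_integral {δ : ℝ} {U : Set Position} {xA xB : Position} {s : ℕ} {tB : ℝ}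
    (hδ : 0 < δ) (hU : IsOpen U) (hstar : StarConvex ℝ xB U) (hs : 1 ≤ s) (q : ℝ × ℝ)
    (hxA : xA ∈ U \ {xB}) {D Δ : Position → ℝ × ℝ → ℝ} (hD : IsRegularDelay δ U xB D)
    {T : ℝ × ℝ → Event → Tensor}
    (hT : ∀ μ ν, LineSmooth fun l t => T (scaledParams s q t)
      (delayedLine tB xA xB (fun y => Δ y (scaledParams s q t)) l) μ ν)
    (hsol : ∀ q ∈ params δ,
      SolvesDelayEquation (T q) U tB xB (fun x => Δ x q) (fun x => D x q)) (n : ℕ) :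
    orderTerm s n (D xA) q = ‖xB - xA‖ / 2 * ∫ l in (0 : ℝ)..1,
      taylorCoeff n fun t => delayDensity (dir xA xB) (T (scaledParams s q t)
        (delayedLine tB xA xB (fun y => Δ y (scaledParams s q t)) l))
        (grad (fun y => D y (scaledParams s q t)) (segment xA xB l)) := by
  rw [← LineSmooth.taylorCoeff_integral (LineSmooth.delayDensity hT (dir xA xB)
    (fun i => hD.lineSmooth_grad hδ hU hstar hs q hxA i)), orderTerm_eq, ← taylorCoeff_const_mul]
  -- Only germs at `t = 0` matter, and there the scaled parameters are admissible in the delay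
  -- equation.
  refine taylorCoeff_congr ?_ n
  filter_upwards [eventually_scaledParams_mem hδ hs q] with t ht using hsol _ ht xA hxA

lemma IsRegularDelay.sub {δ : ℝ} {U : Set Position} {xB : Position} {D D' : Position → ℝ × ℝ → ℝ}
    (hD : IsRegularDelay δ U xB D) (hD' : IsRegularDelay δ U xB D') :
    IsRegularDelay δ U xB fun x q => D x q - D' x q := by
  obtain ⟨F, hF, hDF⟩ := hD
  obtain ⟨F', hF', hDF'⟩ := hD'
  refine ⟨fun w => F w - F' w, hF.sub hF', fun r u q hr hu hU hq => ?_⟩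
  beta_reduce
  rw [hDF r u q hr hu hU hq, hDF' r u q hr hu hU hq, mul_sub]

/-- Regular solutions of the delay equations of the total, the gravitational and the refractive
delay. -/
structure IsDelaySystem (tB : ℝ) (xB : Position) (U : Set Position) (O : Set Event) (δ : ℝ)
    (κ k : ℝ → Event → Tensor) (Δ Δg Δr Δgr : Position → ℝ × ℝ → ℝ) : Prop where
  pos : 0 < δ
  isOpen_O : IsOpen O
  isOpen_U : IsOpen U
  star : StarConvex ℝ xB U
  line : ∀ x ∈ U, event (tB - ‖xB - x‖) x ∈ O
  pert_κ : IsPerturbation δ O κ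
  pert_k : IsPerturbation δ O k
  eqn : ∀ q ∈ params δ, SolvesDelayEquation (fun z => κ q.1 z + k q.2 z) U tB xB
    (fun x => Δ x q) (fun x => Δ x q)
  eqn_g : ∀ q ∈ params δ, SolvesDelayEquation (k q.2) U tB xB (fun x => Δ x q) (fun x => Δg x q)
  eqn_r : ∀ q ∈ params δ, SolvesDelayEquation (κ q.1) U tB xB (fun x => Δ x q) (fun x => Δr x q)
  split : ∀ x q, Δ x q = Δg x q + Δr x q + Δgr x q
  reg : IsRegularDelay δ U xB Δ
  reg_g : IsRegularDelay δ U xB Δg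
  reg_r : IsRegularDelay δ U xB Δr
  zero : ∀ x ∈ U \ {xB}, Δ x 0 = 0 ∧ Δg x 0 = 0 ∧ Δr x 0 = 0

/-! ### Lowest orders and terms of the delays -/

namespace IsDelaySystem

variable {tB : ℝ} {xB : Position} {U : Set Position} {O : Set Event} {δ : ℝ}
  {κ k : ℝ → Event → Tensor} {Δ Δg Δr Δgr : Position → ℝ × ℝ → ℝ} {s : ℕ}

lemma reg_gr (S : IsDelaySystem tB xB U O δ κ k Δ Δg Δr Δgr) : IsRegularDelay δ U xB Δgr := by
  have h := (S.reg.sub S.reg_g).sub S.reg_r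
  have : Δgr = fun x q => Δ x q - Δg x q - Δr x q := by
    funext x q; rw [S.split]; ring
  rwa [this]

lemma zero_gr (S : IsDelaySystem tB xB U O δ κ k Δ Δg Δr Δgr) {x : Position} (hx : x ∈ U \ {xB}) :
    Δgr x 0 = 0 := by
  have h := S.zero x hx
  have := S.split x 0
  rw [h.1, h.2.1, h.2.2] at this
  linarith

lemma orderTerm_zero {D : Position → ℝ × ℝ → ℝ} (hs : 1 ≤ s) (q : ℝ × ℝ) {x : Position}
    (h : D x 0 = 0) : orderTerm s 0 (D x) q = 0 := by
  rw [orderTerm_eq, taylorCoeff_zero, scaledParams_zero hs, h]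

lemma lineSmooth_κ (S : IsDelaySystem tB xB U O δ κ k Δ Δg Δr Δgr) (hs : 1 ≤ s) (q : ℝ × ℝ)
    {xA : Position} (hxA : xA ∈ U \ {xB}) (μ ν : Fin 4) :
    LineSmooth fun l t => κ (scaledParams s q t).1
      (delayedLine tB xA xB (fun y => Δ y (scaledParams s q t)) l) μ ν := by
  have := lineSmooth_perturbation S.pos S.isOpen_O S.isOpen_U S.star S.line S.pert_κ S.reg
    (fun x hx => (S.zero x hx).1) hs q hxA q.1 le_rfl μ ν
  simpa only [scaledParams, pow_one, mul_comm] using this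

lemma lineSmooth_k (S : IsDelaySystem tB xB U O δ κ k Δ Δg Δr Δgr) (hs : 1 ≤ s) (q : ℝ × ℝ)
    {xA : Position} (hxA : xA ∈ U \ {xB}) (μ ν : Fin 4) :
    LineSmooth fun l t => k (scaledParams s q t).2
      (delayedLine tB xA xB (fun y => Δ y (scaledParams s q t)) l) μ ν := by
  have := lineSmooth_perturbation S.pos S.isOpen_O S.isOpen_U S.star S.line S.pert_k S.reg
    (fun x hx => (S.zero x hx).1) hs q hxA q.2 hs μ ν
  simpa only [scaledParams, mul_comm] using this

lemma event_mem (S : IsDelaySystem tB xB U O δ κ k Δ Δg Δr Δgr) {xA : Position}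
    (hxA : xA ∈ U \ {xB}) {l : ℝ} (h0 : 0 < l) (h1 : l ≤ 1) :
    event (tB - l * ‖xB - xA‖) (segment xA xB l) ∈ O := by
  rw [segment_eq hxA.2, ← norm_sub_segment xA xB h0.le]
  exact S.line _ (segment_mem S.star hxA.1 h0.le h1)

lemma smoothGerm_segment (S : IsDelaySystem tB xB U O δ κ k Δ Δg Δr Δgr) (hs : 1 ≤ s) (q : ℝ × ℝ)
    {xA : Position} (hxA : xA ∈ U \ {xB}) {l : ℝ} (h0 : 0 < l) (h1 : l ≤ 1) :
    SmoothGerm (fun t => Δ (segment xA xB l) (scaledParams s q t)) ∧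
      Δ (segment xA xB l) (scaledParams s q 0) = 0 := by
  have hm := segment_mem_punctured S.star hxA h0 h1
  exact ⟨S.reg.smoothGerm S.pos S.isOpen_U hs q hm, by
    rw [scaledParams_zero hs]; exact (S.zero _ hm).1⟩

/-- The symmetry of the perturbations is available only in `O`, so the path has to stay there for
small `t`. -/
lemma eventually_delayedLine_mem (S : IsDelaySystem tB xB U O δ κ k Δ Δg Δr Δgr) (hs : 1 ≤ s)
    (q : ℝ × ℝ) {xA : Position} (hxA : xA ∈ U \ {xB}) {l : ℝ} (h0 : 0 < l) (h1 : l ≤ 1) :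
    ∀ᶠ t in 𝓝 (0 : ℝ), delayedLine tB xA xB (fun y => Δ y (scaledParams s q t)) l ∈ O := by
  obtain ⟨hd, hd0⟩ := S.smoothGerm_segment hs q hxA h0 h1
  have hc : ContinuousAt
      (fun t => tB - l * ‖xB - xA‖ - Δ (segment xA xB l) (scaledParams s q t)) 0 :=
    continuousAt_const.sub hd.continuousAt
  have := eventually_event_mem S.isOpen_O (S.event_mem hxA h0 h1)
  exact hc.eventually (p := fun τ => event τ (segment xA xB l) ∈ O) (by simpa only [hd0, sub_zero] using this)

lemma tensorExpansion_κ (S : IsDelaySystem tB xB U O δ κ k Δ Δg Δr Δgr) (hs : 1 ≤ s) (q : ℝ × ℝ)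
    {xA : Position} (hxA : xA ∈ U \ {xB}) {l : ℝ} (h0 : 0 < l) (h1 : l ≤ 1) :
    TensorExpansion (fun t => κ (scaledParams s q t).1
      (delayedLine tB xA xB (fun y => Δ y (scaledParams s q t)) l)) 1
      (fun m => kappaHat (powerTerm κ q.1) (fun n x => orderTerm s n (Δ x) q) m
        (tB - l * ‖xB - xA‖) (segment xA xB l)) := by
  obtain ⟨hd, hd0⟩ := S.smoothGerm_segment hs q hxA h0 h1
  have he := S.event_mem hxA h0 h1
  have hf : ∀ μ ν, (fun t => κ (scaledParams s q t).1
      (delayedLine tB xA xB (fun y => Δ y (scaledParams s q t)) l) μ ν)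
      = fun t => κ (q.1 * t ^ 1) (event (tB - l * ‖xB - xA‖
        - Δ (segment xA xB l) (scaledParams s q t)) (segment xA xB l)) μ ν := fun μ ν => by
    funext t
    rw [pow_one, mul_comm]
    rfl
  refine ⟨fun μ ν => VanishesTo.of_coeff ((S.lineSmooth_κ hs q hxA μ ν).smoothGerm h0 h1) ?_, ?_⟩
  · intro n hn
    rw [hf]
    exact taylorCoeff_delayed_of_lt S.pos S.isOpen_O S.pert_κ q.1 le_rfl he hd hd0 μ ν hn
  · intro m hm μ ν
    rw [hf, taylorCoeff_delayed_eq_kHat S.pos S.isOpen_O S.pert_κ q.1 le_rfl he hd hd0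
      (D := fun n x => orderTerm s n (Δ x) q) (fun j => rfl) μ ν hm, kHat_one]

lemma tensorExpansion_k (S : IsDelaySystem tB xB U O δ κ k Δ Δg Δr Δgr) (hs : 1 ≤ s) (q : ℝ × ℝ)
    {xA : Position} (hxA : xA ∈ U \ {xB}) {l : ℝ} (h0 : 0 < l) (h1 : l ≤ 1) :
    TensorExpansion (fun t => k (scaledParams s q t).2
      (delayedLine tB xA xB (fun y => Δ y (scaledParams s q t)) l)) s
      (fun m => kHat s (powerTerm k q.2) (fun n x => orderTerm s n (Δ x) q) m
        (tB - l * ‖xB - xA‖) (segment xA xB l)) := by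
  obtain ⟨hd, hd0⟩ := S.smoothGerm_segment hs q hxA h0 h1
  have he := S.event_mem hxA h0 h1
  have hf : ∀ μ ν, (fun t => k (scaledParams s q t).2
      (delayedLine tB xA xB (fun y => Δ y (scaledParams s q t)) l) μ ν)
      = fun t => k (q.2 * t ^ s) (event (tB - l * ‖xB - xA‖
        - Δ (segment xA xB l) (scaledParams s q t)) (segment xA xB l)) μ ν := fun μ ν => by
    funext t
    rw [mul_comm]
    rfl
  refine ⟨fun μ ν => VanishesTo.of_coeff ((S.lineSmooth_k hs q hxA μ ν).smoothGerm h0 h1) ?_, ?_⟩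
  · intro n hn
    rw [hf]
    exact taylorCoeff_delayed_of_lt S.pos S.isOpen_O S.pert_k q.2 hs he hd hd0 μ ν hn
  · intro m hm μ ν
    rw [hf, taylorCoeff_delayed_eq_kHat S.pos S.isOpen_O S.pert_k q.2 hs he hd hd0
      (D := fun n x => orderTerm s n (Δ x) q) (fun j => rfl) μ ν hm]

/-- A delay whose terms of order less than `n` vanish has a gradient with the same property. -/
lemma vanishesTo_grad (S : IsDelaySystem tB xB U O δ κ k Δ Δg Δr Δgr) (hs : 1 ≤ s) (q : ℝ × ℝ)
    {D : Position → ℝ × ℝ → ℝ} (hD : IsRegularDelay δ U xB D) {n : ℕ}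
    (h : ∀ m < n, ∀ x ∈ U \ {xB}, orderTerm s m (D x) q = 0) {xA : Position}
    (hxA : xA ∈ U \ {xB}) {l : ℝ} (h0 : 0 < l) (h1 : l ≤ 1) (i : Fin 3) :
    VanishesTo n fun t => grad (fun y => D y (scaledParams s q t)) (segment xA xB l) i := by
  have hm := segment_mem_punctured S.star hxA h0 h1
  refine VanishesTo.of_coeff
    ((hD.lineSmooth_grad S.pos S.isOpen_U S.star hs q hxA i).smoothGerm h0 h1) fun m hmn => ?_
  rw [hD.taylorCoeff_grad S.pos S.isOpen_U hs q hm]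
  exact grad_orderTerm_eq_zero S.isOpen_U (h m hmn) hm i

lemma covectorExpansion_grad (S : IsDelaySystem tB xB U O δ κ k Δ Δg Δr Δgr) (hs : 1 ≤ s)
    (q : ℝ × ℝ) {D : Position → ℝ × ℝ → ℝ} (hD : IsRegularDelay δ U xB D) {b : ℕ}
    (h : ∀ m < b + 1, ∀ x ∈ U \ {xB}, orderTerm s m (D x) q = 0) {xA : Position}
    (hxA : xA ∈ U \ {xB}) {l : ℝ} (h0 : 0 < l) (h1 : l ≤ 1) :
    CovectorExpansion (fun t => grad (fun y => D y (scaledParams s q t)) (segment xA xB l)) b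
      fun p => grad (fun x => orderTerm s (p + b) (D x) q) (segment xA xB l) :=
  ⟨S.vanishesTo_grad hs q hD h hxA h0 h1, fun p _ i =>
    hD.taylorCoeff_grad S.pos S.isOpen_U hs q (segment_mem_punctured S.star hxA h0 h1) (p + b) i⟩

/-- The gravitational delay has no terms of order less than `s`. -/
lemma orderTerm_g_eq_zero (S : IsDelaySystem tB xB U O δ κ k Δ Δg Δr Δgr) (hs : 1 ≤ s)
    (q : ℝ × ℝ) {n : ℕ} (hn : n < s) {x : Position} (hx : x ∈ U \ {xB}) :
    orderTerm s n (Δg x) q = 0 := by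
  -- The induction runs over all positions at once, because gradients of lower terms vanish only if
  -- these terms vanish on a whole neighbourhood.
  induction n using Nat.strong_induction_on generalizing x with
  | _ n ih =>
  rcases Nat.eq_zero_or_pos n with rfl | hn0
  · exact orderTerm_zero hs q (S.zero x hx).2.1
  rw [orderTerm_eq_integral S.pos S.isOpen_U S.star hs q hx S.reg_g
    (T := fun q => k q.2) (S.lineSmooth_k hs q hx) S.eqn_g n]
  have : ∀ l ∈ Set.uIoc (0 : ℝ) 1, taylorCoeff n (fun t => delayDensity (dir x xB)
      (k (scaledParams s q t).2 (delayedLine tB x xB (fun y => Δ y (scaledParams s q t)) l))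
      (grad (fun y => Δg y (scaledParams s q t)) (segment x xB l))) = 0 := by
    intro l hl
    rw [Set.uIoc_of_le zero_le_one] at hl
    exact (VanishesTo.delayDensity hn0 hn (dir x xB)
      (S.tensorExpansion_k hs q hx hl.1 hl.2).vanishes
      (S.vanishesTo_grad hs q S.reg_g (fun m hm y hy => ih m hm (hm.trans hn) hy) hx hl.1 hl.2)
      ).coeff_eq_zero (Nat.lt_succ_self n)
  rw [intervalIntegral.integral_congr_ae (g := fun _ => 0)
    (Filter.Eventually.of_forall this)]
  simp

lemma grad_split (S : IsDelaySystem tB xB U O δ κ k Δ Δg Δr Δgr) {q : ℝ × ℝ} (hq : q ∈ params δ)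
    {x : Position} (hx : x ∈ U \ {xB}) :
    grad (fun y => Δ y q) x = grad (fun y => Δr y q) x + grad (fun y => Δg y q) x
      + grad (fun y => Δgr y q) x := by
  have h1 := S.reg_r.differentiableAt S.isOpen_U hq hx
  have h2 := S.reg_g.differentiableAt S.isOpen_U hq hx
  have h3 := S.reg_gr.differentiableAt S.isOpen_U hq hx
  have : (fun y => Δ y q) = fun y => Δr y q + Δg y q + Δgr y q := by
    funext y; rw [S.split]; ring
  funext i
  rw [this, grad, fderiv_fun_add (h1.fun_add h2) h3, fderiv_fun_add h1 h2]
  rfl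

lemma orderTerm_split (S : IsDelaySystem tB xB U O δ κ k Δ Δg Δr Δgr) (hs : 1 ≤ s) (q : ℝ × ℝ)
    {x : Position} (hx : x ∈ U \ {xB}) (n : ℕ) :
    orderTerm s n (Δ x) q
      = orderTerm s n (Δr x) q + orderTerm s n (Δg x) q + orderTerm s n (Δgr x) q := by
  have h1 := S.reg_r.smoothGerm S.pos S.isOpen_U hs q hx
  have h2 := S.reg_g.smoothGerm S.pos S.isOpen_U hs q hx
  have h3 := S.reg_gr.smoothGerm S.pos S.isOpen_U hs q hx
  simp only [orderTerm_eq]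
  rw [← taylorCoeff_add h1 h2, ← taylorCoeff_add (h1.add h2) h3]
  congr 1
  funext t
  rw [S.split]; ring

/-- The terms of the coupling delay in terms of those of the coupling integrand. -/
lemma orderTerm_gr_eq (S : IsDelaySystem tB xB U O δ κ k Δ Δg Δr Δgr) (hs : 1 ≤ s) (q : ℝ × ℝ)
    {xA : Position} (hxA : xA ∈ U \ {xB}) (n : ℕ) :
    orderTerm s n (Δgr xA) q = ‖xB - xA‖ * ∑ i, couplingWeight i * ∫ l in (0 : ℝ)..1,
      taylorCoeff n fun t => couplingPart (dir xA xB)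
        (κ (scaledParams s q t).1 (delayedLine tB xA xB (fun y => Δ y (scaledParams s q t)) l))
        (k (scaledParams s q t).2 (delayedLine tB xA xB (fun y => Δ y (scaledParams s q t)) l))
        (grad (fun y => Δr y (scaledParams s q t)) (segment xA xB l))
        (grad (fun y => Δg y (scaledParams s q t)) (segment xA xB l))
        (grad (fun y => Δgr y (scaledParams s q t)) (segment xA xB l)) i := by
  have hκ := S.lineSmooth_κ hs q hxA
  have hk := S.lineSmooth_k hs q hxA
  have hκk : ∀ μ ν, LineSmooth fun l t => (κ (scaledParams s q t).1
      (delayedLine tB xA xB (fun y => Δ y (scaledParams s q t)) l) + k (scaledParams s q t).2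
      (delayedLine tB xA xB (fun y => Δ y (scaledParams s q t)) l)) μ ν := fun μ ν =>
    (hκ μ ν).add (hk μ ν)
  have hG := fun {D : Position → ℝ × ℝ → ℝ} (hD : IsRegularDelay δ U xB D) (i : Fin 3) =>
    hD.lineSmooth_grad S.pos S.isOpen_U S.star hs q hxA i
  have e := S.orderTerm_split hs q hxA n
  have e0 := orderTerm_eq_integral S.pos S.isOpen_U S.star hs q hxA S.reg
    (T := fun q z => κ q.1 z + k q.2 z) hκk S.eqn n
  have e1 := orderTerm_eq_integral S.pos S.isOpen_U S.star hs q hxA S.reg_g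
    (T := fun q => k q.2) hk S.eqn_g n
  have e2 := orderTerm_eq_integral S.pos S.isOpen_U S.star hs q hxA S.reg_r
    (T := fun q => κ q.1) hκ S.eqn_r n
  have L0 := LineSmooth.delayDensity hκk (dir xA xB) (hG S.reg)
  have L1 := LineSmooth.delayDensity hk (dir xA xB) (hG S.reg_g)
  have L2 := LineSmooth.delayDensity hκ (dir xA xB) (hG S.reg_r)
  have Lp := LineSmooth.couplingPart hκ hk (dir xA xB) (hG S.reg_r) (hG S.reg_g) (hG S.reg_gr)
  have hI0 := L0.intervalIntegrable_taylorCoeff n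
  have hI1 := L1.intervalIntegrable_taylorCoeff n
  have hI2 := L2.intervalIntegrable_taylorCoeff n
  have hIp := fun i => (Lp i).intervalIntegrable_taylorCoeff n
  have key : orderTerm s n (Δgr xA) q = orderTerm s n (Δ xA) q - orderTerm s n (Δg xA) q
      - orderTerm s n (Δr xA) q := by linarith
  -- The three equations have the same prefactor and path, so their difference is the integral of a
  -- single difference of densities.
  rw [key, e0, e1, e2, ← mul_sub, ← mul_sub, ← intervalIntegral.integral_sub hI0 hI1,
    ← intervalIntegral.integral_sub (hI0.sub hI1) hI2]
  simp only [← intervalIntegral.integral_const_mul]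
  rw [← intervalIntegral.integral_finsetSum fun i _ => (hIp i).const_mul _,
    ← intervalIntegral.integral_const_mul]
  refine intervalIntegral.integral_congr_ae (Filter.Eventually.of_forall fun l hl => ?_)
  rw [Set.uIoc_of_le zero_le_one] at hl
  have s0 := L0.smoothGerm hl.1 hl.2
  have s1 := L1.smoothGerm hl.1 hl.2
  have s2 := L2.smoothGerm hl.1 hl.2
  have sp := fun i => (Lp i).smoothGerm hl.1 hl.2
  have hsp : ∀ i, SmoothGerm fun t => couplingWeight i * couplingPart (dir xA xB)
        (κ (scaledParams s q t).1 (delayedLine tB xA xB (fun y => Δ y (scaledParams s q t)) l))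
        (k (scaledParams s q t).2 (delayedLine tB xA xB (fun y => Δ y (scaledParams s q t)) l))
        (grad (fun y => Δr y (scaledParams s q t)) (segment xA xB l))
        (grad (fun y => Δg y (scaledParams s q t)) (segment xA xB l))
        (grad (fun y => Δgr y (scaledParams s q t)) (segment xA xB l)) i := fun i =>
    contDiffAt_const.mul (sp i)
  beta_reduce
  simp only [← coeff_jet]
  rw [← map_sub, ← map_sub, ← jet_sub s0 s1, ← jet_sub (s0.sub s1) s2]
  simp only [← PowerSeries.coeff_C_mul, ← jet_const_mul, ← map_sum]
  rw [← jet_sum _ fun i _ => hsp i]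
  rw [← jet_const_mul]
  congr 1
  refine jet_congr ?_
  -- For small `t` the gradients add up and the tensors are symmetric, so the algebraic identity
  -- `delayDensity_sub` applies.
  filter_upwards [eventually_scaledParams_mem S.pos hs q,
    S.eventually_delayedLine_mem hs q hxA hl.1 hl.2] with t ht htO
  rw [S.grad_split ht (segment_mem_punctured S.star hxA hl.1 hl.2),
    delayDensity_sub _ (S.pert_κ.symm _ ht.1 _ htO) (S.pert_k.symm _ ht.2 _ htO)]
  ring

/-- The coupling delay has no terms of order at most `s`. -/
lemma orderTerm_gr_eq_zero (S : IsDelaySystem tB xB U O δ κ k Δ Δg Δr Δgr) (hs : 1 ≤ s)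
    (q : ℝ × ℝ) {n : ℕ} (hn : n ≤ s) {x : Position} (hx : x ∈ U \ {xB}) :
    orderTerm s n (Δgr x) q = 0 := by
  -- The same scheme as for the gravitational delay. It reaches `n = s`, because here every term of
  -- the integrand has a second factor of positive order.
  induction n using Nat.strong_induction_on generalizing x with
  | _ n ih =>
  rcases Nat.eq_zero_or_pos n with rfl | hn0
  · exact orderTerm_zero hs q (S.zero_gr hx)
  rw [S.orderTerm_gr_eq hs q hx]
  refine mul_eq_zero_of_right _ (Finset.sum_eq_zero fun i _ => mul_eq_zero_of_right _ ?_)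
  rw [intervalIntegral.integral_congr_ae (g := fun _ => 0)
    (Filter.Eventually.of_forall fun l hl => ?_)]
  · simp
  rw [Set.uIoc_of_le zero_le_one] at hl
  exact (VanishesTo.couplingPart hs hn0 hn (dir x xB)
    (S.tensorExpansion_κ hs q hx hl.1 hl.2).vanishes
    (S.tensorExpansion_k hs q hx hl.1 hl.2).vanishes
    (S.vanishesTo_grad hs q S.reg_r (fun m hm y hy => by
      obtain rfl : m = 0 := by omega
      exact orderTerm_zero hs q (S.zero y hy).2.2) hx hl.1 hl.2)
    (S.vanishesTo_grad hs q S.reg_g (fun m hm y hy => S.orderTerm_g_eq_zero hs q hm hy)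
      hx hl.1 hl.2)
    (S.vanishesTo_grad hs q S.reg_gr (fun m hm y hy => ih m hm (hm.le.trans hn) hy)
      hx hl.1 hl.2) i).coeff_eq_zero (Nat.lt_succ_self n)

/-- The terms of the coupling delay are sums of line integrals. -/
lemma orderTerm_gr_eq_couplingIntegral (S : IsDelaySystem tB xB U O δ κ k Δ Δg Δr Δgr)
    (hs : 1 ≤ s) (q : ℝ × ℝ) {xA : Position} (hxA : xA ∈ U \ {xB}) (l : ℕ) :
    orderTerm s (l + s) (Δgr xA) q
      = couplingIntegral ‖xB - xA‖ (lineData s κ k q tB xA xB Δ Δr Δg Δgr) s l := by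
  rw [S.orderTerm_gr_eq hs q hxA, couplingIntegral_eq _ _ hs]
  congr 1
  refine Finset.sum_congr rfl fun i _ => ?_
  congr 1
  refine intervalIntegral.integral_congr_ae (Filter.Eventually.of_forall fun t ht => ?_)
  rw [Set.uIoc_of_le zero_le_one] at ht
  refine taylorCoeff_couplingPart hs (lineData s κ k q tB xA xB Δ Δr Δg Δgr t)
    (S.tensorExpansion_κ hs q hxA ht.1 ht.2) (S.tensorExpansion_k hs q hxA ht.1 ht.2)
    (S.covectorExpansion_grad hs q S.reg_r (fun m hm y hy => by
      obtain rfl : m = 0 := by omega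
      exact orderTerm_zero hs q (S.zero y hy).2.2) hxA ht.1 ht.2) ?_
    (S.covectorExpansion_grad hs q S.reg_gr
      (fun m hm y hy => S.orderTerm_gr_eq_zero hs q (by omega) hy) hxA ht.1 ht.2) l i
  have h := S.covectorExpansion_grad hs q S.reg_g (b := s - 1)
    (fun m hm y hy => S.orderTerm_g_eq_zero hs q (by omega) hy) hxA ht.1 ht.2
  -- The line data write the order as `p + s - 1`, the expansion as `p + (s - 1)`.
  simp only [← Nat.add_sub_assoc hs] at h
  exact h

end IsDelaySystem

/-! ### Convergence of the expansion of an analytic function of the parameters -/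

/-- The part of the power series `p` at `q` in which the arguments in the set `x.2` are `(0, q.2)`
and the other ones are `(q.1, 0)`. -/
def mixedTerm (p : FormalMultilinearSeries ℝ (ℝ × ℝ) ℝ) (x : Σ n, Finset (Fin n)) (q : ℝ × ℝ) : ℝ :=
  p x.1 (x.2.piecewise (fun _ => (0, q.2)) fun _ => (q.1, 0))

/-- The order of `mixedTerm p x`, where the second parameter counts for order `s`. -/
def mixedOrder (s : ℕ) (x : Σ n, Finset (Fin n)) : ℕ := ∑ i, if i ∈ x.2 then s else 1

variable {p : FormalMultilinearSeries ℝ (ℝ × ℝ) ℝ} {s : ℕ}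

/-- Multilinear expansion at `q = (0, q.2) + (q.1, 0)`. -/
lemma sum_mixedTerm (n : ℕ) (q : ℝ × ℝ) : ∑ A, mixedTerm p ⟨n, A⟩ q = p n fun _ => q := by
  have h := (p n).map_add_univ (fun _ => ((0 : ℝ), q.2)) (fun _ => (q.1, (0 : ℝ)))
  rw [show ((fun _ => ((0 : ℝ), q.2)) + fun _ => (q.1, (0 : ℝ)) : Fin n → ℝ × ℝ) = fun _ => q by
    funext i; simp] at h
  exact h.symm

/-- Every argument `(0, q.2)` contributes a factor `tˢ`, every argument `(q.1, 0)` a factor `t`. -/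
lemma mixedTerm_scaledParams (x : Σ n, Finset (Fin n)) (q : ℝ × ℝ) (t : ℝ) :
    mixedTerm p x (scaledParams s q t) = t ^ mixedOrder s x * mixedTerm p x q := by
  obtain ⟨n, A⟩ := x
  have h : A.piecewise (fun _ => ((0 : ℝ), (scaledParams s q t).2))
      (fun _ => ((scaledParams s q t).1, (0 : ℝ)))
      = fun i => t ^ (if i ∈ A then s else 1) •
        A.piecewise (fun _ => ((0 : ℝ), q.2)) (fun _ => (q.1, (0 : ℝ))) i := by
    funext i
    by_cases hi : i ∈ A <;> simp [hi, scaledParams]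
  rw [mixedTerm, h, ContinuousMultilinearMap.map_smul_univ, Finset.prod_pow_eq_pow_sum]
  rfl

lemma norm_mixedTerm_le (n : ℕ) (A : Finset (Fin n)) (q : ℝ × ℝ) :
    ‖mixedTerm p ⟨n, A⟩ q‖ ≤ ‖p n‖ * ‖q‖ ^ n := by
  refine ((p n).le_opNorm _).trans (mul_le_mul_of_nonneg_left ?_ (norm_nonneg _))
  refine (Finset.prod_le_prod (fun _ _ => norm_nonneg _) fun i _ => ?_).trans
    (by rw [Finset.prod_const, Finset.card_univ, Fintype.card_fin])
  by_cases hi : i ∈ A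
  · simp [hi, Prod.norm_def]
  · simp [hi, Prod.norm_def]

/-- The `2ⁿ` terms of degree `n` are each at most `‖p n‖ ‖q‖ⁿ`; this is why `2 ‖q‖`, rather than
`‖q‖`, must stay below the radius of convergence. -/
lemma summable_mixedTerm {q : ℝ × ℝ} {ρ : NNReal} (hρ : ρ < p.radius) (hq : 2 * ‖q‖ ≤ ρ) :
    Summable fun x => mixedTerm p x q := by
  refine Summable.of_norm ((summable_sigma_of_nonneg fun _ => norm_nonneg _).2
    ⟨fun n => (hasSum_fintype _).summable, ?_⟩)
  refine Summable.of_nonneg_of_le (fun n => tsum_nonneg fun _ => norm_nonneg _) (fun n => ?_)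
    (p.summable_norm_mul_pow hρ)
  rw [tsum_fintype]
  calc ∑ A, ‖mixedTerm p ⟨n, A⟩ q‖ ≤ ∑ _A : Finset (Fin n), ‖p n‖ * ‖q‖ ^ n :=
        Finset.sum_le_sum fun A _ => norm_mixedTerm_le n A q
    _ = ‖p n‖ * (2 * ‖q‖) ^ n := by
        simp [mul_pow]; ring
    _ ≤ ‖p n‖ * ρ ^ n := by gcongr

/-- The sum of the terms of order `m`. -/
def mixedSum (p : FormalMultilinearSeries ℝ (ℝ × ℝ) ℝ) (s m : ℕ) (q : ℝ × ℝ) : ℝ :=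
  ∑' x : {x // mixedOrder s x = m}, mixedTerm p x q

lemma mixedSum_scaledParams (m : ℕ) (q : ℝ × ℝ) (t : ℝ) :
    mixedSum p s m (scaledParams s q t) = t ^ m * mixedSum p s m q := by
  rw [mixedSum, mixedSum, ← tsum_mul_left]
  exact tsum_congr fun x => by rw [mixedTerm_scaledParams, x.2]

/-- One absolutely summable family is summed in two ways: by degree, which gives the value of `f`,
and by order. -/
lemma hasSum_mixedSum {f : ℝ × ℝ → ℝ} {r : ENNReal} (hf : HasFPowerSeriesOnBall f p 0 r)
    {q : ℝ × ℝ} {ρ : NNReal} (hρ : ρ < r) (hq : 2 * ‖q‖ ≤ ρ) :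
    HasSum (fun m => mixedSum p s m q) (f q) := by
  have hs := summable_mixedTerm (hρ.trans_le hf.r_le) hq
  have hqr : q ∈ Metric.eball (0 : ℝ × ℝ) r := by
    rw [Metric.mem_eball, edist_zero_right]
    refine lt_of_le_of_lt ?_ hρ
    rw [← ofReal_norm, ← ENNReal.ofReal_coe_nnreal]
    exact ENNReal.ofReal_le_ofReal (by linarith [norm_nonneg q])
  have h1 := hs.hasSum.sigma (g := fun n => p n fun _ => q) fun n => by
    rw [← sum_mixedTerm]
    exact hasSum_fintype _
  have h2 := hf.hasSum hqr
  rw [zero_add] at h2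
  have h3 : HasSum (fun x => mixedTerm p x q) (f q) := h1.unique h2 ▸ hs.hasSum
  have h4 := (Equiv.sigmaFiberEquiv (mixedOrder s)).hasSum_iff.2 h3
  exact h4.sigma fun m => (h4.summable.sigma_factor m).hasSum

lemma norm_scaledParams_le (q : ℝ × ℝ) {t : ℝ} (ht : |t| ≤ 1) :
    ‖scaledParams s q t‖ ≤ ‖q‖ := by
  refine max_le_max ?_ ?_
  · simpa [scaledParams, abs_mul] using mul_le_of_le_one_left (abs_nonneg q.1) ht
  · simpa [scaledParams, abs_mul] using
      mul_le_of_le_one_left (abs_nonneg q.2) (pow_le_one₀ (n := s) (abs_nonneg t) ht)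

/-- Both the sums of mixed terms and the parts of `f` are the coefficients of the power series of `t
↦ f (t N₀, tˢ G)`; this series is shown to converge for `|t| ≤ 1`, and it is evaluated at `t = 1`.
-/
lemma eventually_hasSum_orderTerm {f : ℝ × ℝ → ℝ} (hf : AnalyticAt ℝ f 0) :
    ∀ᶠ q in 𝓝 (0 : ℝ × ℝ), HasSum (fun m => orderTerm s m f q) (f q) := by
  obtain ⟨p, r, hp⟩ := hf
  obtain ⟨ρ, hρ0, hρ⟩ := ENNReal.lt_iff_exists_nnreal_btwn.1 hp.r_pos
  have hρ0' : (0 : ℝ) < ρ := by exact_mod_cast hρ0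
  filter_upwards [Metric.ball_mem_nhds (0 : ℝ × ℝ) (half_pos hρ0')] with q hq
  rw [mem_ball_zero_iff] at hq
  have hsum : ∀ t : ℝ, |t| ≤ 1 →
      HasSum (fun m => t ^ m * mixedSum p s m q) (f (scaledParams s q t)) := fun t ht => by
    have := hasSum_mixedSum (s := s) hp hρ
      (q := scaledParams s q t) (by linarith [norm_scaledParams_le (s := s) q ht])
    simpa only [mixedSum_scaledParams] using this
  have hpow : HasFPowerSeriesAt (fun t => f (scaledParams s q t))
      (FormalMultilinearSeries.ofScalars ℝ fun m => mixedSum p s m q) 0 := by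
    rw [hasFPowerSeriesAt_iff]
    filter_upwards [Metric.ball_mem_nhds (0 : ℝ) one_pos] with t ht
    rw [mem_ball_zero_iff] at ht
    simpa [FormalMultilinearSeries.coeff_ofScalars] using hsum t ht.le
  -- Uniqueness of the power series of an analytic function of one variable.
  have hcoeff : ∀ m, mixedSum p s m q = orderTerm s m f q := fun m => by
    have h := congrArg (fun P => FormalMultilinearSeries.coeff P m)
      (hpow.eq_formalMultilinearSeries hpow.analyticAt.hasFPowerSeriesAt)
    simp only [FormalMultilinearSeries.coeff_ofScalars] at h
    exact h
  have h1 := hsum 1 (by simp)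
  simp only [one_pow, one_mul, hcoeff] at h1
  simpa [scaledParams] using h1

/-- A function of the parameters which is smooth along the scalings and has no terms of order at
most `w` is the sum of its terms of order greater than `w`. -/
lemma hasExpansion {f : ℝ × ℝ → ℝ} {w : ℕ} (hf : ∀ q, SmoothGerm fun t => f (scaledParams s q t))
    (h0 : ∀ q, ∀ n ≤ w, orderTerm s n f q = 0) : HasExpansion s w f := by
  refine ⟨fun q L => ?_, fun ha => ?_⟩
  · have h := (hf q).taylor_isBigO (w + 1 + L)
    have hsplit : ∀ t : ℝ, ∑ n ∈ Finset.range (w + 1 + L),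
        taylorCoeff n (fun t => f (scaledParams s q t)) * t ^ n
        = ∑ l ∈ Finset.range L, orderTerm s (l + 1 + w) f q * t ^ (l + 1 + w) := fun t => by
      rw [Finset.sum_range_add, Finset.sum_eq_zero fun n hn => ?_, zero_add]
      · refine Finset.sum_congr rfl fun l _ => ?_
        rw [show w + 1 + l = l + 1 + w by ring]
        rfl
      · exact mul_eq_zero_of_left (h0 q n (Nat.lt_succ_iff.1 (Finset.mem_range.1 hn))) _
    simp only [hsplit] at h
    rw [show w + 1 + L = L + 1 + w by ring] at h
    exact h
  -- The first `w + 1` terms vanish and may be removed from the convergent series.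
  · filter_upwards [eventually_hasSum_orderTerm ha] with q hq
    have h := (hasSum_nat_add_iff' (w + 1)).2 hq
    rw [Finset.sum_eq_zero fun n hn => h0 q n (Nat.lt_succ_iff.1 (Finset.mem_range.1 hn)),
      sub_zero] at h
    simpa only [add_assoc, add_comm, add_left_comm] using h

end OpticalDelay

end

/-! ### The expansions of the four delays -/

theorem theorem10
    -- coordinates of the reception event, emission positions, region of spacetime, parameters
    (tB : ℝ) (xB : Position) (U : Set Position) (O : Set Event) (δ : ℝ)
    (hδ : 0 < δ) (hO : IsOpen O) (hU : IsOpen U) (hxB : xB ∈ U) (hstar : StarConvex ℝ xB U)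
    (hline : ∀ x ∈ U, event (tB - ‖xB - x‖) x ∈ O)
    -- refractive and gravitational perturbations of the contravariant metric
    (κ k : ℝ → Event → Tensor) (hκ : IsPerturbation δ O κ) (hk : IsPerturbation δ O k)
    -- reception delay `Δ`: range transfer function minus Euclidean distance
    (Δ : Position → ℝ × ℝ → ℝ)
    (hrange : ∀ q ∈ params δ,
      IsReceptionRange (opticalMetric κ k q) O U tB xB (fun x => ‖xB - x‖ + Δ x q))
    -- gravitational, refractive and coupling parts
    (Δg Δr Δgr : Position → ℝ × ℝ → ℝ)
    (hg : ∀ q ∈ params δ,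
      SolvesDelayEquation (k q.2) U tB xB (fun x => Δ x q) (fun x => Δg x q))
    (hr : ∀ q ∈ params δ,
      SolvesDelayEquation (κ q.1) U tB xB (fun x => Δ x q) (fun x => Δr x q))
    (hgr : ∀ x q, Δ x q = Δg x q + Δr x q + Δgr x q)
    -- quasi-Minkowskian regime: regular delays which vanish in the Minkowskian limit
    (hregΔ : IsRegularDelay δ U xB Δ) (hregg : IsRegularDelay δ U xB Δg)
    (hregr : IsRegularDelay δ U xB Δr)
    (hzero : ∀ x ∈ U \ {xB}, Δ x 0 = 0 ∧ Δg x 0 = 0 ∧ Δr x 0 = 0)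
    -- relative order of the two parameters, emission position
    (s : ℕ) (hs : 1 ≤ s) (xA : Position) (hxA : xA ∈ U) (hAB : xA ≠ xB) :
    (HasExpansion s 0 (Δ xA) ∧ HasExpansion s 0 (Δr xA) ∧ HasExpansion s (s - 1) (Δg xA)) ∧
    (∀ (q : ℝ × ℝ) (l : ℕ), 1 ≤ l →
      orderTerm s l (Δ xA) q = orderTerm s l (Δr xA) q
        + (if s ≤ l then orderTerm s ((l - s + 1) + s - 1) (Δg xA) q else 0)
        + (if s + 1 ≤ l then orderTerm s ((l - s) + s) (Δgr xA) q else 0)) ∧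
    HasExpansion s s (Δgr xA) ∧
    (∀ (q : ℝ × ℝ) (l : ℕ), 1 ≤ l →
      orderTerm s (l + s) (Δgr xA) q =
        couplingIntegral ‖xB - xA‖ (lineData s κ k q tB xA xB Δ Δr Δg Δgr) s l) := by
  -- The light rays enter only through the delay equation of the total delay.
  have S : IsDelaySystem tB xB U O δ κ k Δ Δg Δr Δgr :=
    ⟨hδ, hO, hU, hstar, hline, hκ, hk,
      fun q hq => total_delay_equation hO hU hstar hκ hk hregΔ hq (hrange q hq),
      hg, hr, hgr, hregΔ, hregg, hregr, hzero⟩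
  have hx : xA ∈ U \ {xB} := ⟨hxA, hAB⟩
  have germ : ∀ {D : Position → ℝ × ℝ → ℝ}, IsRegularDelay δ U xB D → ∀ q,
      SmoothGerm fun t => D xA (scaledParams s q t) := fun hD q => hD.smoothGerm hδ hU hs q hx
  have first : ∀ {D : Position → ℝ × ℝ → ℝ}, D xA 0 = 0 → ∀ q, ∀ n ≤ 0,
      orderTerm s n (D xA) q = 0 := fun h q n hn => by
    rw [Nat.le_zero.1 hn]
    exact IsDelaySystem.orderTerm_zero hs q h
  have h0 := hzero xA hx
  refine ⟨⟨hasExpansion (germ hregΔ) (first h0.1), hasExpansion (germ hregr) (first h0.2.2),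
    hasExpansion (germ hregg) fun q n hn => S.orderTerm_g_eq_zero hs q (by omega) hx⟩, ?_,
    hasExpansion (germ S.reg_gr) fun q n hn => S.orderTerm_gr_eq_zero hs q hn hx,
    fun q l _ => S.orderTerm_gr_eq_couplingIntegral hs q hx l⟩
  intro q l _
  rw [S.orderTerm_split hs q hx]
  congr 1
  · congr 1
    -- Below the bounds the parts of `Δ_g` and `Δ_gr` of order `l` are zero, so the conditions only
    -- record the lowest orders.
    split_ifs with h
    · rw [show l - s + 1 + s - 1 = l by omega]
    · exact S.orderTerm_g_eq_zero hs q (by omega) hx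
  · split_ifs with h
    · rw [Nat.sub_add_cancel (by omega)]
    · exact S.orderTerm_gr_eq_zero hs q (by omega) hx
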